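/- Let $(M^3,J,\theta)$ be a strictly pseudoconvex pseudohermitian three-manifold: $H=\ker\theta\subset TM$ carries a smooth complex structure $J$, and $d\theta=ih_{1\bar 1}\theta^1\wedge\theta^{\bar 1}$ with $h_{1\bar 1}>0$, where $T$ is the Reeb field ($\theta(T)=1$, $T\lrcorner d\theta=0$) and $\{\theta,\theta^1,\theta^{\bar 1}\}$ is dual to $\{T,Z_1,Z_{\bar 1}\}$ for a local frame $Z_1$ of the $+i$-eigenbundle $T^{1,0}$ of $J$. Let $\nabla$ be the Tanaka--Webster connection and $A_{\alpha\beta}$ the torsion, determined by $d\theta^1=\theta^1\wedge\omega_1{}^1+\theta\wedge\tau^1$, $\tau_1=A_{11}\theta^1$, $\omega_{1\bar 1}+\omega_{\bar 1 1}=dh_{1\bar 1}$, and let $R$ be the pseudohermitian scalar curvature, $d\omega_1{}^1=R\,h_{1\bar 1}\theta^1\wedge\theta^{\bar 1}$ mod $\theta$. Indices are raised and lowered with $h$. For real $f\in C^\infty(M)$ put \[ \Delta_b f=-(\nabla^\alpha\nabla_\alpha f+\nabla_\alpha\nabla^\alpha f),\qquad P_\alpha f=\nabla_\alpha\nabla_\beta\nabla^\beta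 f+iA_{\alpha\beta}\nabla^\beta f, \] \[ P_4f=\Delta_b^2f+T^2f-4\,\mathrm{Im}\,\nabla^\alpha(A_{\alpha\beta}\nabla^\beta f), \] \[ \begin{aligned} P_4'f={}&4\Delta_b^2f-8\,\mathrm{Im}\,\nabla^\alpha(A_{\alpha\beta}\nabla^\beta f)-4\,\mathrm{Re}\,\nabla^\alpha(R\nabla_\alpha f)\\ &+\tfrac83\,\mathrm{Re}\bigl((\nabla_\alpha R-i\nabla^\beta A_{\alpha\beta})\nabla^\alpha f\bigr)+\tfrac23\bigl(\Delta_bR-2\,\mathrm{Im}\,\nabla^\alpha\nabla^\beta A_{\alpha\beta}\bigr)f . \end{aligned} \] Let $\sigma\in C^\infty(M)$ be real, and let $\widehat{P_4'}$ be the operator $P_4'$ defined by the contact form $\hat\theta=e^\sigma\theta$. (All these scalar operators may be computed in any local frame of $T^{1,0}$, with different frames for $\theta$ and $\hat\theta$ allowed.) Then \[ e^{2\sigma}\widehat{P_4'}(f)=P_4'(f)+P_4(f\sigma)-\sigma P_4(f)-16\,\mathrm{Re}\bigl(P_\alpha f\,\nabla^\alpha\sigma\bigr) \] for all $f\in C^\infty(M)$.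 Moreover, for a given $f\in C^\infty(M)$, the simple covariance law \[ e^{2\sigma}\widehat{P_4'}(f)=P_4'(f)+P_4(f\sigma) \] holds for all $\sigma\in C^\infty(M)$ if and only if $f$ is CR pluriharmonic, i.e. locally the real part of a smooth CR function (a complex function $v$ with $\nabla_{\bar\alpha}v=0$). -/

import Mathlib

open scoped Manifold ContDiff

noncomputable section

namespace CRGeometry

/-- The model space of three-dimensional manifolds. -/
abbrev E3 : Type := EuclideanSpace ℝ (Fin 3)

section Calculus

variable {M : Type*} [TopologicalSpace M] [ChartedSpace E3 M]
  [IsManifold (𝓡 3) ∞ M]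

/-- A vector field on `M` (no regularity assumed) is smooth on `U`. -/
def SmoothFieldOn (X : ∀ x : M, TangentSpace (𝓡 3) x) (U : Set M) : Prop :=
  ContMDiffOn (𝓡 3) (𝓡 3).tangent ∞ (fun x => (⟨x, X x⟩ : TangentBundle (𝓡 3) M)) U

variable (M) in
/-- A complex vector field `re + i im`, i.e. a section of `ℂ ⊗ TM`. -/
@[ext]
structure CField where
  re : ∀ x : M, TangentSpace (𝓡 3) x
  im : ∀ x : M, TangentSpace (𝓡 3) x

/-- The complex vector field given by a real one. -/
def CField.ofReal (X : ∀ x : M, TangentSpace (𝓡 3) x) : CField M := ⟨X, fun _ => 0⟩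

/-- The complex conjugate of a complex vector field. -/
def CField.conj (V : CField M) : CField M := ⟨V.re, fun x => -V.im x⟩

/-- Smoothness of a complex vector field on a set. -/
def CField.SmoothOn (V : CField M) (U : Set M) : Prop :=
  SmoothFieldOn V.re U ∧ SmoothFieldOn V.im U

/-- The Lie bracket, extended complex bilinearly to complex vector fields. -/
def CField.bracket (V W : CField M) : CField M where
  re x := VectorField.mlieBracket (𝓡 3) V.re W.re x - VectorField.mlieBracket (𝓡 3) V.im W.im x
  im x := VectorField.mlieBracket (𝓡 3) V.re W.im x + VectorField.mlieBracket (𝓡 3) V.im W.re x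

variable (M) in
/-- A complex valued one-form on `M`. -/
abbrev CForm : Type _ := ∀ x : M, TangentSpace (𝓡 3) x →L[ℝ] ℂ

/-- A complex one-form applied (complex linearly) to a complex vector field. -/
def CForm.app (φ : CForm M) (V : CField M) (x : M) : ℂ :=
  φ x (V.re x) + Complex.I * φ x (V.im x)

/-- The conjugate one-form, `φ̄(V) = conj (φ (V̄))`. -/
def CForm.conj (φ : CForm M) : CForm M := fun x =>
  (Complex.conjCLE : ℂ →L[ℝ] ℂ).comp (φ x)

/-- A real one-form viewed as a complex one. -/
def CForm.ofReal (φ : ∀ x : M, TangentSpace (𝓡 3) x →L[ℝ] ℝ) : CForm M := fun x =>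
  Complex.ofRealCLM.comp (φ x)

/-- The differential of a complex valued function. -/
def dFun (u : M → ℂ) : CForm M := fun x => mfderiv (𝓡 3) 𝓘(ℝ, ℂ) u x

/-- The derivative `V u` of a function along a complex vector field. -/
def CField.act (V : CField M) (u : M → ℂ) : M → ℂ := (dFun u).app V

/-- The exterior derivative of a one-form, evaluated on two vector fields:
`dφ(V, W) = V (φ W) - W (φ V) - φ [V, W]`. -/
def dForm (φ : CForm M) (V W : CField M) (x : M) : ℂ :=
  V.act (φ.app W) x - W.act (φ.app V) x - φ.app (V.bracket W) x

end Calculus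

/-- A CR structure on a three-manifold: a smooth rank two subbundle `H` of the tangent bundle with
a smooth complex structure `J` on it, given by local frames `X, Y = J X` of `H`. Formal
integrability of `J` is automatic in this dimension, and (maximal) nonintegrability of `H` is part
of the existence of a contact form, see `ContactForm`. -/
structure CRStructure (M : Type*) [TopologicalSpace M] [ChartedSpace E3 M]
  [IsManifold (𝓡 3) ∞ M] where
  H : ∀ x : M, Submodule ℝ (TangentSpace (𝓡 3) x)
  J : ∀ x : M, H x →ₗ[ℝ] H x
  J_sq : ∀ (x : M) (v : H x), J x (J x v) = -v
  local_frame : ∀ p : M, ∃ U : Set M, IsOpen U ∧ p ∈ U ∧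
    ∃ X Y : ∀ x : M, TangentSpace (𝓡 3) x, SmoothFieldOn X U ∧ SmoothFieldOn Y U ∧
      ∀ x ∈ U, X x ≠ 0 ∧ H x = Submodule.span ℝ {X x, Y x} ∧
        ∃ hX : X x ∈ H x, ((J x ⟨X x, hX⟩ : H x) : TangentSpace (𝓡 3) x) = Y x

section

variable {M : Type*} [TopologicalSpace M] [ChartedSpace E3 M]
  [IsManifold (𝓡 3) ∞ M]

/-- A local frame `Z = Z₁` of the bundle `T^{1,0}` of `+i`-eigenvectors of `J`, over an open set
`U`. The `(1,0)`-vectors are exactly those of the form `X - i J X` with `X` in `H`. -/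
structure CRStructure.Frame (S : CRStructure M) where
  U : Set M
  isOpen : IsOpen U
  Z : CField M
  smooth : Z.SmoothOn U
  ne_zero : ∀ x ∈ U, Z.re x ≠ 0
  one_zero : ∀ x ∈ U, ∃ h : Z.re x ∈ S.H x,
    Z.im x = -((S.J x ⟨Z.re x, h⟩ : S.H x) : TangentSpace (𝓡 3) x)

/-- Every point lies in the domain of a local frame. -/
theorem CRStructure.exists_frame (S : CRStructure M) (p : M) : ∃ Z : S.Frame, p ∈ Z.U := by
  obtain ⟨U, hU, hp, X, Y, hX, hY, h⟩ := S.local_frame p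
  refine ⟨⟨U, hU, CField.conj ⟨X, Y⟩, ⟨hX, ?_⟩, fun x hx => (h x hx).1, fun x hx => ?_⟩, hp⟩
  · exact ContMDiffOn.neg_section (V := fun x : M => TangentSpace (𝓡 3) x) hY
  · obtain ⟨-, -, hm, e⟩ := h x hx
    exact ⟨hm, by simp only [CField.conj, e]⟩

/-- A CR function on `U`: a smooth complex function annihilated by all `(0,1)`-vectors
`w + i J w`, `w ∈ H`. -/
def CRStructure.IsCRFunctionOn (S : CRStructure M) (v : M → ℂ) (U : Set M) : Prop :=
  ContMDiffOn (𝓡 3) 𝓘(ℝ, ℂ) ∞ v U ∧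
    ∀ x ∈ U, ∀ w : S.H x,
      dFun v x (w : TangentSpace (𝓡 3) x)
        + Complex.I * dFun v x ((S.J x w : S.H x) : TangentSpace (𝓡 3) x) = 0

/-- CR pluriharmonic functions: smooth real functions that are locally the real part of a
CR function. -/
def CRStructure.IsPluriharmonic (S : CRStructure M) (f : M → ℝ) : Prop :=
  ContMDiff (𝓡 3) 𝓘(ℝ, ℝ) ∞ f ∧
    ∀ p : M, ∃ U : Set M, IsOpen U ∧ p ∈ U ∧
      ∃ v : M → ℂ, S.IsCRFunctionOn v U ∧ ∀ x ∈ U, f x = (v x).re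

/-- A contact form `θ` on a strictly pseudoconvex CR three-manifold: a smooth real one-form with
kernel `H`, whose Levi form `h`, given in a local frame by `dθ(Z, Z̄) = i h`, is positive (for
`Z = X - i J X` one has `h = 2 dθ(X, J X)`). -/
structure ContactForm (S : CRStructure M) where
  form : ∀ x : M, TangentSpace (𝓡 3) x →L[ℝ] ℝ
  smooth : ContMDiff (𝓡 3) ((𝓡 3).prod 𝓘(ℝ, E3 →L[ℝ] ℝ)) ∞
    (fun x => Bundle.TotalSpace.mk' (E3 →L[ℝ] ℝ)
      (E := fun x : M => TangentSpace (𝓡 3) x →L[ℝ] Bundle.Trivial M ℝ x) x (form x))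
  ker : ∀ (x : M) (v : TangentSpace (𝓡 3) x), form x v = 0 ↔ v ∈ S.H x
  levi_pos : ∀ (Z : S.Frame), ∀ x ∈ Z.U,
    0 < (-Complex.I * dForm (CForm.ofReal form) Z.Z Z.Z.conj x).re

namespace ContactForm

variable {S : CRStructure M}

/-- The contact form `e^σ θ`. -/
def rescale (θ : ContactForm S) (σ : M → ℝ) (hσ : ContMDiff (𝓡 3) 𝓘(ℝ, ℝ) ∞ σ) :
    ContactForm S where
  form x := Real.exp (σ x) • θ.form x
  smooth := ContMDiff.smul_section (V := fun x : M => TangentSpace (𝓡 3) x →L[ℝ] Bundle.Trivial M ℝ x)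
    (Real.contDiff_exp.contMDiff.comp hσ) θ.smooth
  ker x v := by
    rw [← θ.ker x v]
    simp [Real.exp_ne_zero]
  levi_pos Z x hx := by
    have key : ∀ (φ : CForm M), (∀ y ∈ Z.U, φ.app Z.Z y = 0 ∧ φ.app Z.Z.conj y = 0) →
        dForm φ Z.Z Z.Z.conj x = -φ.app (Z.Z.bracket Z.Z.conj) x := by
      intro φ h
      have hn : Z.U ∈ nhds x := Z.isOpen.mem_nhds hx
      have h1 : φ.app Z.Z =ᶠ[nhds x] fun _ => (0 : ℂ) := by
        filter_upwards [hn] with y hy using (h y hy).1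
      have h2 : φ.app Z.Z.conj =ᶠ[nhds x] fun _ => (0 : ℂ) := by
        filter_upwards [hn] with y hy using (h y hy).2
      have d1 : dFun (φ.app Z.Z) x = 0 := by
        unfold dFun; rw [h1.mfderiv_eq]; exact mfderiv_const
      have d2 : dFun (φ.app Z.Z.conj) x = 0 := by
        unfold dFun; rw [h2.mfderiv_eq]; exact mfderiv_const
      have e1 : Z.Z.act (φ.app Z.Z.conj) x = 0 := by
        change dFun (φ.app Z.Z.conj) x _ + Complex.I * dFun (φ.app Z.Z.conj) x _ = 0
        simp [d2]
      have e2 : Z.Z.conj.act (φ.app Z.Z) x = 0 := by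
        change dFun (φ.app Z.Z) x _ + Complex.I * dFun (φ.app Z.Z) x _ = 0
        simp [d1]
      unfold dForm
      rw [e1, e2]; ring
    have hz : ∀ y ∈ Z.U, θ.form y (Z.Z.re y) = 0 ∧ θ.form y (Z.Z.im y) = 0 := by
      intro y hy
      obtain ⟨hm, e⟩ := Z.one_zero y hy
      refine ⟨(θ.ker y _).2 hm, (θ.ker y _).2 ?_⟩
      rw [e]
      exact (S.H y).neg_mem (S.J y ⟨Z.Z.re y, hm⟩).2
    have k1 := key (CForm.ofReal θ.form) (fun y hy => by
      obtain ⟨a, b⟩ := hz y hy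
      simp [CForm.app, CForm.ofReal, CField.conj, a, b])
    have k2 := key (CForm.ofReal fun y => Real.exp (σ y) • θ.form y) (fun y hy => by
      obtain ⟨a, b⟩ := hz y hy
      simp [CForm.app, CForm.ofReal, CField.conj, a, b])
    have k3 : (CForm.ofReal fun y => Real.exp (σ y) • θ.form y).app (Z.Z.bracket Z.Z.conj) x
        = (Real.exp (σ x) : ℂ) * (CForm.ofReal θ.form).app (Z.Z.bracket Z.Z.conj) x := by
      simp only [CForm.app, CForm.ofReal, ContinuousLinearMap.comp_apply,
        smul_apply, Complex.ofRealCLM_apply, smul_eq_mul, Complex.ofReal_mul]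
      ring
    have hp := θ.levi_pos Z x hx
    rw [k1] at hp
    rw [k2, k3]
    have : -Complex.I * -((Real.exp (σ x) : ℂ) *
        (CForm.ofReal θ.form).app (Z.Z.bracket Z.Z.conj) x)
        = (Real.exp (σ x) : ℂ) * (-Complex.I *
          -(CForm.ofReal θ.form).app (Z.Z.bracket Z.Z.conj) x) := by ring
    rw [this, Complex.re_ofReal_mul]
    exact mul_pos (Real.exp_pos _) hp

/-- The form `θ`, as a complex valued form. -/
abbrev formC (θ : ContactForm S) : CForm M := CForm.ofReal θ.form

/-- `T` is the Reeb vector field of `θ`: it is smooth, `θ(T) = 1` and `T ⌟ dθ = 0`. -/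
def IsReeb (θ : ContactForm S) (T : ∀ x : M, TangentSpace (𝓡 3) x) : Prop :=
  SmoothFieldOn T Set.univ ∧ (∀ x, θ.form x (T x) = 1) ∧
    ∀ (U : Set M) (V : CField M), IsOpen U → V.SmoothOn U →
      ∀ x ∈ U, dForm θ.formC (CField.ofReal T) V x = 0

/-- The Reeb vector field of `θ` (it exists and is unique). -/
def reeb (θ : ContactForm S) : CField M :=
  CField.ofReal (Classical.epsilon θ.IsReeb)

variable (θ : ContactForm S) (Z : S.Frame)

/-- The Levi form `h = h_{1 1̄}` in the frame `Z`, where `dθ = i h θ¹ ∧ θ^{1̄}`. -/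
def levi (x : M) : ℂ := -Complex.I * dForm θ.formC Z.Z Z.Z.conj x

/-- The admissible coframe `θ¹` dual to `Z`: on the domain of `Z` it is the unique form with
`θ¹(Z) = 1`, `θ¹(Z̄) = 0`, `θ¹(T) = 0`. -/
def coframe : CForm M := fun x => Classical.epsilon fun φ : TangentSpace (𝓡 3) x →L[ℝ] ℂ =>
  φ (Z.Z.re x) + Complex.I * φ (Z.Z.im x) = 1 ∧
  φ (Z.Z.re x) - Complex.I * φ (Z.Z.im x) = 0 ∧
  φ (θ.reeb.re x) = 0

/-- The component `ω(Z̄)` of the connection form `ω = ω₁¹`: evaluating the structure equation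
`dθ¹ = θ¹ ∧ ω + θ ∧ τ¹` (with `τ¹` a multiple of `θ^{1̄}`) on `(Z, Z̄)` gives
`ω(Z̄) = θ¹([Z̄, Z])`. -/
def connZbar (x : M) : ℂ := (θ.coframe Z).app (Z.Z.conj.bracket Z.Z) x

/-- The component `ω(T) = θ¹([T, Z])`, from the structure equation evaluated on `(T, Z)`. -/
def connT (x : M) : ℂ := (θ.coframe Z).app (θ.reeb.bracket Z.Z) x

/-- The component `ω(Z)`, from the compatibility `h ω + h ω̄ = dh` with the Levi form. -/
def connZ (x : M) : ℂ :=
  (θ.levi Z x)⁻¹ * Z.Z.act (θ.levi Z) x - (starRingEnd ℂ) (θ.connZbar Z x)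

/-- The connection form `ω = ω₁¹` of the Tanaka-Webster connection, `∇Z = ω ⊗ Z`. -/
def conn : CForm M := fun x =>
  θ.connZ Z x • θ.coframe Z x + θ.connZbar Z x • (θ.coframe Z).conj x
    + θ.connT Z x • θ.formC x

/-- The torsion component `A = A_{1 1}`. The structure equation evaluated on `(T, Z̄)` gives
`A^1_{1̄} = -θ¹([T, Z̄])`, and `A_{1 1}` is the conjugate of `h A^1_{1̄}`. -/
def torsion (x : M) : ℂ :=
  -θ.levi Z x * (starRingEnd ℂ) ((θ.coframe Z).app (θ.reeb.bracket Z.Z.conj) x)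

/-- The pseudohermitian scalar curvature `R = h^{1 1̄} R_{1 1̄}`, where
`dω = R_{1 1̄} θ¹ ∧ θ^{1̄} mod θ`. It is real valued. -/
def scalarCurv (x : M) : ℂ := (θ.levi Z x)⁻¹ * dForm (θ.conn Z) Z.Z Z.Z.conj x

/-- `∇₁ τ` for (the component in the frame `Z` of) a tensor `τ` with `p` lower minus upper
unbarred indices: `∇_V τ = V τ - p ω(V) τ`. The result has `p + 1` indices. -/
def nablaDown (p : ℤ) (τ : M → ℂ) (x : M) : ℂ :=
  Z.Z.act τ x - p * (θ.conn Z).app Z.Z x * τ x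

/-- `∇¹ τ = h^{1 1̄} ∇_{1̄} τ` for a tensor `τ` with `p` lower minus upper unbarred indices.
The result has `p - 1` indices. -/
def nablaUp (p : ℤ) (τ : M → ℂ) (x : M) : ℂ :=
  (θ.levi Z x)⁻¹ * (Z.Z.conj.act τ x - p * (θ.conn Z).app Z.Z.conj x * τ x)

/-- The sublaplacian `Δ_b u = -(∇^α ∇_α u + ∇_α ∇^α u)`. -/
def sublaplacian (u : M → ℂ) (x : M) : ℂ :=
  -(θ.nablaUp Z 1 (θ.nablaDown Z 0 u) x + θ.nablaDown Z (-1) (θ.nablaUp Z 0 u) x)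

/-- `∇^α (A_{αβ} ∇^β u)`. -/
def divTorsionGrad (u : M → ℂ) (x : M) : ℂ :=
  θ.nablaUp Z 1 (fun y => θ.torsion Z y * θ.nablaUp Z 0 u y) x

/-- The CR Paneitz operator
`P₄ f = Δ_b² f + ∇₀² f - 4 Im ∇^α (A_{αβ} ∇^β f)` on real functions. -/
def paneitz (f : M → ℝ) (x : M) : ℝ :=
  (θ.sublaplacian Z (θ.sublaplacian Z (fun y => (f y : ℂ))) x).re
    + (θ.reeb.act (θ.reeb.act (fun y => (f y : ℂ))) x).re
    - 4 * (θ.divTorsionGrad Z (fun y => (f y : ℂ)) x).im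

/-- The third order operator `P_α f = ∇_α ∇_β ∇^β f + i A_{αβ} ∇^β f`. -/
def thirdOrder (f : M → ℝ) (x : M) : ℂ :=
  θ.nablaDown Z 0 (θ.nablaDown Z (-1) (θ.nablaUp Z 0 (fun y => (f y : ℂ)))) x
    + Complex.I * θ.torsion Z x * θ.nablaUp Z 0 (fun y => (f y : ℂ)) x

/-- The critical `P'`-operator, given by its local formula on all smooth real functions:
`P₄' f = 4 Δ_b² f - 8 Im ∇^α (A_{αβ} ∇^β f) - 4 Re ∇^α (R ∇_α f)
  + (8/3) Re ((∇_α R - i ∇^β A_{αβ}) ∇^α f) + (2/3) (Δ_b R - 2 Im ∇^α ∇^β A_{αβ}) f`. -/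
def paneitzPrime (f : M → ℝ) (x : M) : ℝ :=
  4 * (θ.sublaplacian Z (θ.sublaplacian Z (fun y => (f y : ℂ))) x).re
    - 8 * (θ.divTorsionGrad Z (fun y => (f y : ℂ)) x).im
    - 4 * (θ.nablaUp Z 1
        (fun y => θ.scalarCurv Z y * θ.nablaDown Z 0 (fun y => (f y : ℂ)) y) x).re
    + 8 / 3 * ((θ.nablaDown Z 0 (θ.scalarCurv Z) x
        - Complex.I * θ.nablaUp Z 2 (θ.torsion Z) x) * θ.nablaUp Z 0 (fun y => (f y : ℂ)) x).re
    + 2 / 3 * ((θ.sublaplacian Z (θ.scalarCurv Z) x).re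
        - 2 * (θ.nablaUp Z 1 (θ.nablaUp Z 2 (θ.torsion Z)) x).im) * f x

/-- The pairing `P_α f ∇^α σ`. -/
def thirdOrderPairing (f σ : M → ℝ) (x : M) : ℂ :=
  θ.thirdOrder Z f x * θ.nablaUp Z 0 (fun y => (σ y : ℂ)) x

end ContactForm

end

end CRGeometry

end

open CRGeometry

set_option linter.unusedSectionVars false
set_option linter.unusedSimpArgs false
-- The transformation law. In a local frame `Z` a tensor with p lower minus upper unbarred indices
-- is one function, and ∇_V acts on it as V − p ω(V). Recording p as the exponent of a variable t
-- makes tensors of all degrees into Laurent polynomials over the smooth functions on the domain of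
-- `Z`, a model of functions on the frame bundle. There ∇₁, ∇¹, ∇₀ and the degree are derivations
-- `D`, `U`, `T`, `W`, subject to a short list of commutation relations with curvature and torsion
-- as coefficients (`WebsterCalculus`). If the same `Z` is kept for e^σ θ, the new `D`, `U`, R and A
-- are explicit expressions in the old ones and σ. Substituting them into P₄' and normal ordering
-- all derivatives leaves a polynomial identity, `WebsterCalculus.prime_rescale`.
--
-- The geometry supplies the input. Lie brackets of Z, Z̄, T and the Jacobi identity give the
-- relations (`frameEquations`, `FrameEquations.websterCalculus`); the Reeb field of e^σ θ is
-- computed, and with it the new connection, torsion and curvature (`coframe_app_reeb_rescale`,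
-- `torsion_rescale`, `scalarCurv_rescale`). Conjugation symmetry identifies the real operators with
-- their complexifications (`ofReal_paneitz`, `ofReal_paneitzPrime`), and
-- `paneitzPrime_eq_of_frames` allows a different frame for e^σ θ.
--
-- The characterization. By the law, simple covariance for all σ means σ P₄f + 16 Re(P_αf ∇^ασ) = 0
-- for all σ. Taking σ that vanishes at a point with prescribed gradient there gives P_αf = 0;
-- conversely P_αf = 0 is enough, because P₄f = 4∇^αP_αf (`WebsterCalculus.paneitz_eq`). It remains
-- to see that P_αf = 0 exactly when f is CR pluriharmonic (`isPluriharmonic_iff`). If f = Re v with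
-- v CR, then P_α kills v since ∇^βv = 0, and kills v̄ by the commutation relations. If P_αf = 0,
-- the form i(∂̄_b − ∂_b)f + (Δ_b f)θ is closed: its (Z, Z̄) component vanishes by the choice of the
-- θ-coefficient, and its (T, Z) and (T, Z̄) components are multiples of P_αf and its conjugate. The
-- Poincaré lemma gives a local primitive g, and f + i Re g is a CR function.
noncomputable section

/-! ### Part: the operators as words in abstract derivations. -/

section FrameBundleCalculus

/-- The imaginary unit of a complex algebra. -/
def imUnit (B : Type*) [CommRing B] [Algebra ℂ B] : B := algebraMap ℂ B Complex.I

variable {B : Type*} [CommRing B] [Algebra ℂ B]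

theorem imUnit_sq : imUnit B ^ 2 = -1 := by
  rw [imUnit, ← map_pow, Complex.I_sq, map_neg, map_one]

theorem Derivation.map_imUnit (D : Derivation ℂ B B) : D (imUnit B) = 0 :=
  D.map_algebraMap _

theorem Derivation.map_ofNat' (D : Derivation ℂ B B) (n : ℕ) [n.AtLeastTwo] :
    D (ofNat(n) : B) = 0 :=
  D.map_natCast n

/-- The Tanaka-Webster calculus in the algebra of functions on the frame bundle: `D = ∇₁` and
`U = ∇¹`, `T = ∇₀`, and `W` is the weight of a tensor. -/
structure WebsterCalculus (D U T W : Derivation ℂ B B) (R A A' : B) : Prop where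
  comm_DU : ∀ x, D (U x) = U (D x) - imUnit B * T x - R * W x
  comm_TD : ∀ x, T (D x) = D (T x) - A * U x + U A * W x
  comm_TU : ∀ x, T (U x) = U (T x) - A' * D x - D A' * W x
  comm_WD : ∀ x, W (D x) = D (W x) + D x
  comm_WU : ∀ x, W (U x) = U (W x) - U x
  comm_WT : ∀ x, W (T x) = T (W x)
  weight_R : W R = 0
  weight_A : W A = 2 * A
  weight_A' : W A' = -(2 * A')

namespace WebsterCalculus

/-- The sublaplacian on functions. -/
def lap (D U : B → B) (f : B) : B := -(U (D f) + D (U f))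

/-- The third order operator `P_α f`. -/
def third (D U : B → B) (A f : B) : B := D (D (U f)) + imUnit B * (A * U f)

/-- The CR Paneitz operator, real parts written out. -/
def paneitz (D U T : B → B) (A A' f : B) : B :=
  lap D U (lap D U f) + T (T f) + 2 * imUnit B * (U (A * U f) - D (A' * D f))

/-- Three times the `P'`-operator, real parts written out. -/
def prime (D U : B → B) (R A A' f : B) : B :=
  12 * lap D U (lap D U f) + 12 * imUnit B * (U (A * U f) - D (A' * D f))
    - 6 * (U (R * D f) + D (R * U f))
    + 4 * ((D R - imUnit B * U A) * U f + (U R + imUnit B * D A') * D f)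
    + 2 * ((lap D U R + imUnit B * (U (U A) - D (D A'))) * f)

variable {D U T W : Derivation ℂ B B} {R A A' : B}

theorem third_add (f g : B) : third D U A (f + g) = third D U A f + third D U A g := by
  simp only [third, map_add]
  ring

theorem third_eq_zero_of_U (f : B) (hf : U f = 0) : third D U A f = 0 := by
  simp [third, hf]

/-- Meant for conjugates of CR functions. If `D f = 0`, the commutators give `D (U f) = -i T f` and
`D (T f) = A * U f`, so the two terms of P_α f cancel. -/
theorem third_eq_zero_of_D (H : WebsterCalculus D U T W R A A') (f : B) (hW : W f = 0)
    (hf : D f = 0) : third D U A f = 0 := by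
  have h1 := H.comm_TD f
  have h2 := congrArg D (H.comm_DU f)
  simp only [hf, hW, map_zero, mul_zero, sub_zero, zero_sub, map_neg, add_zero,
    Derivation.leibniz, Derivation.map_imUnit, smul_eq_mul] at h1 h2
  rw [third, h2]
  linear_combination imUnit B * h1

/-- On functions Δ_b = −(2UD − iT), so its square contains −T², which cancels the T² of P₄; the rest
is a divergence. -/
theorem paneitz_eq (H : WebsterCalculus D U T W R A A') (f : B) (hW : W f = 0) :
    paneitz D U T A A' f = 4 * U (third D U A f) := by
  simp only [paneitz, third, lap, H.comm_DU, H.comm_TD, H.comm_TU, H.comm_WD, H.comm_WU,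
    H.comm_WT, hW, map_add, map_sub, map_neg, Derivation.leibniz, Derivation.map_imUnit,
    map_zero, smul_eq_mul, mul_zero, zero_add, add_zero, sub_zero]
  linear_combination (T (T f)) * imUnit_sq (B := B)

/-- Integrability of the system for the conjugate of `f`. -/
theorem closed_of_third_eq_zero (H : WebsterCalculus D U T W R A A') (f : B) (hW : W f = 0)
    (hf : third D U A f = 0) :
    T (-(imUnit B * D f)) - D (lap D U f) + A * (imUnit B * U f) = 0 := by
  have h := H.comm_TD f
  have h2 := congrArg D (H.comm_DU f)
  simp only [third, lap, hW, mul_zero, add_zero, sub_zero, map_sub, map_add, map_neg,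
    Derivation.leibniz, Derivation.map_imUnit, smul_eq_mul] at h h2 hf ⊢
  -- Modulo the two commutators the left side is exactly 2 P_α f.
  linear_combination -imUnit B * h + 2 * hf - h2

/-- Transformation of the `P'`-operator under `θ ↦ e^σ θ`; here `E = e^{-σ}`. -/
theorem prime_rescale (H : WebsterCalculus D U T W R A A') {f s E : B} {D' U' : B → B} {R' A₁ A₂ : B}
    (hW : W f = 0) (hs : W s = 0) (hE : W E = 0)
    (hDE : D E = -(E * D s)) (hUE : U E = -(E * U s))
    (hD : ∀ x, D' x = D x - 2 * (D s * W x)) (hU : ∀ x, U' x = E * (U x + U s * W x))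
    (hR : R' = E * (R - 2 * (U (D s) + D (U s)) - 2 * (D s * U s)))
    (hA₁ : A₁ = A + imUnit B * (D (D s) - D s ^ 2))
    (hA₂ : A₂ = E ^ 2 * (A' - imUnit B * (U (U s) - U s ^ 2))) :
    prime D' U' R' A₁ A₂ f = E ^ 2 * (prime D U R A A' f + 3 * paneitz D U T A A' (f * s)
      - 3 * s * paneitz D U T A A' f - 24 * (third D U A f * U s
        + (U (U (D f)) - imUnit B * (A' * D f)) * D s)) := by
  -- The commutators are used as a rewriting system: `U` is moved outermost, then `D`, then `T`,
  -- while `W` is pushed onto the generators. Both sides become polynomials in the ordered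
  -- derivatives of f, s, R, A, A', which are then compared as free variables.
  simp only [prime, paneitz, third, lap, hR, hA₁, hA₂, hD, hU, Derivation.map_ofNat',
    H.comm_DU, H.comm_TD, H.comm_TU, H.comm_WD, H.comm_WU,
    H.comm_WT, H.weight_R, H.weight_A, H.weight_A', hW, hs, hE, hDE, hUE, pow_two, map_add, map_sub,
    map_neg, Derivation.leibniz, Derivation.map_imUnit,
    map_zero, smul_eq_mul, mul_zero, zero_add, add_zero, sub_zero]
  -- `ring` treats i as a free variable, so its powers are reduced explicitly.
  have i3 : imUnit B ^ 3 = -imUnit B := by linear_combination imUnit B * imUnit_sq (B := B)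
  have i4 : imUnit B ^ 4 = 1 := by linear_combination (imUnit B ^ 2 - 1) * imUnit_sq (B := B)
  ring_nf
  simp only [imUnit_sq, i3, i4]
  ring

end WebsterCalculus

end FrameBundleCalculus
end

noncomputable section

/-! ### Part: tensors of all degrees as Laurent polynomials, and the covariant derivatives on them.
-/

section LaurentLift

open LaurentPolynomial

variable {A : Type*} [CommRing A]

theorem LaurentPolynomial.induction_single {P : A[T;T⁻¹] → Prop} (x : A[T;T⁻¹])
    (add : ∀ x y, P x → P y → P (x + y))
    (single : ∀ (p : ℤ) (τ : A), P (AddMonoidAlgebra.single p τ)) : P x :=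
  LaurentPolynomial.induction_on' x add fun n a => single_eq_C_mul_T a n ▸ single n a

variable [Algebra ℂ A]

/-- The additive map underlying `laurentLift`. -/
def laurentLiftHom (δ : Derivation ℂ A A) (β : A) (k : ℤ) : A[T;T⁻¹] →+ A[T;T⁻¹] :=
  (Finsupp.liftAddHom fun p : ℤ =>
    (AddMonoidAlgebra.singleAddHom (p + k)).comp
      ((δ : A →+ A) + AddMonoidHom.mulLeft ((p : A) * β))).comp
    AddMonoidAlgebra.coeffAddEquiv.toAddMonoidHom

theorem laurentLiftHom_single (δ : Derivation ℂ A A) (β : A) (k p : ℤ) (τ : A) :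
    laurentLiftHom δ β k (.single p τ) = .single (p + k) (δ τ + p * β * τ) := by
  rw [laurentLiftHom, AddMonoidHom.comp_apply]
  exact Finsupp.liftAddHom_apply_single _ _ _

/-- The derivation `τ t^p ↦ (δ τ + p β τ) t^(p+k)` of the Laurent polynomials. -/
def laurentLift (δ : Derivation ℂ A A) (β : A) (k : ℤ) : Derivation ℂ A[T;T⁻¹] A[T;T⁻¹] :=
  Derivation.mk'
    { toFun := laurentLiftHom δ β k
      map_add' := map_add _
      map_smul' := fun z x => by
        induction x using LaurentPolynomial.induction_single with
        | add x y hx hy => simp only [smul_add, map_add, hx, hy]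
        | single p τ =>
          rw [AddMonoidAlgebra.smul_single, laurentLiftHom_single, laurentLiftHom_single,
            RingHom.id_apply, AddMonoidAlgebra.smul_single]
          congr 1
          rw [Derivation.map_smul, smul_add, mul_smul_comm] }
    (fun x y => by
      change laurentLiftHom δ β k (x * y) = x * laurentLiftHom δ β k y + y * laurentLiftHom δ β k x
      induction x using LaurentPolynomial.induction_single with
      | add x x' hx hx' => simp only [add_mul, mul_add, map_add, hx, hx']; ring
      | single p τ =>
        induction y using LaurentPolynomial.induction_single with
        | add y y' hy hy' => simp only [add_mul, mul_add, map_add, hy, hy']; ring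
        | single q υ =>
          rw [AddMonoidAlgebra.single_mul_single, laurentLiftHom_single, laurentLiftHom_single,
            laurentLiftHom_single, AddMonoidAlgebra.single_mul_single,
            AddMonoidAlgebra.single_mul_single, ← add_assoc p q k, ← add_assoc q p k,
            add_comm q p, ← AddMonoidAlgebra.single_add]
          congr 1
          simp only [Derivation.leibniz, smul_eq_mul, Int.cast_add]
          ring)

theorem laurentLift_single (δ : Derivation ℂ A A) (β : A) (k p : ℤ) (τ : A) :
    laurentLift δ β k (.single p τ) = .single (p + k) (δ τ + p * β * τ) :=
  laurentLiftHom_single δ β k p τ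

theorem imUnit_mul_single (p : ℤ) (τ : A) :
    imUnit A[T;T⁻¹] * .single p τ = .single p (imUnit A * τ) := by
  rw [imUnit, imUnit, ← Algebra.smul_def, AddMonoidAlgebra.smul_single, ← Algebra.smul_def]

/-- The structure equations of a local frame `Z, Z̄, T` in an algebra of functions; `h` is the
Levi form, `[Z̄, Z] = b Z - b̄ Z̄ + i h T` and `[T, Z] = c Z + e Z̄`. -/
structure FrameEquations (Z Zb T : Derivation ℂ A A) (h hi b bb c cb e eb : A) : Prop where
  h_hi : h * hi = 1
  comm_Z : ∀ u, Z (Zb u) = Zb (Z u) - b * Z u + bb * Zb u - imUnit A * h * T u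
  comm_T : ∀ u, T (Z u) = Z (T u) + c * Z u + e * Zb u
  comm_Tb : ∀ u, T (Zb u) = Zb (T u) + cb * Zb u + eb * Z u
  T_h : T h = h * (c + cb)
  T_b : T b = b * cb + bb * eb + Zb c - Z eb
  T_bb : T bb = bb * c + b * e + Z cb - Zb e

/-- Every relation is additive in `x`, so it is checked on a monomial τ t^p by comparing
coefficients. Terms free of p are the bracket relations of the frame; terms with p express dω
through curvature and torsion. `T_h`, `T_b` and `T_bb` serve to commute T past the connection
coefficients. -/
theorem FrameEquations.websterCalculus {Z Zb T : Derivation ℂ A A} {h hi b bb c cb e eb : A}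
    (H : FrameEquations Z Zb T h hi b bb c cb e eb) {a R : A} (ha : a = hi * Z h - bb)
    (hR : R = hi * (Z b - Zb a + a * b - bb * b + imUnit A * h * c)) :
    WebsterCalculus (laurentLift Z (-a) 1) (laurentLift (hi • Zb) (-(hi * b)) (-1))
      (laurentLift T (-c) 0) (laurentLift 0 1 0) (.single 0 R) (.single 2 (-(h * e)))
      (.single (-2) (-(hi * eb))) := by
  have hh := H.h_hi
  have one_add' : ∀ p : ℤ, 1 + p = p + 1 := fun p => by ring
  have neg_one_add' : ∀ p : ℤ, -1 + p = p + -1 := fun p => by ring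
  have two_add' : ∀ p : ℤ, 2 + (p + -1) = p + 1 := fun p => by ring
  have neg_two_add' : ∀ p : ℤ, -2 + (p + 1) = p + -1 := fun p => by ring
  have inv : ∀ V : Derivation ℂ A A, V hi = -(hi ^ 2 * V h) := fun V => by
    have := congrArg V hh
    rw [V.leibniz, V.map_one_eq_zero, smul_eq_mul, smul_eq_mul] at this
    linear_combination hi * this - V hi * hh
  constructor
  · intro x
    induction x using LaurentPolynomial.induction_single with
    | add x y hx hy => simp only [mul_add, map_add, hx, hy]; ring
    | single p τ =>
      simp only [laurentLift_single, imUnit_mul_single, AddMonoidAlgebra.single_mul_single]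
      simp only [add_zero, zero_add, neg_add_cancel_right, add_neg_cancel_right,
        Int.reduceAdd, Int.reduceNeg, one_add', neg_one_add', two_add', neg_two_add',
        ← AddMonoidAlgebra.single_sub, ← AddMonoidAlgebra.single_add]
      congr 1
      simp only [inv, H.comm_Z, H.comm_T, H.comm_Tb, H.T_h, H.T_b, H.T_bb, ha, hR, map_add, map_sub,
        map_neg, map_zero, Derivation.leibniz, smul_eq_mul, Derivation.smul_apply,
        Derivation.map_intCast, Derivation.map_one_eq_zero, Derivation.zero_apply]
      push_cast
      linear_combination (-(imUnit A * T τ) + imUnit A * p * τ * c) * hh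
  · intro x
    induction x using LaurentPolynomial.induction_single with
    | add x y hx hy => simp only [mul_add, map_add, hx, hy]; ring
    | single p τ =>
      simp only [laurentLift_single, imUnit_mul_single, AddMonoidAlgebra.single_mul_single]
      simp only [add_zero, zero_add, neg_add_cancel_right, add_neg_cancel_right,
        Int.reduceAdd, Int.reduceNeg, one_add', neg_one_add', two_add', neg_two_add',
        ← AddMonoidAlgebra.single_sub, ← AddMonoidAlgebra.single_add]
      congr 1
      simp only [inv, H.comm_Z, H.comm_T, H.comm_Tb, H.T_h, H.T_b, H.T_bb, ha, hR, map_add, map_sub,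
        map_neg, map_zero, Derivation.leibniz, smul_eq_mul, Derivation.smul_apply,
        Derivation.map_intCast, Derivation.map_one_eq_zero, Derivation.zero_apply]
      push_cast
      linear_combination (c * p * hi * Z h * τ + p * hi * Z h * τ * cb - p * τ * Z c - p * τ * Z cb
        - e * Zb τ - e * p * τ * b + p * τ * Zb e) * hh
  · intro x
    induction x using LaurentPolynomial.induction_single with
    | add x y hx hy => simp only [mul_add, map_add, hx, hy]; ring
    | single p τ =>
      simp only [laurentLift_single, imUnit_mul_single, AddMonoidAlgebra.single_mul_single]
      simp only [add_zero, zero_add, neg_add_cancel_right, add_neg_cancel_right,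
        Int.reduceAdd, Int.reduceNeg, one_add', neg_one_add', two_add', neg_two_add',
        ← AddMonoidAlgebra.single_sub, ← AddMonoidAlgebra.single_add]
      congr 1
      simp only [inv, H.comm_Z, H.comm_T, H.comm_Tb, H.T_h, H.T_b, H.T_bb, ha, hR, map_add, map_sub,
        map_neg, map_zero, Derivation.leibniz, smul_eq_mul, Derivation.smul_apply,
        Derivation.map_intCast, Derivation.map_one_eq_zero, Derivation.zero_apply]
      push_cast
      linear_combination (-(hi * cb * Zb τ) + hi * cb * p * b * τ - hi * Zb τ * c
        + hi * c * p * b * τ) * hh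
  · intro x
    induction x using LaurentPolynomial.induction_single with
    | add x y hx hy => simp only [mul_add, map_add, hx, hy]; ring
    | single p τ =>
      simp only [laurentLift_single, imUnit_mul_single, AddMonoidAlgebra.single_mul_single]
      simp only [add_zero, zero_add, neg_add_cancel_right, add_neg_cancel_right,
        Int.reduceAdd, Int.reduceNeg, one_add', neg_one_add', two_add', neg_two_add',
        ← AddMonoidAlgebra.single_sub, ← AddMonoidAlgebra.single_add]
      congr 1
      simp only [inv, H.comm_Z, H.comm_T, H.comm_Tb, H.T_h, H.T_b, H.T_bb, ha, hR, map_add, map_sub,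
        map_neg, map_zero, Derivation.leibniz, smul_eq_mul, Derivation.smul_apply,
        Derivation.map_intCast, Derivation.map_one_eq_zero, Derivation.zero_apply]
      push_cast
      ring
  · intro x
    induction x using LaurentPolynomial.induction_single with
    | add x y hx hy => simp only [mul_add, map_add, hx, hy]; ring
    | single p τ =>
      simp only [laurentLift_single, imUnit_mul_single, AddMonoidAlgebra.single_mul_single]
      simp only [add_zero, zero_add, neg_add_cancel_right, add_neg_cancel_right,
        Int.reduceAdd, Int.reduceNeg, one_add', neg_one_add', two_add', neg_two_add',
        ← AddMonoidAlgebra.single_sub, ← AddMonoidAlgebra.single_add]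
      congr 1
      simp only [inv, H.comm_Z, H.comm_T, H.comm_Tb, H.T_h, H.T_b, H.T_bb, ha, hR, map_add, map_sub,
        map_neg, map_zero, Derivation.leibniz, smul_eq_mul, Derivation.smul_apply,
        Derivation.map_intCast, Derivation.map_one_eq_zero, Derivation.zero_apply]
      push_cast
      ring
  · intro x
    induction x using LaurentPolynomial.induction_single with
    | add x y hx hy => simp only [mul_add, map_add, hx, hy]
    | single p τ =>
      simp only [laurentLift_single, imUnit_mul_single, AddMonoidAlgebra.single_mul_single]
      simp only [add_zero, zero_add, neg_add_cancel_right, add_neg_cancel_right,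
        Int.reduceAdd, Int.reduceNeg, one_add', neg_one_add', two_add', neg_two_add',
        ← AddMonoidAlgebra.single_sub, ← AddMonoidAlgebra.single_add]
      congr 1
      simp only [inv, H.comm_Z, H.comm_T, H.comm_Tb, H.T_h, H.T_b, H.T_bb, ha, hR, map_add, map_sub,
        map_neg, map_zero, Derivation.leibniz, smul_eq_mul, Derivation.smul_apply,
        Derivation.map_intCast, Derivation.map_one_eq_zero, Derivation.zero_apply]
      ring
  · rw [laurentLift_single]
    simp
  · rw [laurentLift_single]
    simp only [Derivation.zero_apply, add_zero, zero_add, mul_one, Int.cast_ofNat, single_eq_C_mul_T,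
      map_mul, map_ofNat]
    ring
  · rw [laurentLift_single]
    simp only [Derivation.zero_apply, add_zero, zero_add, mul_one, Int.cast_ofNat, Int.cast_neg,
      neg_mul, mul_neg, neg_neg]
    simp only [single_eq_C_mul_T, map_mul, map_neg, map_ofNat]
    ring

/-! ### Part: consequences of the Jacobi identity, and reality of the curvature. -/

section Jacobi

variable {Z Zb T : Derivation ℂ A A} {h hi b bb c cb e eb : A}

/-- The Jacobi identity of `T`, `Z̄` and `Z`. -/
theorem jacobi_relation (comm_Z : ∀ u, Z (Zb u) = Zb (Z u) - b * Z u + bb * Zb u - imUnit A * h * T u)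
    (comm_T : ∀ u, T (Z u) = Z (T u) + c * Z u + e * Zb u)
    (comm_Tb : ∀ u, T (Zb u) = Zb (T u) + cb * Zb u + eb * Z u) (u : A) :
    (T b - (b * cb + bb * eb + Zb c - Z eb)) * Z u
      + -(T bb - (bb * c + b * e + Z cb - Zb e)) * Zb u
      + imUnit A * (T h - h * (c + cb)) * T u = 0 := by
  -- T Z Z̄ u is expanded in two ways: commuting T past Z, or commuting Z past Z̄.
  have h1 := (comm_T (Zb u)).symm.trans (congrArg T (comm_Z u))
  simp only [comm_Z, comm_T, comm_Tb, map_add, map_sub, Derivation.leibniz, Derivation.map_imUnit,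
    smul_eq_mul, mul_zero, add_zero] at h1
  linear_combination h1

/-- The scalar curvature is real. -/
theorem FrameEquations.curvature_conj (H : FrameEquations Z Zb T h hi b bb c cb e eb) {a ab : A}
    (ha : a = hi * Z h - bb) (hab : ab = hi * Zb h - b) :
    hi * (Z b - Zb a + a * b - bb * b + imUnit A * h * c) =
      hi * (Zb bb - Z ab + ab * bb - b * bb - imUnit A * h * cb) := by
  have hh := H.h_hi
  have inv : ∀ V : Derivation ℂ A A, V hi = -(hi ^ 2 * V h) := fun V => by
    have := congrArg V hh
    rw [V.leibniz, V.map_one_eq_zero, smul_eq_mul, smul_eq_mul] at this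
    linear_combination hi * this - V hi * hh
  -- The second derivatives of h on the two sides differ by [Z, Z̄]h; its T h term becomes c + c̄ by
  -- `T_h`.
  simp only [ha, hab, map_sub, Derivation.leibniz, smul_eq_mul, inv, H.comm_Z]
  linear_combination (-imUnit A * hi ^ 2 * h) * H.T_h - imUnit A * hi * h * (c + cb) * hh

end Jacobi

end LaurentLift

end

/-! ### Part: brackets of real vector fields as commutators, and functions with given differential.
-/

open scoped Manifold ContDiff
noncomputable section
namespace CRGeometry

open VectorField Topology

variable {M : Type*} [TopologicalSpace M] [ChartedSpace E3 M] [IsManifold (𝓡 3) ∞ M]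

section RealFields

theorem order_le (n : ℕ∞) : (n : WithTop ℕ∞) ≤ ∞ := by exact_mod_cast le_top

theorem SmoothFieldOn.contMDiffAt {X : ∀ x : M, TangentSpace (𝓡 3) x} {U : Set M}
    (h : SmoothFieldOn X U) (hU : IsOpen U) {x : M} (hx : x ∈ U) :
    ContMDiffAt (𝓡 3) (𝓡 3).tangent ∞ (fun x => (⟨x, X x⟩ : TangentBundle (𝓡 3) M)) x :=
  ContMDiffOn.contMDiffAt h (hU.mem_nhds hx)

theorem SmoothFieldOn.mlieBracket {X Y : ∀ x : M, TangentSpace (𝓡 3) x} {U : Set M} (hU : IsOpen U)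
    (hX : SmoothFieldOn X U) (hY : SmoothFieldOn Y U) :
    SmoothFieldOn (mlieBracket (𝓡 3) X Y) U := by
  have : IsManifold (𝓡 3) (minSmoothness ℝ 2) M := IsManifold.of_le (n := ∞) (by simpa using order_le 2)
  have : IsManifold (𝓡 3) ((⊤ : ℕ∞) + 1 : WithTop ℕ∞) M := by simpa
  exact fun x hx =>
  (ContMDiffAt.mlieBracket_vectorField (m := ⊤) (n := ⊤) (hX.contMDiffAt hU hx) (hY.contMDiffAt hU hx)
    (by simp)).contMDiffWithinAt

theorem contMDiffOn_mfderiv_apply {F : Type*} [NormedAddCommGroup F] [NormedSpace ℝ F] {u : M → F}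
    {X : ∀ x : M, TangentSpace (𝓡 3) x} {U : Set M} (hU : IsOpen U)
    (hu : ContMDiffOn (𝓡 3) 𝓘(ℝ, F) ∞ u U) (hX : SmoothFieldOn X U) :
    ContMDiffOn (𝓡 3) 𝓘(ℝ, F) ∞ (fun y => (mfderiv (𝓡 3) 𝓘(ℝ, F) u y (X y) : F)) U := by
  have h1 := hu.contMDiffOn_tangentMapWithin (m := ∞) (by simp) hU.uniqueMDiffOn
  have h2 := h1.comp (t := Bundle.TotalSpace.proj ⁻¹' U) hX (fun x hx => hx)
  have h3 := (contMDiff_snd_tangentBundle_modelSpace F 𝓘(ℝ, F) (n := ∞)).comp_contMDiffOn h2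
  refine h3.congr fun x hx => ?_
  change _ = mfderivWithin (𝓡 3) 𝓘(ℝ, F) u U x (X x)
  rw [mfderivWithin_of_isOpen hU hx]

/-- The bracket is a commutator on functions because of the Leibniz identity [X,[Y,uW]] = [[X,Y],uW]
+ [Y,[X,uW]]: expanding every bracket and subtracting u times the same identity for W leaves (([X,Y]
− XY + YX)u) W = 0, where W can be chosen nonzero at the point. -/
theorem mlieBracket_apply_real {X Y : ∀ x : M, TangentSpace (𝓡 3) x} {u : M → ℝ} {U : Set M}
    (hU : IsOpen U) (hu : ContMDiffOn (𝓡 3) 𝓘(ℝ, ℝ) ∞ u U) (hX : SmoothFieldOn X U)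
    (hY : SmoothFieldOn Y U) {x : M} (hx : x ∈ U) :
    mvfderiv (𝓡 3) u x (mlieBracket (𝓡 3) X Y x) =
      mvfderiv (𝓡 3) (fun y => mvfderiv (𝓡 3) u y (Y y)) x (X x)
        - mvfderiv (𝓡 3) (fun y => mvfderiv (𝓡 3) u y (X y)) x (Y x) := by
  have : IsManifold (𝓡 3) (minSmoothness ℝ 3) M := IsManifold.of_le (n := ∞) (by simpa using order_le 3)
  have : IsManifold (𝓡 3) (minSmoothness ℝ 2) M := IsManifold.of_le (n := ∞) (by simpa using order_le 2)
  -- `W` extends a nonzero vector at x and is smooth only near x, so everything is restricted to a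
  -- smaller open set `O`.
  obtain ⟨v, hv⟩ : ∃ v : TangentSpace (𝓡 3) x, v ≠ 0 := exists_ne (α := E3) 0
  let W : ∀ y : M, TangentSpace (𝓡 3) y := FiberBundle.extend E3 v
  have hWx : W x = v := FiberBundle.extend_apply_self ..
  obtain ⟨V, hxV, hVo, hW⟩ : ∃ V : Set M, x ∈ V ∧ IsOpen V ∧ SmoothFieldOn W V := by
    obtain ⟨s, hs, hW⟩ := FiberBundle.exists_contMDiffOn_extend (k := ∞) (𝓡 3) E3 v
    obtain ⟨V, hV, hVo, hxV⟩ := mem_nhds_iff.1 hs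
    exact ⟨V, hxV, hVo, hW.mono hV⟩
  replace hU := hU.inter hVo
  replace hu : ContMDiffOn (𝓡 3) 𝓘(ℝ, ℝ) ∞ u (U ∩ V) := hu.mono Set.inter_subset_left
  replace hX : SmoothFieldOn X (U ∩ V) := hX.mono Set.inter_subset_left
  replace hY : SmoothFieldOn Y (U ∩ V) := hY.mono Set.inter_subset_left
  replace hW : SmoothFieldOn W (U ∩ V) := hW.mono Set.inter_subset_right
  replace hx : x ∈ U ∩ V := ⟨hx, hxV⟩
  generalize U ∩ V = O at *
  have md : ∀ {Z : ∀ x : M, TangentSpace (𝓡 3) x}, SmoothFieldOn Z O → ∀ y ∈ O,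
      MDifferentiableAt (𝓡 3) (𝓡 3).tangent (fun x => (⟨x, Z x⟩ : TangentBundle (𝓡 3) M)) y :=
    fun h y hy => (h.contMDiffAt hU hy).mdifferentiableAt (by simp)
  have mu : ∀ {w : M → ℝ}, ContMDiffOn (𝓡 3) 𝓘(ℝ, ℝ) ∞ w O → ∀ y ∈ O,
      MDifferentiableAt (𝓡 3) 𝓘(ℝ, ℝ) w y :=
    fun h y hy => (h.contMDiffAt (hU.mem_nhds hy)).mdifferentiableAt (by simp)
  have sm : ∀ {Z : ∀ x : M, TangentSpace (𝓡 3) x} {w : M → ℝ}, ContMDiffOn (𝓡 3) 𝓘(ℝ, ℝ) ∞ w O →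
      SmoothFieldOn Z O → SmoothFieldOn (w • Z) O := fun h h' => ContMDiffOn.smul_section h h'
  have du : ∀ {Z : ∀ x : M, TangentSpace (𝓡 3) x}, SmoothFieldOn Z O →
      ContMDiffOn (𝓡 3) 𝓘(ℝ, ℝ) ∞ (fun y => mvfderiv (𝓡 3) u y (Z y)) O :=
    fun h => contMDiffOn_mfderiv_apply hU hu h
  have first : ∀ {Z : ∀ x : M, TangentSpace (𝓡 3) x}, SmoothFieldOn Z O → ∀ y ∈ O,
      mlieBracket (𝓡 3) Z (u • W) y = mvfderiv (𝓡 3) u y (Z y) • W y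
        + u y • mlieBracket (𝓡 3) Z W y :=
    fun h y hy => mlieBracket_smul_right (mu hu y hy) (md hW y hy)
  have second : ∀ {A B : ∀ x : M, TangentSpace (𝓡 3) x}, SmoothFieldOn A O → SmoothFieldOn B O →
      mlieBracket (𝓡 3) A (mlieBracket (𝓡 3) B (u • W)) x =
        (mvfderiv (𝓡 3) (fun y => mvfderiv (𝓡 3) u y (B y)) x (A x) • W x
          + mvfderiv (𝓡 3) u x (B x) • mlieBracket (𝓡 3) A W x)
        + (mvfderiv (𝓡 3) u x (A x) • mlieBracket (𝓡 3) B W x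
          + u x • mlieBracket (𝓡 3) A (mlieBracket (𝓡 3) B W) x) := by
    intro A B hA hB
    have e : mlieBracket (𝓡 3) B (u • W) =ᶠ[𝓝 x]
        (fun y => mvfderiv (𝓡 3) u y (B y)) • W + u • mlieBracket (𝓡 3) B W := by
      filter_upwards [hU.mem_nhds hx] with y hy using first hB y hy
    rw [Filter.EventuallyEq.rfl.mlieBracket_vectorField_eq e,
      mlieBracket_add_right (md (sm (du hB) hW) x hx) (md (sm hu (hB.mlieBracket hU hW)) x hx),
      mlieBracket_smul_right (mu (du hB) x hx) (md hW x hx),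
      mlieBracket_smul_right (mu hu x hx) (md (hB.mlieBracket hU hW) x hx)]
  have c2 : ∀ {Z : ∀ x : M, TangentSpace (𝓡 3) x}, SmoothFieldOn Z O →
      ContMDiffAt (𝓡 3) (𝓡 3).tangent (minSmoothness ℝ 2)
        (fun x => (⟨x, Z x⟩ : TangentBundle (𝓡 3) M)) x :=
    fun h => (h.contMDiffAt hU hx).of_le (by simpa using order_le 2)
  have j1 := leibniz_identity_mlieBracket_apply (c2 hX) (c2 hY) (c2 (sm hu hW))
  have j2 := leibniz_identity_mlieBracket_apply (c2 hX) (c2 hY) (c2 hW)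
  rw [second hX hY, second hY hX, first (hX.mlieBracket hU hY) x hx, j2] at j1
  have key : (mvfderiv (𝓡 3) u x (mlieBracket (𝓡 3) X Y x) -
      (mvfderiv (𝓡 3) (fun y => mvfderiv (𝓡 3) u y (Y y)) x (X x)
        - mvfderiv (𝓡 3) (fun y => mvfderiv (𝓡 3) u y (X y)) x (Y x))) • W x = 0 := by
    rw [← sub_eq_zero] at j1
    rw [← neg_eq_zero, ← j1]
    module
  rw [hWx] at key
  exact sub_eq_zero.1 ((smul_eq_zero.1 key).resolve_right hv)

end RealFields

/-- A linear function of the chart, centred at x, is made global by a bump function equal to 1 near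
x. -/
theorem exists_contMDiff_mfderiv_eq [T2Space M] (x : M) (l : TangentSpace (𝓡 3) x →L[ℝ] ℝ) :
    ∃ s : M → ℝ, ContMDiff (𝓡 3) 𝓘(ℝ, ℝ) ∞ s ∧ s x = 0 ∧ mfderiv (𝓡 3) 𝓘(ℝ, ℝ) s x = l := by
  have hinv := isInvertible_mfderiv_extChartAt (I := 𝓡 3) (mem_extChartAt_source x)
  let k : E3 →L[ℝ] ℝ := l.comp (mfderiv (𝓡 3) 𝓘(ℝ, E3) (extChartAt (𝓡 3) x) x).inverse
  let g : M → ℝ := fun y => k (extChartAt (𝓡 3) x y - extChartAt (𝓡 3) x x)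
  have hc : ContMDiffOn (𝓡 3) 𝓘(ℝ, E3) ∞ (fun y => extChartAt (𝓡 3) x y - extChartAt (𝓡 3) x x)
      (chartAt E3 x).source := (contMDiffOn_extChartAt (x := x)).sub contMDiffOn_const
  have hg : ContMDiffOn (𝓡 3) 𝓘(ℝ, ℝ) ∞ g (chartAt E3 x).source :=
    k.contMDiff.comp_contMDiffOn hc
  obtain ⟨f⟩ : Nonempty (SmoothBumpFunction (𝓡 3) x) := inferInstance
  refine ⟨fun y => f y • g y, f.contMDiff_smul hg, by simp only [g, sub_self, map_zero, smul_zero], ?_⟩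
  have h1 : (fun y => f y • g y) =ᶠ[𝓝 x] g := by
    filter_upwards [f.eventuallyEq_one] with y hy
    simp [hy]
  rw [h1.mfderiv_eq]
  have h2 : HasFDerivAt (fun y : E3 => k (y - extChartAt (𝓡 3) x x)) k (extChartAt (𝓡 3) x x) :=
    k.hasFDerivAt.comp _ ((hasFDerivAt_id _).sub_const _)
  have h3 := (mdifferentiableAt_extChartAt (I := 𝓡 3) (mem_chart_source E3 x)).hasMFDerivAt
  have h4 := h2.hasMFDerivAt.comp x h3
  refine h4.mfderiv.trans ?_
  ext v
  change l ((mfderiv (𝓡 3) 𝓘(ℝ, E3) (extChartAt (𝓡 3) x) x).inverse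
    (mfderiv (𝓡 3) 𝓘(ℝ, E3) (extChartAt (𝓡 3) x) x v)) = l v
  rw [hinv.inverse_apply_eq.2 rfl]

end CRGeometry
end

/-! ### Part: calculus of complex functions and complex vector fields. -/

open scoped Manifold ContDiff
noncomputable section
namespace CRGeometry

open VectorField Topology

variable {M : Type*} [TopologicalSpace M] [ChartedSpace E3 M]

/-- Smoothness of a complex valued function on a set. -/
abbrev SmoothFunOn (u : M → ℂ) (U : Set M) : Prop := ContMDiffOn (𝓡 3) 𝓘(ℝ, ℂ) ∞ u U

theorem SmoothFunOn.mdifferentiableAt {u : M → ℂ} {U : Set M} (hu : SmoothFunOn u U) (hU : IsOpen U)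
    {x : M} (hx : x ∈ U) : MDifferentiableAt (𝓡 3) 𝓘(ℝ, ℂ) u x :=
  (ContMDiffOn.contMDiffAt hu (hU.mem_nhds hx)).mdifferentiableAt (by simp)

theorem SmoothFunOn.const (c : ℂ) (U : Set M) : SmoothFunOn (fun _ : M => c) U := contMDiffOn_const

theorem SmoothFunOn.add {u v : M → ℂ} {U : Set M} (hu : SmoothFunOn u U) (hv : SmoothFunOn v U) :
    SmoothFunOn (fun x => u x + v x) U :=
  (contDiff_add (𝕜 := ℝ) (F := ℂ)).contMDiff.comp_contMDiffOn (hu.prodMk_space hv)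

theorem SmoothFunOn.mul {u v : M → ℂ} {U : Set M} (hu : SmoothFunOn u U) (hv : SmoothFunOn v U) :
    SmoothFunOn (fun x => u x * v x) U :=
  (contDiff_mul (𝕜 := ℝ) (𝔸 := ℂ)).contMDiff.comp_contMDiffOn (hu.prodMk_space hv)

theorem SmoothFunOn.neg {u : M → ℂ} {U : Set M} (hu : SmoothFunOn u U) :
    SmoothFunOn (fun x => -u x) U :=
  (contDiff_neg (𝕜 := ℝ) (F := ℂ)).contMDiff.comp_contMDiffOn hu

theorem SmoothFunOn.sub {u v : M → ℂ} {U : Set M} (hu : SmoothFunOn u U) (hv : SmoothFunOn v U) :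
    SmoothFunOn (fun x => u x - v x) U := by
  simpa only [sub_eq_add_neg] using hu.add hv.neg

theorem SmoothFunOn.conj {u : M → ℂ} {U : Set M} (hu : SmoothFunOn u U) :
    SmoothFunOn (fun x => starRingEnd ℂ (u x)) U :=
  (Complex.conjCLE : ℂ →L[ℝ] ℂ).contMDiff.comp_contMDiffOn hu

theorem SmoothFunOn.ofReal {f : M → ℝ} {U : Set M} (hf : ContMDiffOn (𝓡 3) 𝓘(ℝ, ℝ) ∞ f U) :
    SmoothFunOn (fun x => (f x : ℂ)) U :=
  Complex.ofRealCLM.contMDiff.comp_contMDiffOn hf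

theorem SmoothFunOn.re {u : M → ℂ} {U : Set M} (hu : SmoothFunOn u U) :
    ContMDiffOn (𝓡 3) 𝓘(ℝ, ℝ) ∞ (fun x => (u x).re) U :=
  Complex.reCLM.contMDiff.comp_contMDiffOn hu

theorem SmoothFunOn.im {u : M → ℂ} {U : Set M} (hu : SmoothFunOn u U) :
    ContMDiffOn (𝓡 3) 𝓘(ℝ, ℝ) ∞ (fun x => (u x).im) U :=
  Complex.imCLM.contMDiff.comp_contMDiffOn hu

theorem SmoothFunOn.inv {u : M → ℂ} {U : Set M} (hu : SmoothFunOn u U) (h0 : ∀ x ∈ U, u x ≠ 0) :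
    SmoothFunOn (fun x => (u x)⁻¹) U := fun x hx =>
  ((contDiffAt_inv ℝ (h0 x hx)).contMDiffAt (n := ∞)).comp_contMDiffWithinAt x (hu x hx)

section dFun

variable {u v : M → ℂ} {x : M}

theorem hasMFDerivAt_dFun (hu : MDifferentiableAt (𝓡 3) 𝓘(ℝ, ℂ) u x) :
    HasMFDerivAt (𝓡 3) 𝓘(ℝ, ℂ) u x (dFun u x) := hu.hasMFDerivAt

theorem dFun_clm (hu : MDifferentiableAt (𝓡 3) 𝓘(ℝ, ℂ) u x) (L : ℂ →L[ℝ] ℂ)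
    (w : TangentSpace (𝓡 3) x) : dFun (fun y => L (u y)) x w = L (dFun u x w) := by
  have h := (L.hasFDerivAt (x := u x)).hasMFDerivAt.comp x (hasMFDerivAt_dFun hu)
  exact congrArg (fun φ : TangentSpace (𝓡 3) x →L[ℝ] ℂ => φ w) h.mfderiv

theorem dFun_conj (hu : MDifferentiableAt (𝓡 3) 𝓘(ℝ, ℂ) u x) (w : TangentSpace (𝓡 3) x) :
    dFun (fun y => starRingEnd ℂ (u y)) x w = starRingEnd ℂ (dFun u x w) :=
  dFun_clm hu (Complex.conjCLE : ℂ →L[ℝ] ℂ) w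

theorem dFun_add (hu : MDifferentiableAt (𝓡 3) 𝓘(ℝ, ℂ) u x)
    (hv : MDifferentiableAt (𝓡 3) 𝓘(ℝ, ℂ) v x) (w : TangentSpace (𝓡 3) x) :
    dFun (fun y => u y + v y) x w = dFun u x w + dFun v x w :=
  congrArg (fun φ : TangentSpace (𝓡 3) x →L[ℝ] ℂ => φ w)
    ((hasMFDerivAt_dFun hu).add (hasMFDerivAt_dFun hv)).mfderiv

theorem dFun_mul (hu : MDifferentiableAt (𝓡 3) 𝓘(ℝ, ℂ) u x)
    (hv : MDifferentiableAt (𝓡 3) 𝓘(ℝ, ℂ) v x) (w : TangentSpace (𝓡 3) x) :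
    dFun (fun y => u y * v y) x w = u x * dFun v x w + v x * dFun u x w :=
  congrArg (fun φ : TangentSpace (𝓡 3) x →L[ℝ] ℂ => φ w)
    ((hasMFDerivAt_dFun hu).mul (hasMFDerivAt_dFun hv)).mfderiv

theorem dFun_const (c : ℂ) (w : TangentSpace (𝓡 3) x) : dFun (fun _ : M => c) x w = 0 :=
  congrArg (fun φ : TangentSpace (𝓡 3) x →L[ℝ] ℂ => φ w) mfderiv_const

theorem dFun_const_mul (hu : MDifferentiableAt (𝓡 3) 𝓘(ℝ, ℂ) u x) (c : ℂ)
    (w : TangentSpace (𝓡 3) x) : dFun (fun y => c * u y) x w = c * dFun u x w := by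
  rw [dFun_mul mdifferentiableAt_const hu, dFun_const]; ring

theorem dFun_congr (h : u =ᶠ[𝓝 x] v) : dFun u x = dFun v x := h.mfderiv_eq

theorem dFun_ofReal {f : M → ℝ} (hf : MDifferentiableAt (𝓡 3) 𝓘(ℝ, ℝ) f x)
    (w : TangentSpace (𝓡 3) x) :
    dFun (fun y => (f y : ℂ)) x w = ((mvfderiv (𝓡 3) f x w : ℝ) : ℂ) := by
  have h := (Complex.ofRealCLM.hasFDerivAt (x := f x)).hasMFDerivAt.comp x hf.hasMFDerivAt
  exact congrArg (fun φ : TangentSpace (𝓡 3) x →L[ℝ] ℂ => φ w) h.mfderiv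

end dFun

variable [IsManifold (𝓡 3) ∞ M]

theorem SmoothFunOn.dFun_apply {u : M → ℂ} {X : ∀ x : M, TangentSpace (𝓡 3) x} {U : Set M}
    (hU : IsOpen U) (hu : SmoothFunOn u U) (hX : SmoothFieldOn X U) :
    SmoothFunOn (fun x => dFun u x (X x)) U :=
  contMDiffOn_mfderiv_apply hU hu hX

/-- The real statement is applied to the real and imaginary parts of `u`. -/
theorem dFun_mlieBracket {X Y : ∀ x : M, TangentSpace (𝓡 3) x} {u : M → ℂ} {U : Set M}
    (hU : IsOpen U) (hu : SmoothFunOn u U) (hX : SmoothFieldOn X U) (hY : SmoothFieldOn Y U) {x : M}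
    (hx : x ∈ U) : dFun u x (mlieBracket (𝓡 3) X Y x) =
      dFun (fun y => dFun u y (Y y)) x (X x) - dFun (fun y => dFun u y (X y)) x (Y x) := by
  have real : ∀ f : M → ℝ, ContMDiffOn (𝓡 3) 𝓘(ℝ, ℝ) ∞ f U →
      dFun (fun y => (f y : ℂ)) x (mlieBracket (𝓡 3) X Y x) =
        dFun (fun y => dFun (fun y => (f y : ℂ)) y (Y y)) x (X x)
          - dFun (fun y => dFun (fun y => (f y : ℂ)) y (X y)) x (Y x) := by
    intro f hf
    have md : ∀ {f : M → ℝ}, ContMDiffOn (𝓡 3) 𝓘(ℝ, ℝ) ∞ f U → ∀ y ∈ U,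
      MDifferentiableAt (𝓡 3) 𝓘(ℝ, ℝ) f y :=
      fun h y hy => (h.contMDiffAt (hU.mem_nhds hy)).mdifferentiableAt (by simp)
    have e : ∀ {V : ∀ x : M, TangentSpace (𝓡 3) x}, (fun y => dFun (fun y => (f y : ℂ)) y (V y))
        =ᶠ[𝓝 x] fun y => ((mvfderiv (𝓡 3) f y (V y) : ℝ) : ℂ) := by
      intro V
      filter_upwards [hU.mem_nhds hx] with y hy using dFun_ofReal (md hf y hy) _
    have d : ∀ {V : ∀ x : M, TangentSpace (𝓡 3) x}, SmoothFieldOn V U →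
        MDifferentiableAt (𝓡 3) 𝓘(ℝ, ℝ) (fun y => mvfderiv (𝓡 3) f y (V y)) x :=
      fun h => md (contMDiffOn_mfderiv_apply hU hf h) x hx
    rw [dFun_congr e, dFun_congr e, dFun_ofReal (md hf x hx), dFun_ofReal (d hX), dFun_ofReal (d hY),
      mlieBracket_apply_real hU hf hX hY hx, Complex.ofReal_sub]
  have hr := SmoothFunOn.ofReal hu.re
  have hi := SmoothFunOn.ofReal hu.im
  have split : ∀ (w : ∀ y : M, TangentSpace (𝓡 3) y), ∀ y ∈ U, dFun u y (w y) =
      dFun (fun y => ((u y).re : ℂ)) y (w y) + Complex.I * dFun (fun y => ((u y).im : ℂ)) y (w y) := by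
    intro w y hy
    have hI : SmoothFunOn (fun y => Complex.I * ((u y).im : ℂ)) U := (SmoothFunOn.const _ _).mul hi
    rw [← dFun_const_mul (hi.mdifferentiableAt hU hy),
      ← dFun_add (hr.mdifferentiableAt hU hy) (hI.mdifferentiableAt hU hy)]
    congr 2
    ext y
    rw [mul_comm, Complex.re_add_im]
  have split' : ∀ {V : ∀ y : M, TangentSpace (𝓡 3) y}, SmoothFieldOn V U →
      ∀ w : TangentSpace (𝓡 3) x, dFun (fun y => dFun u y (V y)) x w =
        dFun (fun y => dFun (fun y => ((u y).re : ℂ)) y (V y)) x w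
          + Complex.I * dFun (fun y => dFun (fun y => ((u y).im : ℂ)) y (V y)) x w := by
    intro V hV w
    have h1 := hr.dFun_apply hU hV
    have h2 := hi.dFun_apply hU hV
    have hI : SmoothFunOn (fun y => Complex.I * dFun (fun y => ((u y).im : ℂ)) y (V y)) U :=
      (SmoothFunOn.const _ _).mul h2
    rw [← dFun_const_mul (h2.mdifferentiableAt hU hx),
      ← dFun_add (h1.mdifferentiableAt hU hx) (hI.mdifferentiableAt hU hx)]
    refine congrArg (fun φ : TangentSpace (𝓡 3) x →L[ℝ] ℂ => φ w) (dFun_congr ?_)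
    filter_upwards [hU.mem_nhds hx] with y hy using split V y hy
  rw [split _ x hx, split' hX, split' hY, real _ hu.re, real _ hu.im]
  ring

section CFields

theorem CForm.app_conj (φ : CForm M) (V : CField M) (x : M) :
    φ.conj.app V.conj x = starRingEnd ℂ (φ.app V x) := by
  simp [CForm.app, CForm.conj, CField.conj]

theorem CForm.app_conj' (φ : CForm M) (V : CField M) (x : M) :
    φ.conj.app V x = starRingEnd ℂ (φ.app V.conj x) := by
  simp [CForm.app, CForm.conj, CField.conj]

@[simp]
theorem CField.conj_conj (V : CField M) : V.conj.conj = V := by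
  simp [CField.conj]

theorem CForm.app_eq_of_eq (φ : CForm M) {V W : CField M} {x : M} (hr : V.re x = W.re x)
    (hi : V.im x = W.im x) : φ.app V x = φ.app W x := by
  rw [CForm.app, CForm.app, hr, hi]

theorem SmoothFieldOn.add {X Y : ∀ x : M, TangentSpace (𝓡 3) x} {U : Set M}
    (hX : SmoothFieldOn X U) (hY : SmoothFieldOn Y U) : SmoothFieldOn (fun x => X x + Y x) U :=
  ContMDiffOn.add_section hX hY

theorem SmoothFieldOn.sub {X Y : ∀ x : M, TangentSpace (𝓡 3) x} {U : Set M}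
    (hX : SmoothFieldOn X U) (hY : SmoothFieldOn Y U) : SmoothFieldOn (fun x => X x - Y x) U :=
  ContMDiffOn.sub_section hX hY

theorem SmoothFieldOn.neg {X : ∀ x : M, TangentSpace (𝓡 3) x} {U : Set M}
    (hX : SmoothFieldOn X U) : SmoothFieldOn (fun x => -X x) U :=
  ContMDiffOn.neg_section (V := fun x : M => TangentSpace (𝓡 3) x) hX

theorem SmoothFieldOn.smul {X : ∀ x : M, TangentSpace (𝓡 3) x} {f : M → ℝ} {U : Set M}
    (hf : ContMDiffOn (𝓡 3) 𝓘(ℝ, ℝ) ∞ f U) (hX : SmoothFieldOn X U) :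
    SmoothFieldOn (fun x => f x • X x) U :=
  ContMDiffOn.smul_section hf hX

theorem SmoothFieldOn.zero (U : Set M) :
    SmoothFieldOn (fun x : M => (0 : TangentSpace (𝓡 3) x)) U :=
  (Bundle.contMDiff_zeroSection ℝ (fun x : M => TangentSpace (𝓡 3) x)).contMDiffOn

/-- The sum of complex vector fields. -/
def CField.add (V W : CField M) : CField M := ⟨fun x => V.re x + W.re x, fun x => V.im x + W.im x⟩

/-- The product of a complex function and a complex vector field. -/
def CField.smul (u : M → ℂ) (V : CField M) : CField M :=
  ⟨fun x => (u x).re • V.re x - (u x).im • V.im x, fun x => (u x).re • V.im x + (u x).im • V.re x⟩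

theorem CForm.app_add (φ : CForm M) (V W : CField M) (x : M) :
    φ.app (V.add W) x = φ.app V x + φ.app W x := by
  simp only [CForm.app, CField.add, map_add]; ring

theorem CForm.app_smul (φ : CForm M) (u : M → ℂ) (V : CField M) (x : M) :
    φ.app (V.smul u) x = u x * φ.app V x := by
  simp only [CForm.app, CField.smul, map_add, map_sub, map_smul, Complex.real_smul]
  nth_rw 5 [← Complex.re_add_im (u x)]
  linear_combination (-((u x).im : ℂ) * φ x (V.im x)) * Complex.I_sq

variable {V W : CField M} {U : Set M}

theorem CField.SmoothOn.conj (hV : V.SmoothOn U) : V.conj.SmoothOn U := ⟨hV.1, hV.2.neg⟩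

theorem CField.SmoothOn.mono {U' : Set M} (hV : V.SmoothOn U) (h : U' ⊆ U) : V.SmoothOn U' :=
  ⟨ContMDiffOn.mono hV.1 h, ContMDiffOn.mono hV.2 h⟩

theorem CField.SmoothOn.ofReal {X : ∀ x : M, TangentSpace (𝓡 3) x} (hX : SmoothFieldOn X U) :
    (CField.ofReal X).SmoothOn U := ⟨hX, SmoothFieldOn.zero U⟩

theorem CField.SmoothOn.bracket (hU : IsOpen U) (hV : V.SmoothOn U) (hW : W.SmoothOn U) :
    (V.bracket W).SmoothOn U :=
  ⟨(hV.1.mlieBracket hU hW.1).sub (hV.2.mlieBracket hU hW.2),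
    (hV.1.mlieBracket hU hW.2).add (hV.2.mlieBracket hU hW.1)⟩

theorem CField.SmoothOn.act (hU : IsOpen U) (hV : V.SmoothOn U) {u : M → ℂ} (hu : SmoothFunOn u U) :
    SmoothFunOn (V.act u) U :=
  (hu.dFun_apply hU hV.1).add ((SmoothFunOn.const _ _).mul (hu.dFun_apply hU hV.2))

theorem mlieBracket_neg_right {X Y : ∀ x : M, TangentSpace (𝓡 3) x} {x : M} (hU : IsOpen U)
    (hY : SmoothFieldOn Y U) (hx : x ∈ U) :
    mlieBracket (𝓡 3) X (fun y => -Y y) x = -mlieBracket (𝓡 3) X Y x := by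
  have h := mlieBracket_const_smul_right (I := 𝓡 3) (V := X) (c := (-1 : ℝ))
    ((hY.contMDiffAt hU hx).mdifferentiableAt (by simp))
  have e : (-1 : ℝ) • Y = fun y => -Y y := by
    funext y
    exact neg_one_smul ℝ (Y y)
  rw [e, neg_one_smul] at h
  exact h

theorem mlieBracket_neg_left {X Y : ∀ x : M, TangentSpace (𝓡 3) x} {x : M} (hU : IsOpen U)
    (hX : SmoothFieldOn X U) (hx : x ∈ U) :
    mlieBracket (𝓡 3) (fun y => -X y) Y x = -mlieBracket (𝓡 3) X Y x := by
  rw [mlieBracket_swap_apply, mlieBracket_neg_right hU hX hx, mlieBracket_swap_apply (V := X) (W := Y)]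

theorem CField.bracket_conj (hU : IsOpen U) (hV : V.SmoothOn U) (hW : W.SmoothOn U) {x : M}
    (hx : x ∈ U) : (V.conj.bracket W.conj).re x = (V.bracket W).conj.re x ∧
      (V.conj.bracket W.conj).im x = (V.bracket W).conj.im x := by
  have h1 := mlieBracket_neg_left (Y := fun y => -W.im y) hU hV.2 hx
  have h2 := mlieBracket_neg_right (X := V.im) hU hW.2 hx
  have h3 := mlieBracket_neg_left (Y := W.re) hU hV.2 hx
  have h4 := mlieBracket_neg_right (X := V.re) hU hW.2 hx
  simp only [CField.bracket, CField.conj, h1, h2, h3, h4, neg_neg, neg_add, and_self]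

theorem CField.bracket_swap (V W : CField M) (x : M) :
    (V.bracket W).re x = -(W.bracket V).re x ∧ (V.bracket W).im x = -(W.bracket V).im x := by
  simp only [CField.bracket]
  rw [mlieBracket_swap_apply, mlieBracket_swap_apply (V := V.im) (W := W.im),
    mlieBracket_swap_apply (V := V.re) (W := W.im), mlieBracket_swap_apply (V := V.im) (W := W.re)]
  exact ⟨by abel, by abel⟩

section act

variable {u v : M → ℂ} {x : M}

theorem CField.act_congr (V : CField M) (h : u =ᶠ[𝓝 x] v) : V.act u x = V.act v x := by
  rw [CField.act, CField.act, CForm.app, CForm.app, dFun_congr h]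

theorem act_congr_on (V : CField M) {U : Set M} (hU : IsOpen U)
    (h : ∀ y ∈ U, u y = v y) (hx : x ∈ U) : V.act u x = V.act v x :=
  V.act_congr (by filter_upwards [hU.mem_nhds hx] with y hy using h y hy)

theorem CField.act_add (V : CField M) (hu : MDifferentiableAt (𝓡 3) 𝓘(ℝ, ℂ) u x)
    (hv : MDifferentiableAt (𝓡 3) 𝓘(ℝ, ℂ) v x) :
    V.act (fun y => u y + v y) x = V.act u x + V.act v x := by
  simp only [CField.act, CForm.app, dFun_add hu hv]; ring

theorem CField.act_mul (V : CField M) (hu : MDifferentiableAt (𝓡 3) 𝓘(ℝ, ℂ) u x)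
    (hv : MDifferentiableAt (𝓡 3) 𝓘(ℝ, ℂ) v x) :
    V.act (fun y => u y * v y) x = u x * V.act v x + v x * V.act u x := by
  simp only [CField.act, CForm.app, dFun_mul hu hv]; ring

theorem CField.act_const (V : CField M) (c : ℂ) : V.act (fun _ => c) x = 0 := by
  simp [CField.act, CForm.app, dFun_const]

theorem CField.act_conj (V : CField M) (hu : MDifferentiableAt (𝓡 3) 𝓘(ℝ, ℂ) u x) :
    V.conj.act (fun y => starRingEnd ℂ (u y)) x = starRingEnd ℂ (V.act u x) := by
  simp [CField.act, CForm.app, dFun_conj hu, CField.conj]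

/-- Both sides are complex bilinear in the two fields, so this is the real commutator formula on the
four pairs of real and imaginary parts. -/
theorem CField.act_bracket (hU : IsOpen U) (hV : V.SmoothOn U) (hW : W.SmoothOn U)
    (hu : SmoothFunOn u U) (hx : x ∈ U) :
    (V.bracket W).act u x = V.act (W.act u) x - W.act (V.act u) x := by
  have aux : ∀ {A : CField M}, A.SmoothOn U → ∀ w : TangentSpace (𝓡 3) x, dFun (A.act u) x w =
      dFun (fun y => dFun u y (A.re y)) x w + Complex.I * dFun (fun y => dFun u y (A.im y)) x w := by
    intro A hA w
    have h1 := hu.dFun_apply hU hA.1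
    have h2 := hu.dFun_apply hU hA.2
    rw [← dFun_const_mul (h2.mdifferentiableAt hU hx), ← dFun_add (h1.mdifferentiableAt hU hx)
      (((SmoothFunOn.const _ _).mul h2).mdifferentiableAt hU hx)]
    rfl
  have h := @dFun_mlieBracket M _ _ _
  have e : ∀ {A B : CField M}, A.SmoothOn U → A.act (B.act u) x = dFun (B.act u) x (A.re x)
    + Complex.I * dFun (B.act u) x (A.im x) := fun _ => rfl
  rw [e hV, e hW, aux hV, aux hV, aux hW, aux hW]
  simp only [CField.act, CForm.app, CField.bracket, map_add, map_sub, dFun_mlieBracket hU hu hV.1 hW.1 hx,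
    dFun_mlieBracket hU hu hV.1 hW.2 hx, dFun_mlieBracket hU hu hV.2 hW.1 hx,
    dFun_mlieBracket hU hu hV.2 hW.2 hx]
  ring_nf
  simp only [Complex.I_sq]
  ring

end act

/-- Differentials of global real functions exhaust the cotangent space at x, and on a real function
the real and imaginary parts of the derivative see `V.re` and `V.im` separately. Identities between
complex vectors can thus be tested on such functions. -/
theorem CField.eq_of_act_eq [T2Space M] {x : M}
    (h : ∀ s : M → ℝ, ContMDiff (𝓡 3) 𝓘(ℝ, ℝ) ∞ s →
      V.act (fun y => (s y : ℂ)) x = W.act (fun y => (s y : ℂ)) x) :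
    V.re x = W.re x ∧ V.im x = W.im x := by
  have key : ∀ l : TangentSpace (𝓡 3) x →L[ℝ] ℝ, l (V.re x) = l (W.re x) ∧ l (V.im x) = l (W.im x) := by
    intro l
    obtain ⟨s, hs, -, e⟩ := exists_contMDiff_mfderiv_eq x l
    have := h s hs
    have hd : MDifferentiableAt (𝓡 3) 𝓘(ℝ, ℝ) s x := (hs x).mdifferentiableAt (by simp)
    simp only [CField.act, CForm.app, dFun_ofReal hd] at this
    have e' : ∀ v, mvfderiv (𝓡 3) s x v = l v := fun v =>
      congrArg (fun φ : TangentSpace (𝓡 3) x →L[ℝ] ℝ => φ v) e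
    simp only [e'] at this
    exact ⟨by simpa using congrArg Complex.re this, by simpa using congrArg Complex.im this⟩
  have sep : ∀ v w : E3, (∀ l : E3 →L[ℝ] ℝ, l v = l w) → v = w := fun v w hl => by
    by_contra hne
    obtain ⟨l, hl'⟩ := SeparatingDual.exists_separating_of_ne (R := ℝ) hne
    exact hl' (hl l)
  exact ⟨sep _ _ fun l => (key l).1, sep _ _ fun l => (key l).2⟩

end CFields

end CRGeometry
end

/-! ### Part: dθ as a pointwise form, and frames of H. -/

open scoped Manifold ContDiff
noncomputable section
namespace CRGeometry

open VectorField Topology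

variable {M : Type*} [TopologicalSpace M] [ChartedSpace E3 M] [IsManifold (𝓡 3) ∞ M]
  {S : CRStructure M}

namespace ContactForm

variable (θ : ContactForm S)

theorem contMDiffOn_form_apply {X : ∀ x : M, TangentSpace (𝓡 3) x} {U : Set M}
    (hX : SmoothFieldOn X U) : ContMDiffOn (𝓡 3) 𝓘(ℝ, ℝ) ∞ (fun x => θ.form x (X x)) U := by
  have h := ContMDiffOn.clm_bundle_apply (n := ∞) (IB := 𝓡 3) (F₁ := E3) (F₂ := ℝ)
    (E₁ := fun x : M => TangentSpace (𝓡 3) x) (E₂ := Bundle.Trivial M ℝ) (b := fun x => x)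
    (θ.smooth.contMDiffOn (s := U)) hX
  intro x hx
  have := (Bundle.contMDiffWithinAt_totalSpace.1 (h x hx)).2
  exact this

theorem mdifferentiableAt_form_apply {X : ∀ x : M, TangentSpace (𝓡 3) x} {x : M}
    (hX : MDifferentiableAt (𝓡 3) (𝓡 3).tangent (fun x => (⟨x, X x⟩ : TangentBundle (𝓡 3) M)) x) :
    MDifferentiableAt (𝓡 3) 𝓘(ℝ, ℝ) (fun x => θ.form x (X x)) x := by
  have h := MDifferentiableAt.clm_bundle_apply (IB := 𝓡 3) (F₁ := E3) (F₂ := ℝ)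
    (E₁ := fun x : M => TangentSpace (𝓡 3) x) (E₂ := Bundle.Trivial M ℝ) (b := fun x => x)
    ((θ.smooth x).mdifferentiableAt (by simp)) hX
  exact ((mdifferentiableAt_totalSpace ..).1 h).2

/-- The exterior derivative of a contact form on real vector fields. -/
def dReal (X Y : ∀ x : M, TangentSpace (𝓡 3) x) (x : M) : ℝ :=
  mvfderiv (𝓡 3) (fun y => θ.form y (Y y)) x (X x) - mvfderiv (𝓡 3) (fun y => θ.form y (X y)) x (Y x)
    - θ.form x (mlieBracket (𝓡 3) X Y x)

theorem dReal_swap (X Y : ∀ x : M, TangentSpace (𝓡 3) x) (x : M) :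
    θ.dReal X Y x = -θ.dReal Y X x := by
  rw [dReal, dReal, mlieBracket_swap_apply, map_neg]; ring

/-- Tensoriality allows dθ to be evaluated on a vector decomposed only at the point x, without
extending its coefficients to functions. The other slot follows from `dReal_swap`. -/
theorem tensorialAt_dReal {X : ∀ x : M, TangentSpace (𝓡 3) x} {x : M} :
    TensorialAt (𝓡 3) E3 (fun Y => θ.dReal X Y x) x where
  smul {f Y} hf hY := by
    have h1 : (fun y => θ.form y ((f • Y) y)) = fun y => f y * θ.form y (Y y) := by
      funext y; simp
    have h2 : mlieBracket (𝓡 3) X (f • Y) x = mvfderiv (𝓡 3) f x (X x) • Y x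
        + f x • mlieBracket (𝓡 3) X Y x := mlieBracket_smul_right hf hY
    have h3 : mvfderiv (𝓡 3) (fun y => f y * θ.form y (Y y)) x =
        f x • mvfderiv (𝓡 3) (fun y => θ.form y (Y y)) x + θ.form x (Y x) • mvfderiv (𝓡 3) f x :=
      mvfderiv_mul hf (θ.mdifferentiableAt_form_apply hY)
    simp only [dReal, h2, h3, map_add, map_smul, smul_eq_mul, Pi.smul_apply', add_apply, smul_apply]
    ring
  add {Y Y'} hY hY' := by
    have : IsManifold (𝓡 3) (minSmoothness ℝ 2) M :=
      IsManifold.of_le (n := ∞) (by simpa using order_le 2)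
    have h1 : (fun y => θ.form y ((Y + Y') y)) = fun y => θ.form y (Y y) + θ.form y (Y' y) := by
      funext y; simp
    have h2 := mlieBracket_add_right (V := X) hY hY'
    have h3 : mvfderiv (𝓡 3) (fun y => θ.form y (Y y) + θ.form y (Y' y)) x =
        mvfderiv (𝓡 3) (fun y => θ.form y (Y y)) x + mvfderiv (𝓡 3) (fun y => θ.form y (Y' y)) x :=
      mvfderiv_add (θ.mdifferentiableAt_form_apply hY) (θ.mdifferentiableAt_form_apply hY')
    simp only [dReal, h2, h3, map_add, Pi.add_apply, add_apply]
    ring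

/-- Contraction of the exterior derivative with a field, as a pointwise linear map. -/
def dRealHom (X : ∀ x : M, TangentSpace (𝓡 3) x) (x : M) : TangentSpace (𝓡 3) x →L[ℝ] ℝ :=
  TensorialAt.mkHom (I := 𝓡 3) (F := E3) (fun Y => θ.dReal X Y x) x θ.tensorialAt_dReal

/-- Differentiability of a vector field at a point. -/
abbrev _root_.CRGeometry.FieldDiffAt (X : ∀ x : M, TangentSpace (𝓡 3) x) (x : M) : Prop :=
  MDifferentiableAt (𝓡 3) (𝓡 3).tangent (fun y => (⟨y, X y⟩ : TangentBundle (𝓡 3) M)) x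

theorem _root_.CRGeometry.SmoothFieldOn.fieldDiffAt {X : ∀ x : M, TangentSpace (𝓡 3) x} {U : Set M}
    (h : SmoothFieldOn X U) (hU : IsOpen U) {x : M} (hx : x ∈ U) : FieldDiffAt X x :=
  (h.contMDiffAt hU hx).mdifferentiableAt (by simp)

theorem dRealHom_apply {X Y : ∀ x : M, TangentSpace (𝓡 3) x} {x : M} (hY : FieldDiffAt Y x) :
    θ.dRealHom X x (Y x) = θ.dReal X Y x :=
  TensorialAt.mkHom_apply θ.tensorialAt_dReal hY

theorem mdifferentiableAt_of_smooth {f : M → ℝ} {U : Set M} (hU : IsOpen U)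
    (hf : ContMDiffOn (𝓡 3) 𝓘(ℝ, ℝ) ∞ f U) {x : M} (hx : x ∈ U) :
    MDifferentiableAt (𝓡 3) 𝓘(ℝ, ℝ) f x :=
  (hf.contMDiffAt (hU.mem_nhds hx)).mdifferentiableAt (by simp)

theorem contMDiffOn_dReal {X Y : ∀ x : M, TangentSpace (𝓡 3) x} {U : Set M} (hU : IsOpen U)
    (hX : SmoothFieldOn X U) (hY : SmoothFieldOn Y U) :
    ContMDiffOn (𝓡 3) 𝓘(ℝ, ℝ) ∞ (θ.dReal X Y) U :=
  ((contMDiffOn_mfderiv_apply hU (θ.contMDiffOn_form_apply hY) hX).sub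
    (contMDiffOn_mfderiv_apply hU (θ.contMDiffOn_form_apply hX) hY)).sub
      (θ.contMDiffOn_form_apply (hX.mlieBracket hU hY))

theorem smoothFunOn_formC_app {V : CField M} {U : Set M} (hV : V.SmoothOn U) :
    SmoothFunOn (θ.formC.app V) U :=
  (SmoothFunOn.ofReal (θ.contMDiffOn_form_apply hV.1)).add
    ((SmoothFunOn.const _ _).mul (SmoothFunOn.ofReal (θ.contMDiffOn_form_apply hV.2)))

theorem dForm_formC {V W : CField M} {U : Set M} (hU : IsOpen U) (hV : V.SmoothOn U)
    (hW : W.SmoothOn U) {x : M} (hx : x ∈ U) : dForm θ.formC V W x =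
      ((θ.dReal V.re W.re x - θ.dReal V.im W.im x : ℝ) : ℂ)
        + Complex.I * ((θ.dReal V.re W.im x + θ.dReal V.im W.re x : ℝ) : ℂ) := by
  have aux : ∀ {A : CField M}, A.SmoothOn U → ∀ w : TangentSpace (𝓡 3) x,
      dFun (θ.formC.app A) x w = ((mvfderiv (𝓡 3) (fun y => θ.form y (A.re y)) x w : ℝ) : ℂ)
        + Complex.I * ((mvfderiv (𝓡 3) (fun y => θ.form y (A.im y)) x w : ℝ) : ℂ) := by
    intro A hA w
    have s1 := θ.contMDiffOn_form_apply hA.1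
    have s2 := θ.contMDiffOn_form_apply hA.2
    have h1 := SmoothFunOn.ofReal s1
    have h2 := SmoothFunOn.ofReal s2
    rw [← dFun_ofReal (mdifferentiableAt_of_smooth hU s1 hx),
      ← dFun_ofReal (mdifferentiableAt_of_smooth hU s2 hx),
      ← dFun_const_mul (h2.mdifferentiableAt hU hx), ← dFun_add (h1.mdifferentiableAt hU hx)
      (((SmoothFunOn.const _ _).mul h2).mdifferentiableAt hU hx)]
    rfl
  simp only [dForm, CField.act, CForm.app, aux hV, aux hW]
  simp only [dReal, CForm.ofReal, CField.bracket, ContinuousLinearMap.comp_apply, map_add, map_sub,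
    Complex.ofRealCLM_apply]
  push_cast
  linear_combination (((mvfderiv (𝓡 3) (fun y => θ.form y (W.im y)) x (V.im x) : ℝ) : ℂ) -
   ((mvfderiv (𝓡 3) (fun y => θ.form y (V.im y)) x (W.im x) : ℝ) : ℂ)) * Complex.I_sq

end ContactForm

section Frame

variable (Z : S.Frame) (θ : ContactForm S)

theorem CRStructure.Frame.mem {x : M} (hx : x ∈ Z.U) :
    Z.Z.re x ∈ S.H x ∧ Z.Z.im x ∈ S.H x := by
  obtain ⟨h, e⟩ := Z.one_zero x hx
  exact ⟨h, e ▸ (S.H x).neg_mem (S.J x ⟨Z.Z.re x, h⟩).2⟩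

theorem ContactForm.form_re {x : M} (hx : x ∈ Z.U) : θ.form x (Z.Z.re x) = 0 :=
  (θ.ker x _).2 (Z.mem hx).1

theorem ContactForm.form_im {x : M} (hx : x ∈ Z.U) : θ.form x (Z.Z.im x) = 0 :=
  (θ.ker x _).2 (Z.mem hx).2

theorem CRStructure.Frame.J_re {x : M} (hx : x ∈ Z.U) (w : S.H x) (hw : (w : TangentSpace (𝓡 3) x) = Z.Z.re x) :
    ((S.J x w : S.H x) : TangentSpace (𝓡 3) x) = -Z.Z.im x := by
  obtain ⟨h, e⟩ := Z.one_zero x hx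
  obtain rfl : w = ⟨Z.Z.re x, h⟩ := Subtype.ext hw
  rw [e, neg_neg]

theorem CRStructure.Frame.J_im {x : M} (hx : x ∈ Z.U) (w : S.H x) (hw : (w : TangentSpace (𝓡 3) x) = Z.Z.im x) :
    ((S.J x w : S.H x) : TangentSpace (𝓡 3) x) = Z.Z.re x := by
  obtain ⟨h, e⟩ := Z.one_zero x hx
  obtain rfl : w = -S.J x ⟨Z.Z.re x, h⟩ := Subtype.ext (hw.trans e)
  rw [map_neg, S.J_sq, neg_neg]

/-- The bundle `H` is spanned by the real and imaginary parts of a frame. -/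
theorem CRStructure.Frame.exists_eq_smul_add {x : M} (hx : x ∈ Z.U) {w : TangentSpace (𝓡 3) x}
    (hw : w ∈ S.H x) : ∃ a b : ℝ, w = a • Z.Z.re x + b • Z.Z.im x := by
  obtain ⟨U, -, hU, X, Y, -, -, h⟩ := S.local_frame x
  obtain ⟨h0, hs, hX, hJ⟩ := h x hU
  obtain ⟨hr, hi⟩ := Z.mem hx
  have mem : ∀ w, w ∈ S.H x ↔ ∃ a b : ℝ, a • X x + b • Y x = w := fun w => by
    rw [hs, Submodule.mem_span_pair]
  obtain ⟨p, q, hpq⟩ := (mem _).1 hr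
  have hY : Y x ∈ S.H x := hJ ▸ (S.J x ⟨X x, hX⟩).2
  -- J-linearity turns Re Z = pX + qY into Im Z = qX − pY; this change of basis has determinant −(p²
  -- + q²), and `hn` shows that it is invertible.
  have eJ : -Z.Z.im x = -q • X x + p • Y x := by
    have e1 : S.J x ⟨Z.Z.re x, hr⟩ = S.J x (p • ⟨X x, hX⟩ + q • S.J x ⟨X x, hX⟩) := by
      congr 1
      exact Subtype.ext (by simp [← hpq, hJ])
    have e2 := congrArg Subtype.val e1
    rw [Z.J_re hx _ rfl, map_add, map_smul, map_smul, S.J_sq] at e2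
    rw [e2]
    simp [hJ]; abel
  have hn : p ^ 2 + q ^ 2 ≠ 0 := by
    intro h
    have hp : p = 0 := by nlinarith [sq_nonneg p, sq_nonneg q]
    have hq : q = 0 := by nlinarith [sq_nonneg p, sq_nonneg q]
    exact Z.ne_zero x hx (by rw [← hpq, hp, hq]; simp)
  obtain ⟨a, b, rfl⟩ := (mem _).1 hw
  have eX : X x = (p / (p ^ 2 + q ^ 2)) • Z.Z.re x + (q / (p ^ 2 + q ^ 2)) • Z.Z.im x := by
    have e3 : Z.Z.im x = q • X x - p • Y x := by rw [← neg_neg (Z.Z.im x), eJ]; module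
    rw [e3, ← hpq]
    match_scalars <;> field_simp
    ring
  have eY : Y x = (q / (p ^ 2 + q ^ 2)) • Z.Z.re x + (-p / (p ^ 2 + q ^ 2)) • Z.Z.im x := by
    have e3 : Z.Z.im x = q • X x - p • Y x := by rw [← neg_neg (Z.Z.im x), eJ]; module
    rw [e3, ← hpq]
    match_scalars <;> field_simp <;> ring
  refine ⟨a * (p / (p ^ 2 + q ^ 2)) + b * (q / (p ^ 2 + q ^ 2)),
    a * (q / (p ^ 2 + q ^ 2)) + b * (-p / (p ^ 2 + q ^ 2)), ?_⟩
  nth_rw 1 [eX, eY]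
  module

end Frame

end CRGeometry
end

/-! ### Part: existence and uniqueness of the Reeb field, and the dual coframe. -/

open scoped Manifold ContDiff
noncomputable section
namespace CRGeometry

open VectorField Topology

variable {M : Type*} [TopologicalSpace M] [ChartedSpace E3 M] [IsManifold (𝓡 3) ∞ M]
  {S : CRStructure M}

theorem CForm.app_conj_ofReal (φ : ∀ x : M, TangentSpace (𝓡 3) x →L[ℝ] ℝ) (V : CField M) (x : M) :
    (CForm.ofReal φ).app V.conj x = starRingEnd ℂ ((CForm.ofReal φ).app V x) := by
  simp [CForm.app, CForm.ofReal, CField.conj]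

namespace ContactForm

variable (θ : ContactForm S) (Z : S.Frame)

/-- The Levi form in a frame, as a real function. -/
def leviReal (x : M) : ℝ := -2 * θ.dReal Z.Z.re Z.Z.im x

/-- With X = Re Z and Y = Im Z, dθ(Z, Z̄) = −2i dθ(X, Y); hence the factor −2 in `leviReal`. -/
theorem levi_eq {x : M} (hx : x ∈ Z.U) : θ.levi Z x = (θ.leviReal Z x : ℂ) := by
  rw [levi, θ.dForm_formC Z.isOpen Z.smooth Z.smooth.conj hx, leviReal]
  have h1 : θ.dReal Z.Z.re Z.Z.conj.im x = -θ.dReal Z.Z.re Z.Z.im x := by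
    rw [← θ.dRealHom_apply (Z.smooth.conj.2.fieldDiffAt Z.isOpen hx),
      ← θ.dRealHom_apply (Z.smooth.2.fieldDiffAt Z.isOpen hx), ← map_neg]
    rfl
  have h2 : θ.dReal Z.Z.im Z.Z.conj.re x = -θ.dReal Z.Z.re Z.Z.im x := θ.dReal_swap _ _ x
  have h3 : θ.dReal Z.Z.re Z.Z.conj.re x = 0 := by
    have := θ.dReal_swap Z.Z.re Z.Z.re x
    change θ.dReal Z.Z.re Z.Z.re x = 0
    linarith
  have h4 : θ.dReal Z.Z.im Z.Z.conj.im x = 0 := by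
    rw [← θ.dRealHom_apply (Z.smooth.conj.2.fieldDiffAt Z.isOpen hx)]
    change θ.dRealHom Z.Z.im x (-Z.Z.im x) = 0
    rw [map_neg, θ.dRealHom_apply (Z.smooth.2.fieldDiffAt Z.isOpen hx)]
    have := θ.dReal_swap Z.Z.im Z.Z.im x
    linarith
  rw [h1, h2, h3, h4]
  push_cast
  linear_combination (2 * (θ.dReal Z.Z.re Z.Z.im x : ℂ)) * Complex.I_sq

theorem leviReal_pos {x : M} (hx : x ∈ Z.U) : 0 < θ.leviReal Z x := by
  have h := θ.levi_pos Z x hx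
  change 0 < (θ.levi Z x).re at h
  rwa [θ.levi_eq Z hx, Complex.ofReal_re] at h

theorem levi_ne_zero {x : M} (hx : x ∈ Z.U) : θ.levi Z x ≠ 0 := by
  rw [θ.levi_eq Z hx]
  exact_mod_cast (θ.leviReal_pos Z hx).ne'

theorem contMDiffOn_leviReal : ContMDiffOn (𝓡 3) 𝓘(ℝ, ℝ) ∞ (θ.leviReal Z) Z.U :=
  contMDiffOn_const.mul (θ.contMDiffOn_dReal Z.isOpen Z.smooth.1 Z.smooth.2)

theorem conj_levi {x : M} (hx : x ∈ Z.U) : starRingEnd ℂ (θ.levi Z x) = θ.levi Z x := by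
  rw [θ.levi_eq Z hx, Complex.conj_ofReal]

theorem smoothFunOn_levi : SmoothFunOn (θ.levi Z) Z.U :=
  (SmoothFunOn.ofReal (θ.contMDiffOn_leviReal Z)).congr fun _ hx => θ.levi_eq Z hx

theorem contMDiffOn_leviReal_inv : ContMDiffOn (𝓡 3) 𝓘(ℝ, ℝ) ∞ (fun x => (θ.leviReal Z x)⁻¹) Z.U :=
  fun x hx => ((contDiffAt_inv ℝ (θ.leviReal_pos Z hx).ne').contMDiffAt (n := ∞)).comp_contMDiffWithinAt
    x (θ.contMDiffOn_leviReal Z x hx)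

/-- A local Reeb field. -/
structure IsReebOn (T : ∀ x : M, TangentSpace (𝓡 3) x) (U : Set M) : Prop where
  smooth : SmoothFieldOn T U
  form_eq_one : ∀ x ∈ U, θ.form x (T x) = 1
  dReal_eq_zero : ∀ x ∈ U, ∀ V, FieldDiffAt V x → θ.dReal T V x = 0

/-- Nondegeneracy of dθ on H in coordinates: since dθ(X, Y) = −h/2, the components a, b can be read
off from contractions with X and Y. The summand `w` is typically a multiple of the Reeb vector. -/
theorem dRealHom_re_im {x : M} (hx : x ∈ Z.U) (a b : ℝ) (w : TangentSpace (𝓡 3) x)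
    (hr : θ.dRealHom Z.Z.re x w = 0) (hi : θ.dRealHom Z.Z.im x w = 0) :
    θ.dRealHom Z.Z.re x (w + (a • Z.Z.re x + b • Z.Z.im x)) = -(b * θ.leviReal Z x / 2) ∧
    θ.dRealHom Z.Z.im x (w + (a • Z.Z.re x + b • Z.Z.im x)) = a * θ.leviReal Z x / 2 := by
  have h1 := θ.dReal_swap Z.Z.re Z.Z.re x
  have h2 := θ.dReal_swap Z.Z.im Z.Z.im x
  have h3 := θ.dReal_swap Z.Z.im Z.Z.re x
  simp only [map_add, map_smul, hr, hi, smul_eq_mul, leviReal,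
    θ.dRealHom_apply (Z.smooth.1.fieldDiffAt Z.isOpen hx),
    θ.dRealHom_apply (Z.smooth.2.fieldDiffAt Z.isOpen hx)]
  constructor
  · linear_combination (a / 2) * h1
  · linear_combination (b / 2) * h2 + a * h3

theorem exists_isReebOn : ∃ T, θ.IsReebOn T Z.U := by
  set X := Z.Z.re with hX
  set Y := Z.Z.im with hY
  have sX : SmoothFieldOn X Z.U := Z.smooth.1
  have sY : SmoothFieldOn Y Z.U := Z.smooth.2
  -- Since θ([X, Y]) = −dθ(X, Y) = h/2, the field 2[X, Y]/h has θ-value 1. The H-component pX + qY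
  -- added to it solves dθ(X, T) = dθ(Y, T) = 0, a linear system with determinant coming from dθ(X,
  -- Y) = −h/2.
  let B := mlieBracket (𝓡 3) X Y
  have sB : SmoothFieldOn B Z.U := sX.mlieBracket Z.isOpen sY
  let k : M → ℝ := fun x => (θ.leviReal Z x)⁻¹
  have sk := θ.contMDiffOn_leviReal_inv Z
  have c2 : ContMDiffOn (𝓡 3) 𝓘(ℝ, ℝ) ∞ (fun _ : M => (2 : ℝ)) Z.U := contMDiffOn_const
  let p : M → ℝ := fun x => -(2 * k x * (2 * k x)) * θ.dReal Y B x
  let q : M → ℝ := fun x => 2 * k x * (2 * k x) * θ.dReal X B x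
  have sp : ContMDiffOn (𝓡 3) 𝓘(ℝ, ℝ) ∞ p Z.U :=
    (((c2.mul sk).mul (c2.mul sk)).neg).mul (θ.contMDiffOn_dReal Z.isOpen sY sB)
  have sq : ContMDiffOn (𝓡 3) 𝓘(ℝ, ℝ) ∞ q Z.U :=
    ((c2.mul sk).mul (c2.mul sk)).mul (θ.contMDiffOn_dReal Z.isOpen sX sB)
  let T : ∀ x : M, TangentSpace (𝓡 3) x := fun x => (2 * k x) • B x + (p x • X x + q x • Y x)
  have sT : SmoothFieldOn T Z.U := (sB.smul (c2.mul sk)).add ((sX.smul sp).add (sY.smul sq))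
  have fB : ∀ x ∈ Z.U, θ.form x (B x) = θ.leviReal Z x / 2 := by
    intro x hx
    have d : ∀ {V : ∀ x : M, TangentSpace (𝓡 3) x}, (∀ y ∈ Z.U, θ.form y (V y) = 0) →
        mvfderiv (𝓡 3) (fun y => θ.form y (V y)) x = 0 := by
      intro V hV
      have e : (fun y => θ.form y (V y)) =ᶠ[𝓝 x] fun _ => (0 : ℝ) := by
        filter_upwards [Z.isOpen.mem_nhds hx] with y hy using hV y hy
      exact e.mfderiv_eq.trans mfderiv_const
    have : θ.dReal X Y x = -θ.form x (B x) := by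
      rw [dReal, d fun y hy => θ.form_re Z hy, d fun y hy => θ.form_im Z hy]
      simp [B]
    rw [leviReal]
    linarith
  have fT : ∀ x ∈ Z.U, θ.form x (T x) = 1 := by
    intro x hx
    have := (θ.leviReal_pos Z hx).ne'
    simp only [T, map_add, map_smul, smul_eq_mul, X, Y, θ.form_re Z hx, θ.form_im Z hx, fB x hx, k]
    field_simp
    ring
  have dX : ∀ x ∈ Z.U, θ.dReal X T x = 0 ∧ θ.dReal Y T x = 0 := by
    intro x hx
    have h0 := (θ.leviReal_pos Z hx).ne'
    have h := θ.dRealHom_re_im Z hx (p x) (q x) 0 (map_zero _) (map_zero _)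
    rw [zero_add] at h
    rw [← θ.dRealHom_apply (sT.fieldDiffAt Z.isOpen hx), ← θ.dRealHom_apply (sT.fieldDiffAt Z.isOpen hx)]
    change θ.dRealHom X x ((2 * k x) • B x + _) = 0 ∧ θ.dRealHom Y x ((2 * k x) • B x + _) = 0
    rw [map_add, h.1, map_add, h.2, map_smul, map_smul,
      θ.dRealHom_apply (sB.fieldDiffAt Z.isOpen hx), θ.dRealHom_apply (sB.fieldDiffAt Z.isOpen hx)]
    simp only [smul_eq_mul, p, q, k]
    constructor
    · field_simp; ring
    · field_simp; ring
  refine ⟨T, sT, fT, fun x hx V hV => ?_⟩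
  rw [← θ.dRealHom_apply hV]
  have hm : V x - θ.form x (V x) • T x ∈ S.H x := by
    rw [← θ.ker, map_sub, map_smul, fT x hx]; simp
  obtain ⟨a, b, hab⟩ := Z.exists_eq_smul_add hx hm
  rw [sub_eq_iff_eq_add] at hab
  have h1 := (dX x hx).1
  have h2 := (dX x hx).2
  have h3 := θ.dReal_swap T T x
  rw [θ.dReal_swap] at h1 h2
  rw [hab, ← hX, ← hY]
  simp only [map_add, map_smul, smul_eq_mul, θ.dRealHom_apply (sX.fieldDiffAt Z.isOpen hx),
    θ.dRealHom_apply (sY.fieldDiffAt Z.isOpen hx), θ.dRealHom_apply (sT.fieldDiffAt Z.isOpen hx)]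
  linear_combination -a * h1 - b * h2 + θ.form x (V x) / 2 * h3

/-- The difference of two Reeb fields lies in H and is annihilated by dθ, which is nondegenerate on
H. -/
theorem isReebOn_unique {T T' : ∀ x : M, TangentSpace (𝓡 3) x} {U U' : Set M} (hU : IsOpen U)
    (hU' : IsOpen U') (hT : θ.IsReebOn T U) (hT' : θ.IsReebOn T' U') {x : M} (hx : x ∈ U)
    (hx' : x ∈ U') : T x = T' x := by
  obtain ⟨Z, hZ⟩ := S.exists_frame x
  have hm : T x - T' x ∈ S.H x := by
    rw [← θ.ker, map_sub, hT.form_eq_one x hx, hT'.form_eq_one x hx', sub_self]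
  obtain ⟨a, b, hab⟩ := Z.exists_eq_smul_add hZ hm
  have h0 := (θ.leviReal_pos Z hZ).ne'
  have h := θ.dRealHom_re_im Z hZ a b 0 (map_zero _) (map_zero _)
  rw [zero_add, ← hab, map_sub, map_sub, θ.dRealHom_apply (hT.smooth.fieldDiffAt hU hx),
    θ.dRealHom_apply (hT.smooth.fieldDiffAt hU hx), θ.dRealHom_apply (hT'.smooth.fieldDiffAt hU' hx'),
    θ.dRealHom_apply (hT'.smooth.fieldDiffAt hU' hx'), θ.dReal_swap _ T, θ.dReal_swap _ T,
    θ.dReal_swap _ T', θ.dReal_swap _ T',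
    hT.dReal_eq_zero x hx _ (Z.smooth.1.fieldDiffAt Z.isOpen hZ),
    hT.dReal_eq_zero x hx _ (Z.smooth.2.fieldDiffAt Z.isOpen hZ),
    hT'.dReal_eq_zero x hx' _ (Z.smooth.1.fieldDiffAt Z.isOpen hZ),
    hT'.dReal_eq_zero x hx' _ (Z.smooth.2.fieldDiffAt Z.isOpen hZ), sub_self] at h
  have hb : b = 0 := (mul_eq_zero.1 (by linarith [h.1] : b * θ.leviReal Z x = 0)).resolve_right h0
  have ha : a = 0 := (mul_eq_zero.1 (by linarith [h.2] : a * θ.leviReal Z x = 0)).resolve_right h0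
  rw [ha, hb, zero_smul, zero_smul, add_zero] at hab
  exact sub_eq_zero.1 hab

/-- By uniqueness the local Reeb fields agree on overlaps, so the field taking at each x the value
of the solution chosen for x coincides near x with that one smooth solution; brackets and
derivatives depend only on germs. -/
theorem exists_isReebOn_univ : ∃ T, θ.IsReebOn T Set.univ := by
  choose F hF using S.exists_frame
  choose T hT using fun x => θ.exists_isReebOn (F x)
  have e : ∀ x, ∀ y ∈ (F x).U, T y y = T x y := fun x y hy =>
    θ.isReebOn_unique (F y).isOpen (F x).isOpen (hT y) (hT x) (hF y) hy
  have ev : ∀ x, (fun y => T y y) =ᶠ[𝓝 x] T x := fun x => by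
    filter_upwards [(F x).isOpen.mem_nhds (hF x)] with y hy using e x y hy
  refine ⟨fun x => T x x, fun x _ => ?_, fun x _ => (hT x).form_eq_one x (hF x), fun x _ V hV => ?_⟩
  · refine (((hT x).smooth.contMDiffAt (F x).isOpen (hF x)).congr_of_eventuallyEq ?_).contMDiffWithinAt
    filter_upwards [ev x] with y hy
    rw [hy]
  · have := (hT x).dReal_eq_zero x (hF x) V hV
    rw [dReal] at this ⊢
    have e4 : mlieBracket (𝓡 3) (fun y => T y y) V x = mlieBracket (𝓡 3) (T x) V x :=
      (ev x).mlieBracket_vectorField_eq Filter.EventuallyEq.rfl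
    have e2 : (fun y => θ.form y (T y y)) =ᶠ[𝓝 x] fun y => θ.form y (T x y) := by
      filter_upwards [ev x] with y hy
      exact congrArg (θ.form y) hy
    have e3 : mvfderiv (𝓡 3) (fun y => θ.form y (T y y)) x = mvfderiv (𝓡 3) (fun y => θ.form y (T x y)) x :=
      e2.mfderiv_eq
    rw [e3, e4]
    exact this

theorem dReal_zero_right (X : ∀ x : M, TangentSpace (𝓡 3) x) (x : M) :
    θ.dReal X (fun _ => 0) x = 0 := by
  rw [← θ.dRealHom_apply ((SmoothFieldOn.zero Set.univ).fieldDiffAt isOpen_univ trivial), map_zero]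

theorem IsReebOn.isReeb {T : ∀ x : M, TangentSpace (𝓡 3) x} (hT : θ.IsReebOn T Set.univ) :
    θ.IsReeb T := by
  refine ⟨hT.smooth, fun x => hT.form_eq_one x trivial, fun U V hU hV x hx => ?_⟩
  rw [θ.dForm_formC hU (CField.SmoothOn.ofReal (ContMDiffOn.mono hT.smooth (Set.subset_univ U))) hV hx]
  have z : ∀ W : ∀ x : M, TangentSpace (𝓡 3) x, θ.dReal (CField.ofReal T).im W x = 0 := fun W => by
    rw [θ.dReal_swap]
    exact neg_eq_zero.2 (θ.dReal_zero_right W x)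
  rw [z, z]
  change ((θ.dReal T V.re x - 0 : ℝ) : ℂ) + Complex.I * ((θ.dReal T V.im x + 0 : ℝ) : ℂ) = 0
  rw [hT.dReal_eq_zero x trivial _ (hV.1.fieldDiffAt hU hx),
    hT.dReal_eq_zero x trivial _ (hV.2.fieldDiffAt hU hx)]
  simp

/-- `IsReeb` tests against smooth fields on open sets, `IsReebOn` against fields merely
differentiable at the point. By tensoriality such a field may be replaced by a smooth local
extension of its value. -/
theorem IsReeb.isReebOn {T : ∀ x : M, TangentSpace (𝓡 3) x} (hT : θ.IsReeb T) :
    θ.IsReebOn T Set.univ := by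
  refine ⟨hT.1, fun x _ => hT.2.1 x, fun x _ V hV => ?_⟩
  obtain ⟨s, hs, hW⟩ := FiberBundle.exists_contMDiffOn_extend (k := ∞) (𝓡 3) E3 (V x)
  obtain ⟨O, hO, hOo, hxO⟩ := mem_nhds_iff.1 hs
  set W : ∀ y : M, TangentSpace (𝓡 3) y := FiberBundle.extend E3 (V x) with hWdef
  have hWx : W x = V x := FiberBundle.extend_apply_self ..
  have hWO : SmoothFieldOn W O := hW.mono hO
  have h := hT.2.2 O (CField.ofReal W) hOo (CField.SmoothOn.ofReal hWO) x hxO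
  rw [θ.dForm_formC hOo (CField.SmoothOn.ofReal (ContMDiffOn.mono hT.1 (Set.subset_univ O)))
    (CField.SmoothOn.ofReal hWO) hxO] at h
  have h' := congrArg Complex.re h
  have z : θ.dReal (CField.ofReal T).im (CField.ofReal W).im x = 0 := θ.dReal_zero_right _ x
  rw [z, sub_zero, Complex.add_re, Complex.ofReal_re, Complex.re_mul_ofReal] at h'
  rw [← θ.dRealHom_apply hV, ← hWx, θ.dRealHom_apply (hWO.fieldDiffAt hOo hxO)]
  have h2 : θ.dReal (CField.ofReal T).re (CField.ofReal W).re x = 0 := by simpa using h'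
  exact h2

/-- Existence of a global Reeb field is what gives content to the `Classical.epsilon` in `reeb`. -/
theorem isReebOn_reeb : θ.IsReebOn θ.reeb.re Set.univ := by
  obtain ⟨T, hT⟩ := θ.exists_isReebOn_univ
  exact IsReeb.isReebOn θ (Classical.epsilon_spec (p := θ.IsReeb) ⟨T, hT.isReeb⟩)

theorem smoothOn_reeb (U : Set M) : θ.reeb.SmoothOn U :=
  (CField.SmoothOn.ofReal θ.isReebOn_reeb.smooth).mono (Set.subset_univ U)

theorem reeb_conj : θ.reeb.conj = θ.reeb := by
  simp [reeb, CField.conj, CField.ofReal]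

theorem form_reeb (x : M) : θ.form x (θ.reeb.re x) = 1 := θ.isReebOn_reeb.form_eq_one x trivial

/-- The coframe of a frame, given by contraction with the exterior derivative. -/
def coframeHom (x : M) : TangentSpace (𝓡 3) x →L[ℝ] ℂ :=
  (θ.leviReal Z x : ℂ)⁻¹ • (Complex.ofRealCLM.comp (θ.dRealHom Z.Z.im x)
    + Complex.I • Complex.ofRealCLM.comp (θ.dRealHom Z.Z.re x))

theorem coframeHom_apply (x : M) (v : TangentSpace (𝓡 3) x) : θ.coframeHom Z x v =
    (θ.leviReal Z x : ℂ)⁻¹ * ((θ.dRealHom Z.Z.im x v : ℝ) + Complex.I * (θ.dRealHom Z.Z.re x v : ℝ)) :=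
  rfl

theorem dRealHom_reeb {x : M} (hx : x ∈ Z.U) :
    θ.dRealHom Z.Z.re x (θ.reeb.re x) = 0 ∧ θ.dRealHom Z.Z.im x (θ.reeb.re x) = 0 := by
  have hd : FieldDiffAt θ.reeb.re x := (θ.smoothOn_reeb Set.univ).1.fieldDiffAt isOpen_univ trivial
  rw [θ.dRealHom_apply hd, θ.dRealHom_apply hd, θ.dReal_swap, θ.dReal_swap Z.Z.im,
    θ.isReebOn_reeb.dReal_eq_zero x trivial _ (Z.smooth.1.fieldDiffAt Z.isOpen hx),
    θ.isReebOn_reeb.dReal_eq_zero x trivial _ (Z.smooth.2.fieldDiffAt Z.isOpen hx)]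
  simp

theorem exists_eq_reeb_add {x : M} (hx : x ∈ Z.U) (v : TangentSpace (𝓡 3) x) : ∃ a b : ℝ,
    v = θ.form x v • θ.reeb.re x + (a • Z.Z.re x + b • Z.Z.im x) := by
  have hm : v - θ.form x v • θ.reeb.re x ∈ S.H x := by
    rw [← θ.ker, map_sub, map_smul, θ.form_reeb]; simp
  obtain ⟨a, b, hab⟩ := Z.exists_eq_smul_add hx hm
  exact ⟨a, b, by rw [← hab]; abel⟩

theorem coframeHom_decomp {x : M} (hx : x ∈ Z.U) (c a b : ℝ) :
    θ.coframeHom Z x (c • θ.reeb.re x + (a • Z.Z.re x + b • Z.Z.im x)) = (a - Complex.I * b) / 2 := by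
  have h := θ.dRealHom_reeb Z hx
  have h' := θ.dRealHom_re_im Z hx a b (c • θ.reeb.re x) (by rw [map_smul, h.1, smul_zero])
    (by rw [map_smul, h.2, smul_zero])
  have h0 : (θ.leviReal Z x : ℂ) ≠ 0 := by exact_mod_cast (θ.leviReal_pos Z hx).ne'
  rw [coframeHom_apply, h'.1, h'.2]
  push_cast
  field_simp
  ring

/-- The three conditions in `coframe` are met by the contraction formula, so `Classical.epsilon`
returns a form satisfying them; they fix its values on Re Z, Im Z and T, which span the tangent
space. -/
theorem coframe_eq {x : M} (hx : x ∈ Z.U) : θ.coframe Z x = θ.coframeHom Z x := by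
  have hr : θ.coframeHom Z x (Z.Z.re x) = 1 / 2 := by
    have := θ.coframeHom_decomp Z hx 0 1 0
    simpa using this
  have hi : θ.coframeHom Z x (Z.Z.im x) = -Complex.I / 2 := by
    have := θ.coframeHom_decomp Z hx 0 0 1
    simpa using this
  have hT : θ.coframeHom Z x (θ.reeb.re x) = 0 := by
    have := θ.coframeHom_decomp Z hx 1 0 0
    simpa using this
  have hs := Classical.epsilon_spec (p := fun φ : TangentSpace (𝓡 3) x →L[ℝ] ℂ =>
    φ (Z.Z.re x) + Complex.I * φ (Z.Z.im x) = 1 ∧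
    φ (Z.Z.re x) - Complex.I * φ (Z.Z.im x) = 0 ∧ φ (θ.reeb.re x) = 0) ⟨θ.coframeHom Z x, by
      rw [hr, hi, hT]
      exact ⟨by linear_combination (-1 / 2 : ℂ) * Complex.I_sq,
        by linear_combination (1 / 2 : ℂ) * Complex.I_sq, rfl⟩⟩
  change θ.coframe Z x _ + _ * θ.coframe Z x _ = 1 ∧ θ.coframe Z x _ - _ * θ.coframe Z x _ = 0 ∧
    θ.coframe Z x _ = 0 at hs
  obtain ⟨h1, h2, h3⟩ := hs
  ext v
  obtain ⟨a, b, hab⟩ := θ.exists_eq_reeb_add Z hx v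
  rw [hab]
  have hr' : θ.coframe Z x (Z.Z.re x) = 1 / 2 := by linear_combination (h1 + h2) / 2
  have hi' : θ.coframe Z x (Z.Z.im x) = -Complex.I / 2 := by
    linear_combination (-Complex.I / 2) * (h1 - h2) + θ.coframe Z x (Z.Z.im x) * Complex.I_sq
  simp only [map_add, map_smul, h3, hT, hr, hi, hr', hi']

theorem coframe_decomp {x : M} (hx : x ∈ Z.U) (c a b : ℝ) :
    θ.coframe Z x (c • θ.reeb.re x + (a • Z.Z.re x + b • Z.Z.im x)) = (a - Complex.I * b) / 2 := by
  rw [θ.coframe_eq Z hx, θ.coframeHom_decomp Z hx]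

theorem smoothFunOn_coframe_apply {X : ∀ x : M, TangentSpace (𝓡 3) x} {U : Set M} (hU : IsOpen U)
    (hUZ : U ⊆ Z.U) (hX : SmoothFieldOn X U) : SmoothFunOn (fun x => θ.coframe Z x (X x)) U := by
  have h0 : SmoothFunOn (fun x => (θ.leviReal Z x : ℂ)⁻¹) U :=
    ((SmoothFunOn.ofReal (θ.contMDiffOn_leviReal Z)).inv fun x hx => by
      exact_mod_cast (θ.leviReal_pos Z hx).ne').mono hUZ
  have h1 := SmoothFunOn.ofReal (θ.contMDiffOn_dReal hU (ContMDiffOn.mono Z.smooth.2 hUZ) hX)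
  have h2 := SmoothFunOn.ofReal (θ.contMDiffOn_dReal hU (ContMDiffOn.mono Z.smooth.1 hUZ) hX)
  refine (h0.mul (h1.add ((SmoothFunOn.const Complex.I U).mul h2))).congr fun x hx => ?_
  rw [θ.coframe_eq Z (hUZ hx), coframeHom_apply, θ.dRealHom_apply (hX.fieldDiffAt hU hx),
    θ.dRealHom_apply (hX.fieldDiffAt hU hx)]

theorem smoothFunOn_coframe_app {V : CField M} {U : Set M} (hU : IsOpen U) (hUZ : U ⊆ Z.U)
    (hV : V.SmoothOn U) : SmoothFunOn ((θ.coframe Z).app V) U :=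
  (θ.smoothFunOn_coframe_apply Z hU hUZ hV.1).add
    ((SmoothFunOn.const _ _).mul (θ.smoothFunOn_coframe_apply Z hU hUZ hV.2))

/-- Expansion of a complex tangent vector in the frame `Z, Z̄, T`. -/
theorem app_decomp (φ : CForm M) (V : CField M) {x : M} (hx : x ∈ Z.U) : φ.app V x =
    (θ.coframe Z).app V x * φ.app Z.Z x
      + starRingEnd ℂ ((θ.coframe Z).app V.conj x) * φ.app Z.Z.conj x
      + θ.formC.app V x * φ.app θ.reeb x := by
  obtain ⟨a, b, hab⟩ := θ.exists_eq_reeb_add Z hx (V.re x)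
  obtain ⟨a', b', hab'⟩ := θ.exists_eq_reeb_add Z hx (V.im x)
  have hR : θ.reeb.im x = 0 := rfl
  have e1 : φ x (V.re x) = θ.form x (V.re x) * φ x (θ.reeb.re x) + (a * φ x (Z.Z.re x)
      + b * φ x (Z.Z.im x)) := by
    conv_lhs => rw [hab]
    simp
  have e2 : φ x (V.im x) = θ.form x (V.im x) * φ x (θ.reeb.re x) + (a' * φ x (Z.Z.re x)
      + b' * φ x (Z.Z.im x)) := by
    conv_lhs => rw [hab']
    simp
  have f1 : θ.coframe Z x (V.re x) = (a - Complex.I * b) / 2 := by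
    rw [hab, θ.coframe_decomp Z hx]
  have f2 : θ.coframe Z x (V.im x) = (a' - Complex.I * b') / 2 := by
    rw [hab', θ.coframe_decomp Z hx]
  simp only [CForm.app, CField.conj, CForm.ofReal, ContinuousLinearMap.comp_apply, map_neg, map_zero,
    Complex.ofRealCLM_apply, hR, e1, e2, f1, f2, map_add, map_mul, map_sub, map_div₀, Complex.conj_I,
    Complex.conj_ofReal, map_ofNat]
  have i3 : Complex.I ^ 3 = -Complex.I := by rw [pow_succ, Complex.I_sq]; ring
  ring_nf
  simp only [Complex.I_sq, i3]
  ring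

end ContactForm

end CRGeometry
end

/-! ### Part: bracket relations of Z, Z̄, T and smoothness of connection, torsion and curvature. -/

open scoped Manifold ContDiff
noncomputable section
namespace CRGeometry

open VectorField Topology

variable {M : Type*} [TopologicalSpace M] [ChartedSpace E3 M] [IsManifold (𝓡 3) ∞ M]
  {S : CRStructure M}

theorem CForm.app_neg_of (φ : CForm M) {V W : CField M} {x : M}
    (h : V.re x = -W.re x ∧ V.im x = -W.im x) : φ.app V x = -φ.app W x := by
  rw [CForm.app, CForm.app, h.1, h.2, map_neg, map_neg]; ring

theorem CForm.app_bracket_swap (φ : CForm M) (V W : CField M) (x : M) :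
    φ.app (V.bracket W) x = -φ.app (W.bracket V) x :=
  φ.app_neg_of (CField.bracket_swap V W x)

theorem CForm.app_bracket_conj (φ : CForm M) {V W : CField M} {U : Set M} (hU : IsOpen U)
    (hV : V.SmoothOn U) (hW : W.SmoothOn U) {x : M} (hx : x ∈ U) :
    φ.app (V.bracket W).conj x = φ.app (V.conj.bracket W.conj) x := by
  obtain ⟨h1, h2⟩ := CField.bracket_conj hU hV hW hx
  exact (φ.app_eq_of_eq h1 h2).symm

/-- When φ is constant on both fields only the bracket term of dφ survives; this is how dθ is
evaluated on frame vectors. -/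
theorem dForm_of_const {φ : CForm M} {V W : CField M} {U : Set M} (hU : IsOpen U) {c d : ℂ}
    (hV : ∀ y ∈ U, φ.app V y = c) (hW : ∀ y ∈ U, φ.app W y = d) {x : M} (hx : x ∈ U) :
    dForm φ V W x = -φ.app (V.bracket W) x := by
  have h1 : φ.app V =ᶠ[𝓝 x] fun _ => c := by
    filter_upwards [hU.mem_nhds hx] with y hy using hV y hy
  have h2 : φ.app W =ᶠ[𝓝 x] fun _ => d := by
    filter_upwards [hU.mem_nhds hx] with y hy using hW y hy
  rw [dForm, V.act_congr h2, W.act_congr h1, CField.act_const, CField.act_const]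
  ring

namespace ContactForm

variable (θ : ContactForm S) (Z : S.Frame)

section app

variable {x : M} (hx : x ∈ Z.U)
include hx

theorem formC_app_Z : θ.formC.app Z.Z x = 0 := by
  simp [CForm.app, CForm.ofReal, θ.form_re Z hx, θ.form_im Z hx]

theorem formC_app_Zbar : θ.formC.app Z.Z.conj x = 0 := by
  rw [CForm.app_conj_ofReal, θ.formC_app_Z Z hx, map_zero]

omit hx in
theorem formC_app_reeb : θ.formC.app θ.reeb x = 1 := by
  have hR : θ.reeb.im x = 0 := rfl
  simp [CForm.app, CForm.ofReal, θ.form_reeb, hR]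

theorem coframe_re : θ.coframe Z x (Z.Z.re x) = 1 / 2 := by
  simpa using θ.coframe_decomp Z hx 0 1 0

theorem coframe_im : θ.coframe Z x (Z.Z.im x) = -Complex.I / 2 := by
  simpa using θ.coframe_decomp Z hx 0 0 1

theorem coframe_app_Z : (θ.coframe Z).app Z.Z x = 1 := by
  rw [CForm.app, θ.coframe_re Z hx, θ.coframe_im Z hx]
  linear_combination (-1 / 2 : ℂ) * Complex.I_sq

theorem coframe_app_Zbar : (θ.coframe Z).app Z.Z.conj x = 0 := by
  rw [CForm.app]
  change θ.coframe Z x (Z.Z.re x) + Complex.I * θ.coframe Z x (-Z.Z.im x) = 0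
  rw [map_neg, θ.coframe_re Z hx, θ.coframe_im Z hx]
  linear_combination (1 / 2 : ℂ) * Complex.I_sq

theorem coframe_app_reeb : (θ.coframe Z).app θ.reeb x = 0 := by
  have hR : θ.reeb.im x = 0 := rfl
  have := θ.coframe_decomp Z hx 1 0 0
  rw [CForm.app, hR, map_zero, mul_zero, add_zero]
  simpa using this

theorem conn_app (V : CField M) : (θ.conn Z).app V x = θ.connZ Z x * (θ.coframe Z).app V x
    + θ.connZbar Z x * starRingEnd ℂ ((θ.coframe Z).app V.conj x)
    + θ.connT Z x * θ.formC.app V x := by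
  rw [← CForm.app_conj, CField.conj_conj]
  simp only [CForm.app, conn, add_apply, smul_apply, smul_eq_mul]
  ring

theorem conn_app_Z : (θ.conn Z).app Z.Z x = θ.connZ Z x := by
  rw [θ.conn_app Z hx, θ.coframe_app_Z Z hx, θ.coframe_app_Zbar Z hx, θ.formC_app_Z Z hx]
  simp

theorem conn_app_Zbar : (θ.conn Z).app Z.Z.conj x = θ.connZbar Z x := by
  rw [θ.conn_app Z hx, θ.coframe_app_Zbar Z hx, CField.conj_conj, θ.coframe_app_Z Z hx,
    θ.formC_app_Zbar Z hx]
  simp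

theorem formC_app_bracket_Z : θ.formC.app (Z.Z.bracket Z.Z.conj) x = -Complex.I * θ.levi Z x := by
  rw [levi, dForm_of_const Z.isOpen (fun y hy => θ.formC_app_Z Z hy)
    (fun y hy => θ.formC_app_Zbar Z hy) hx]
  linear_combination θ.formC.app (Z.Z.bracket Z.Z.conj) x * Complex.I_sq

theorem formC_app_bracket_reeb {V : CField M} (hV : V.SmoothOn Z.U)
    (h0 : ∀ y ∈ Z.U, θ.formC.app V y = 0) : θ.formC.app (θ.reeb.bracket V) x = 0 := by
  have h := (θ.isReebOn_reeb.isReeb).2.2 Z.U V Z.isOpen hV x hx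
  have h' := dForm_of_const (V := θ.reeb) Z.isOpen (fun y _ => θ.formC_app_reeb (x := y)) h0 hx
  exact neg_eq_zero.1 (h'.symm.trans h)

end app

/-- The coefficient of `Z̄` in `[T, Z]`. -/
def reebCoeff (x : M) : ℂ := starRingEnd ℂ ((θ.coframe Z).app (θ.reeb.bracket Z.Z.conj) x)

theorem torsion_eq (x : M) : θ.torsion Z x = -(θ.levi Z x * θ.reebCoeff Z x) := by
  rw [torsion, reebCoeff]; ring

section bracket

variable {x : M} (hx : x ∈ Z.U)
include hx

/-- The coefficients of [Z, Z̄] in the frame: −ω(Z̄) by definition of the connection, its conjugate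
up to sign, and the Levi form. Stated for every φ, so that φ = du yields the commutator on functions
and other choices yield exterior derivatives. -/
theorem app_bracket_Z (φ : CForm M) : φ.app (Z.Z.bracket Z.Z.conj) x =
    -θ.connZbar Z x * φ.app Z.Z x + starRingEnd ℂ (θ.connZbar Z x) * φ.app Z.Z.conj x
      - Complex.I * θ.levi Z x * φ.app θ.reeb x := by
  rw [θ.app_decomp Z φ _ hx, θ.formC_app_bracket_Z Z hx,
    CForm.app_bracket_conj _ Z.isOpen Z.smooth Z.smooth.conj hx, CField.conj_conj,
    CForm.app_bracket_swap _ Z.Z Z.Z.conj, connZbar]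
  ring

theorem app_bracket_reeb_Z (φ : CForm M) : φ.app (θ.reeb.bracket Z.Z) x =
    θ.connT Z x * φ.app Z.Z x + θ.reebCoeff Z x * φ.app Z.Z.conj x := by
  rw [θ.app_decomp Z φ _ hx, θ.formC_app_bracket_reeb Z hx Z.smooth fun y hy => θ.formC_app_Z Z hy,
    CForm.app_bracket_conj _ Z.isOpen (θ.smoothOn_reeb _) Z.smooth hx, reeb_conj, connT, reebCoeff]
  ring

theorem app_bracket_reeb_Zbar (φ : CForm M) : φ.app (θ.reeb.bracket Z.Z.conj) x =
    starRingEnd ℂ (θ.connT Z x) * φ.app Z.Z.conj x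
      + starRingEnd ℂ (θ.reebCoeff Z x) * φ.app Z.Z x := by
  rw [θ.app_decomp Z φ _ hx, θ.formC_app_bracket_reeb Z hx Z.smooth.conj fun y hy =>
    θ.formC_app_Zbar Z hy, CForm.app_bracket_conj _ Z.isOpen (θ.smoothOn_reeb _) Z.smooth.conj hx,
    reeb_conj, CField.conj_conj, connT, reebCoeff, Complex.conj_conj]
  ring

variable {u : M → ℂ} (hu : SmoothFunOn u Z.U)
include hu

theorem act_Z_Zbar : Z.Z.act (Z.Z.conj.act u) x = Z.Z.conj.act (Z.Z.act u) x
    - θ.connZbar Z x * Z.Z.act u x + starRingEnd ℂ (θ.connZbar Z x) * Z.Z.conj.act u x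
    - Complex.I * θ.levi Z x * θ.reeb.act u x := by
  have h1 := CField.act_bracket Z.isOpen Z.smooth Z.smooth.conj hu hx
  rw [CField.act, θ.app_bracket_Z Z hx] at h1
  change -θ.connZbar Z x * Z.Z.act u x + starRingEnd ℂ (θ.connZbar Z x) * Z.Z.conj.act u x
    - Complex.I * θ.levi Z x * θ.reeb.act u x = _ at h1
  linear_combination -h1

theorem act_reeb_Z : θ.reeb.act (Z.Z.act u) x = Z.Z.act (θ.reeb.act u) x
    + θ.connT Z x * Z.Z.act u x + θ.reebCoeff Z x * Z.Z.conj.act u x := by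
  have h1 := CField.act_bracket Z.isOpen (θ.smoothOn_reeb _) Z.smooth hu hx
  rw [CField.act, θ.app_bracket_reeb_Z Z hx] at h1
  change θ.connT Z x * Z.Z.act u x + θ.reebCoeff Z x * Z.Z.conj.act u x = _ at h1
  linear_combination -h1

theorem act_reeb_Zbar : θ.reeb.act (Z.Z.conj.act u) x = Z.Z.conj.act (θ.reeb.act u) x
    + starRingEnd ℂ (θ.connT Z x) * Z.Z.conj.act u x
    + starRingEnd ℂ (θ.reebCoeff Z x) * Z.Z.act u x := by
  have h1 := CField.act_bracket Z.isOpen (θ.smoothOn_reeb _) Z.smooth.conj hu hx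
  rw [CField.act, θ.app_bracket_reeb_Zbar Z hx] at h1
  change starRingEnd ℂ (θ.connT Z x) * Z.Z.conj.act u x
    + starRingEnd ℂ (θ.reebCoeff Z x) * Z.Z.act u x = _ at h1
  linear_combination -h1

end bracket

section smooth

theorem smoothFunOn_connZbar : SmoothFunOn (θ.connZbar Z) Z.U :=
  θ.smoothFunOn_coframe_app Z Z.isOpen subset_rfl (Z.smooth.conj.bracket Z.isOpen Z.smooth)

theorem smoothFunOn_connT : SmoothFunOn (θ.connT Z) Z.U :=
  θ.smoothFunOn_coframe_app Z Z.isOpen subset_rfl ((θ.smoothOn_reeb _).bracket Z.isOpen Z.smooth)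

theorem smoothFunOn_reebCoeff : SmoothFunOn (θ.reebCoeff Z) Z.U :=
  (θ.smoothFunOn_coframe_app Z Z.isOpen subset_rfl
    ((θ.smoothOn_reeb _).bracket Z.isOpen Z.smooth.conj)).conj

theorem smoothFunOn_levi_inv : SmoothFunOn (fun x => (θ.levi Z x)⁻¹) Z.U :=
  (θ.smoothFunOn_levi Z).inv fun _ hx => θ.levi_ne_zero Z hx

theorem smoothFunOn_connZ : SmoothFunOn (θ.connZ Z) Z.U :=
  ((θ.smoothFunOn_levi_inv Z).mul (Z.smooth.act Z.isOpen (θ.smoothFunOn_levi Z))).sub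
    (θ.smoothFunOn_connZbar Z).conj

theorem smoothFunOn_torsion : SmoothFunOn (θ.torsion Z) Z.U :=
  (θ.smoothFunOn_levi Z).neg.mul (θ.smoothFunOn_reebCoeff Z)

theorem smoothFunOn_conn_app_Z : SmoothFunOn ((θ.conn Z).app Z.Z) Z.U :=
  (θ.smoothFunOn_connZ Z).congr fun _ hx => θ.conn_app_Z Z hx

theorem smoothFunOn_conn_app_Zbar : SmoothFunOn ((θ.conn Z).app Z.Z.conj) Z.U :=
  (θ.smoothFunOn_connZbar Z).congr fun _ hx => θ.conn_app_Zbar Z hx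

/-- This is dω(Z, Z̄) with [Z, Z̄] expanded in the frame; the T-component of the bracket is
responsible for the last term. -/
theorem scalarCurv_eq {x : M} (hx : x ∈ Z.U) : θ.scalarCurv Z x = (θ.levi Z x)⁻¹ *
    (Z.Z.act (θ.connZbar Z) x - Z.Z.conj.act (θ.connZ Z) x + θ.connZ Z x * θ.connZbar Z x
      - starRingEnd ℂ (θ.connZbar Z x) * θ.connZbar Z x + Complex.I * θ.levi Z x * θ.connT Z x) := by
  have hT : (θ.conn Z).app θ.reeb x = θ.connT Z x := by
    rw [θ.conn_app Z hx, reeb_conj, θ.coframe_app_reeb Z hx, θ.formC_app_reeb]; simp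
  rw [scalarCurv, dForm, θ.app_bracket_Z Z hx, θ.conn_app_Z Z hx, θ.conn_app_Zbar Z hx, hT,
    act_congr_on Z.Z Z.isOpen (fun y hy => θ.conn_app_Zbar Z hy) hx,
    act_congr_on Z.Z.conj Z.isOpen (fun y hy => θ.conn_app_Z Z hy) hx]
  ring

theorem smoothFunOn_scalarCurv : SmoothFunOn (θ.scalarCurv Z) Z.U := by
  have b := θ.smoothFunOn_connZbar Z
  have a := θ.smoothFunOn_connZ Z
  refine ContMDiffOn.congr ?_ fun x hx => θ.scalarCurv_eq Z hx
  exact (θ.smoothFunOn_levi_inv Z).mul (((((Z.smooth.act Z.isOpen b).sub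
    (Z.smooth.conj.act Z.isOpen a)).add (a.mul b)).sub (b.conj.mul b)).add
    (((SmoothFunOn.const _ _).mul (θ.smoothFunOn_levi Z)).mul (θ.smoothFunOn_connT Z)))

variable {u : M → ℂ} (hu : SmoothFunOn u Z.U) (p : ℤ)
include hu

theorem smoothFunOn_nablaDown : SmoothFunOn (θ.nablaDown Z p u) Z.U :=
  (Z.smooth.act Z.isOpen hu).sub
    (((SmoothFunOn.const _ _).mul (θ.smoothFunOn_conn_app_Z Z)).mul hu)

theorem smoothFunOn_nablaUp : SmoothFunOn (θ.nablaUp Z p u) Z.U :=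
  (θ.smoothFunOn_levi_inv Z).mul ((Z.smooth.conj.act Z.isOpen hu).sub
    (((SmoothFunOn.const _ _).mul (θ.smoothFunOn_conn_app_Zbar Z)).mul hu))

theorem smoothFunOn_sublaplacian : SmoothFunOn (θ.sublaplacian Z u) Z.U :=
  ((θ.smoothFunOn_nablaUp Z (θ.smoothFunOn_nablaDown Z hu 0) 1).add
    (θ.smoothFunOn_nablaDown Z (θ.smoothFunOn_nablaUp Z hu 0) (-1))).neg

end smooth

/-- A combination of Z, Z̄, T killing all functions is the zero vector; the dual coframe θ¹, its
conjugate and θ then extract the three coefficients. -/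
theorem frame_independent [T2Space M] {x : M} (hx : x ∈ Z.U) {α β γ : ℂ}
    (h : ∀ s : M → ℝ, ContMDiff (𝓡 3) 𝓘(ℝ, ℝ) ∞ s → α * Z.Z.act (fun y => (s y : ℂ)) x
      + β * Z.Z.conj.act (fun y => (s y : ℂ)) x + γ * θ.reeb.act (fun y => (s y : ℂ)) x = 0) :
    α = 0 ∧ β = 0 ∧ γ = 0 := by
  let V : CField M := ((Z.Z.smul fun _ => α).add (Z.Z.conj.smul fun _ => β)).add
    (θ.reeb.smul fun _ => γ)
  have hV : ∀ φ : CForm M, φ.app V x = α * φ.app Z.Z x + β * φ.app Z.Z.conj x + γ * φ.app θ.reeb x :=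
    fun φ => by simp only [V, CForm.app_add, CForm.app_smul]
  obtain ⟨h1, h2⟩ := CField.eq_of_act_eq (V := V) (W := V.smul fun _ => 0) (x := x) fun s hs => by
    have := h s hs
    rw [CField.act, CField.act, CForm.app_smul, zero_mul, hV]
    exact this
  have h0 : ∀ φ : CForm M, φ.app V x = 0 := fun φ => by
    rw [φ.app_eq_of_eq h1 h2, CForm.app_smul, zero_mul]
  have e1 := (hV (θ.coframe Z)).symm.trans (h0 _)
  have e2 := (hV θ.formC).symm.trans (h0 _)
  have e3 := (hV (θ.coframe Z).conj).symm.trans (h0 _)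
  rw [θ.coframe_app_Z Z hx, θ.coframe_app_Zbar Z hx, θ.coframe_app_reeb Z hx] at e1
  rw [θ.formC_app_Z Z hx, θ.formC_app_Zbar Z hx, θ.formC_app_reeb] at e2
  rw [CForm.app_conj', CForm.app_conj', CForm.app_conj', reeb_conj, CField.conj_conj,
    θ.coframe_app_Z Z hx, θ.coframe_app_Zbar Z hx, θ.coframe_app_reeb Z hx] at e3
  simp only [map_zero, map_one, mul_zero, mul_one, add_zero, zero_add] at e1 e2 e3
  exact ⟨e1, e3, e2⟩

end ContactForm

end CRGeometry
end

/-! ### Part: the algebra of smooth functions on the domain of a frame, and its derivations. -/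

open scoped Manifold ContDiff
noncomputable section
namespace CRGeometry

open VectorField Topology

variable {M : Type*} [TopologicalSpace M] [ChartedSpace E3 M]

/-- The algebra of smooth complex functions on a subset of a manifold. -/
def smoothFun (U : Set M) : Subalgebra ℂ (U → ℂ) where
  carrier := {f | SmoothFunOn (Function.extend Subtype.val f 0) U}
  mul_mem' {f g} hf hg := (SmoothFunOn.mul hf hg).congr fun x hx => by
    lift x to U using hx
    simp
  add_mem' {f g} hf hg := (SmoothFunOn.add hf hg).congr fun x hx => by
    lift x to U using hx
    simp
  algebraMap_mem' c := (SmoothFunOn.const c U).congr fun x hx => by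
    lift x to U using hx
    simp

namespace smoothFun

variable {U : Set M}

/-- Extension of a function by zero. -/
def extend (f : smoothFun U) : M → ℂ := Function.extend Subtype.val (f : U → ℂ) 0

theorem smooth_extend (f : smoothFun U) : SmoothFunOn (extend f) U := f.2

theorem extend_apply (f : smoothFun U) (x : U) : extend f x = (f : U → ℂ) x :=
  Subtype.val_injective.extend_apply ..

/-- The restriction of a function that is smooth on `U`. -/
def restrict (u : M → ℂ) (hu : SmoothFunOn u U) : smoothFun U :=
  ⟨fun x => u x, hu.congr fun x hx => by
    lift x to U using hx
    exact Subtype.val_injective.extend_apply _ _ x⟩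

theorem extend_restrict {u : M → ℂ} (hu : SmoothFunOn u U) {x : M} (hx : x ∈ U) : extend (restrict u hu) x = u x :=
  extend_apply (restrict u hu) ⟨x, hx⟩

theorem restrict_extend (f : smoothFun U) : restrict (extend f) (smooth_extend f) = f :=
  Subtype.ext (funext fun x => extend_apply f x)

theorem restrict_eq_restrict {u v : M → ℂ} {hu : SmoothFunOn u U} {hv : SmoothFunOn v U} :
    restrict u hu = restrict v hv ↔ ∀ x ∈ U, u x = v x :=
  ⟨fun h x hx => congrFun (congrArg Subtype.val h) ⟨x, hx⟩,
    fun h => Subtype.ext (funext fun x => h x x.2)⟩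

theorem eq_of_extend_eq {f g : smoothFun U} (h : ∀ x ∈ U, extend f x = extend g x) : f = g := by
  rw [← restrict_extend f, ← restrict_extend g, restrict_eq_restrict]
  exact h

variable {f g : smoothFun U} {x : M} (hx : x ∈ U)
include hx

theorem extend_add : extend (f + g) x = extend f x + extend g x := by
  lift x to U using hx
  simp [extend_apply]

theorem extend_sub : extend (f - g) x = extend f x - extend g x := by
  lift x to U using hx
  simp [extend_apply]

theorem extend_neg : extend (-f) x = -extend f x := by
  lift x to U using hx
  simp [extend_apply]

theorem extend_mul : extend (f * g) x = extend f x * extend g x := by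
  lift x to U using hx
  simp [extend_apply]

theorem extend_pow (n : ℕ) : extend (f ^ n) x = extend f x ^ n := by
  lift x to U using hx
  simp [extend_apply]

theorem extend_one : extend (1 : smoothFun U) x = 1 := by
  lift x to U using hx
  simp [extend_apply]

theorem extend_zero : extend (0 : smoothFun U) x = 0 := by
  lift x to U using hx
  simp [extend_apply]

theorem extend_smul (c : ℂ) : extend (c • f) x = c * extend f x := by
  lift x to U using hx
  simp [extend_apply]

theorem extend_imUnit : extend (imUnit (smoothFun U)) x = Complex.I := by
  lift x to U using hx
  rw [extend_apply]
  rfl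

theorem extend_intCast (p : ℤ) : extend (p : smoothFun U) x = p := by
  lift x to U using hx
  rw [extend_apply]
  simp

end smoothFun

variable [IsManifold (𝓡 3) ∞ M]

open smoothFun in
/-- The derivation of the algebra of smooth functions given by a complex vector field. -/
def CField.derivation (V : CField M) {U : Set M} (hU : IsOpen U) (hV : V.SmoothOn U) :
    Derivation ℂ (smoothFun U) (smoothFun U) :=
  Derivation.mk'
    { toFun := fun f => restrict (V.act (extend f)) (hV.act hU (smooth_extend f))
      map_add' := fun f g => eq_of_extend_eq fun x hx => by
        rw [extend_add hx, extend_restrict _ hx, extend_restrict _ hx, extend_restrict _ hx,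
          ← V.act_add ((smooth_extend f).mdifferentiableAt hU hx) ((smooth_extend g).mdifferentiableAt hU hx)]
        exact act_congr_on V hU (fun y hy => extend_add hy) hx
      map_smul' := fun c f => eq_of_extend_eq fun x hx => by
        rw [RingHom.id_apply, extend_smul hx, extend_restrict _ hx, extend_restrict _ hx]
        have h := V.act_mul ((SmoothFunOn.const c U).mdifferentiableAt hU hx)
          ((smooth_extend f).mdifferentiableAt hU hx)
        rw [V.act_const, mul_zero, add_zero] at h
        rw [← h]
        exact act_congr_on V hU (fun y hy => extend_smul hy c) hx }
    (fun f g => eq_of_extend_eq fun x hx => by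
      have e : ∀ f, SmoothFunOn (V.act (extend f)) U := fun f => hV.act hU (smooth_extend f)
      change extend (restrict _ (e _)) x = extend (_ • restrict _ (e _) + _ • restrict _ (e _)) x
      rw [extend_add hx, smul_eq_mul, smul_eq_mul, extend_mul hx, extend_mul hx, extend_restrict _ hx,
        extend_restrict _ hx, extend_restrict _ hx, ← V.act_mul ((smooth_extend f).mdifferentiableAt hU hx)
        ((smooth_extend g).mdifferentiableAt hU hx)]
      exact act_congr_on V hU (fun y hy => extend_mul hy) hx)

theorem CField.derivation_restrict (V : CField M) {U : Set M} (hU : IsOpen U) (hV : V.SmoothOn U)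
    {u : M → ℂ} (hu : SmoothFunOn u U) : V.derivation hU hV (smoothFun.restrict u hu) =
      smoothFun.restrict (V.act u) (hV.act hU hu) :=
  (smoothFun.restrict_eq_restrict (hu := hV.act hU (smoothFun.smooth_extend _))).2 fun _ hx => act_congr_on V hU (fun _ hy => smoothFun.extend_restrict hu hy) hx

variable {S : CRStructure M}

namespace ContactForm

variable (θ : ContactForm S) (Z : S.Frame)

/-- The derivation given by the frame `Z`. -/
abbrev derZ : Derivation ℂ (smoothFun Z.U) (smoothFun Z.U) := Z.Z.derivation Z.isOpen Z.smooth

/-- The derivation given by `Z̄`. -/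
abbrev derZbar : Derivation ℂ (smoothFun Z.U) (smoothFun Z.U) :=
  Z.Z.conj.derivation Z.isOpen Z.smooth.conj

/-- The derivation given by the Reeb field. -/
abbrev derT : Derivation ℂ (smoothFun Z.U) (smoothFun Z.U) :=
  θ.reeb.derivation Z.isOpen (θ.smoothOn_reeb Z.U)

open smoothFun

/-- The commutators are the bracket relations. `jacobi_relation` then says that a combination of Z,
Z̄, T annihilates every function, and independence of the frame makes its coefficients vanish: these
are the formulas for T h, T b and T b̄. -/
theorem frameEquations [T2Space M] : FrameEquations (derZ Z) (derZbar Z) (θ.derT Z)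
    (restrict _ (θ.smoothFunOn_levi Z)) (restrict _ (θ.smoothFunOn_levi_inv Z))
    (restrict _ (θ.smoothFunOn_connZbar Z)) (restrict _ (θ.smoothFunOn_connZbar Z).conj)
    (restrict _ (θ.smoothFunOn_connT Z)) (restrict _ (θ.smoothFunOn_connT Z).conj)
    (restrict _ (θ.smoothFunOn_reebCoeff Z)) (restrict _ (θ.smoothFunOn_reebCoeff Z).conj) := by
  have cZ : ∀ u, derZ Z (derZbar Z u) = derZbar Z (derZ Z u) - restrict _ (θ.smoothFunOn_connZbar Z) * derZ Z u
      + restrict _ (θ.smoothFunOn_connZbar Z).conj * derZbar Z u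
      - imUnit _ * restrict _ (θ.smoothFunOn_levi Z) * θ.derT Z u := fun u => eq_of_extend_eq fun x hx => by
    rw [← restrict_extend u]
    simp only [CField.derivation_restrict, extend_add hx, extend_sub hx, extend_mul hx, extend_imUnit hx, extend_restrict _ hx]
    exact θ.act_Z_Zbar Z hx (smooth_extend u)
  have cT : ∀ u, θ.derT Z (derZ Z u) = derZ Z (θ.derT Z u) + restrict _ (θ.smoothFunOn_connT Z) * derZ Z u
      + restrict _ (θ.smoothFunOn_reebCoeff Z) * derZbar Z u := fun u => eq_of_extend_eq fun x hx => by
    rw [← restrict_extend u]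
    simp only [CField.derivation_restrict, extend_add hx, extend_mul hx, extend_restrict _ hx]
    exact θ.act_reeb_Z Z hx (smooth_extend u)
  have cTb : ∀ u, θ.derT Z (derZbar Z u) = derZbar Z (θ.derT Z u)
      + restrict _ (θ.smoothFunOn_connT Z).conj * derZbar Z u
      + restrict _ (θ.smoothFunOn_reebCoeff Z).conj * derZ Z u := fun u => eq_of_extend_eq fun x hx => by
    rw [← restrict_extend u]
    simp only [CField.derivation_restrict, extend_add hx, extend_mul hx, extend_restrict _ hx]
    exact θ.act_reeb_Zbar Z hx (smooth_extend u)
  have J := jacobi_relation cZ cT cTb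
  have ind : ∀ {α β γ : smoothFun Z.U}, (∀ u, α * derZ Z u + β * derZbar Z u + γ * θ.derT Z u = 0) →
      α = 0 ∧ β = 0 ∧ γ = 0 := by
    intro α β γ h
    have key : ∀ x ∈ Z.U, extend α x = 0 ∧ extend β x = 0 ∧ extend γ x = 0 := fun x hx => by
      refine θ.frame_independent Z hx fun s hs => ?_
      have := congrArg (fun f => extend f x) (h (restrict _ (SmoothFunOn.ofReal hs.contMDiffOn)))
      simpa only [CField.derivation_restrict, extend_add hx, extend_mul hx, extend_restrict _ hx, extend_zero hx] using this
    exact ⟨eq_of_extend_eq fun x hx => by rw [(key x hx).1, extend_zero hx],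
      eq_of_extend_eq fun x hx => by rw [(key x hx).2.1, extend_zero hx],
      eq_of_extend_eq fun x hx => by rw [(key x hx).2.2, extend_zero hx]⟩
  obtain ⟨j1, j2, j3⟩ := ind J
  refine ⟨?_, cZ, cT, cTb, ?_, sub_eq_zero.1 j1, sub_eq_zero.1 (neg_eq_zero.1 j2)⟩
  · refine eq_of_extend_eq fun x hx => ?_
    rw [extend_mul hx, extend_restrict _ hx, extend_restrict _ hx, extend_one hx, mul_inv_cancel₀ (θ.levi_ne_zero Z hx)]
  · linear_combination (-imUnit (smoothFun Z.U)) * j3 + (θ.derT Z (restrict _ (θ.smoothFunOn_levi Z)) -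
      restrict _ (θ.smoothFunOn_levi Z) * (restrict _ (θ.smoothFunOn_connT Z) + restrict _ (θ.smoothFunOn_connT Z).conj)) *
        imUnit_sq (B := smoothFun Z.U)

theorem restrict_connZ : restrict _ (θ.smoothFunOn_connZ Z) = restrict _ (θ.smoothFunOn_levi_inv Z) *
    derZ Z (restrict _ (θ.smoothFunOn_levi Z)) - restrict _ (θ.smoothFunOn_connZbar Z).conj :=
  eq_of_extend_eq fun x hx => by
    simp only [CField.derivation_restrict, extend_sub hx, extend_mul hx, extend_restrict _ hx, connZ]

theorem restrict_scalarCurv : restrict _ (θ.smoothFunOn_scalarCurv Z) = restrict _ (θ.smoothFunOn_levi_inv Z) *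
    (derZ Z (restrict _ (θ.smoothFunOn_connZbar Z)) - derZbar Z (restrict _ (θ.smoothFunOn_connZ Z))
      + restrict _ (θ.smoothFunOn_connZ Z) * restrict _ (θ.smoothFunOn_connZbar Z)
      - restrict _ (θ.smoothFunOn_connZbar Z).conj * restrict _ (θ.smoothFunOn_connZbar Z)
      + imUnit _ * restrict _ (θ.smoothFunOn_levi Z) * restrict _ (θ.smoothFunOn_connT Z)) :=
  eq_of_extend_eq fun x hx => by
    simp only [CField.derivation_restrict, extend_add hx, extend_sub hx, extend_mul hx, extend_restrict _ hx, extend_imUnit hx]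
    exact θ.scalarCurv_eq Z hx

theorem act_Zbar_conj {u : M → ℂ} (hu : SmoothFunOn u Z.U) {x : M} (hx : x ∈ Z.U) :
    Z.Z.conj.act (fun y => starRingEnd ℂ (u y)) x = starRingEnd ℂ (Z.Z.act u x) :=
  CField.act_conj _ (hu.mdifferentiableAt Z.isOpen hx)

theorem act_Z_conj {u : M → ℂ} (hu : SmoothFunOn u Z.U) {x : M} (hx : x ∈ Z.U) :
    Z.Z.act (fun y => starRingEnd ℂ (u y)) x = starRingEnd ℂ (Z.Z.conj.act u x) := by
  have := CField.act_conj Z.Z.conj (hu.mdifferentiableAt Z.isOpen hx)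
  rwa [CField.conj_conj] at this

theorem act_Zbar_levi {x : M} (hx : x ∈ Z.U) :
    Z.Z.conj.act (θ.levi Z) x = starRingEnd ℂ (Z.Z.act (θ.levi Z) x) := by
  rw [← act_Zbar_conj Z (θ.smoothFunOn_levi Z) hx]
  exact act_congr_on _ Z.isOpen (fun y hy => (θ.conj_levi Z hy).symm) hx

/-- `curvature_conj` rewrites R in terms of the conjugate connection coefficients, and that
expression is the conjugate of `scalarCurv_eq`. -/
theorem conj_scalarCurv [T2Space M] {x : M} (hx : x ∈ Z.U) :
    starRingEnd ℂ (θ.scalarCurv Z x) = θ.scalarCurv Z x := by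
  have h := (θ.frameEquations Z).curvature_conj (θ.restrict_connZ Z)
    (ab := restrict _ (θ.smoothFunOn_connZ Z).conj) (eq_of_extend_eq fun y hy => by
      simp only [CField.derivation_restrict, extend_sub hy, extend_mul hy, extend_restrict _ hy, connZ, map_sub, map_mul,
        map_inv₀, θ.conj_levi Z hy, Complex.conj_conj, θ.act_Zbar_levi Z hy])
  rw [← θ.restrict_scalarCurv Z] at h
  have h2 := congrArg (fun f => extend f x) h
  simp only [CField.derivation_restrict, extend_add hx, extend_sub hx, extend_mul hx, extend_restrict _ hx, extend_imUnit hx,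
    act_Zbar_conj Z (θ.smoothFunOn_connZbar Z) hx] at h2
  rw [act_Z_conj Z (θ.smoothFunOn_connZ Z) hx] at h2
  conv_rhs => rw [θ.scalarCurv_eq Z hx]
  rw [h2]
  simp only [map_add, map_sub, map_mul, map_inv₀, θ.conj_levi Z hx, Complex.conj_conj, Complex.conj_I]
  ring

end ContactForm

end CRGeometry
end

/-! ### Part: geometric tensors as monomials, and the operators in this model. -/

open scoped Manifold ContDiff
noncomputable section
namespace CRGeometry

open VectorField Topology LaurentPolynomial smoothFun

variable {M : Type*} [TopologicalSpace M] [ChartedSpace E3 M] [IsManifold (𝓡 3) ∞ M]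
  {S : CRStructure M}

/-- The monomial of degree `p` whose coefficient is a given smooth function: a tensor with `p`
lower minus upper indices. -/
def tens {U : Set M} (p : ℤ) (u : M → ℂ) (hu : SmoothFunOn u U) : (smoothFun U)[T;T⁻¹] :=
  AddMonoidAlgebra.single p (restrict u hu)

section tens

variable {U : Set M} {u v : M → ℂ} (hu : SmoothFunOn u U) (hv : SmoothFunOn v U) (p q : ℤ)

theorem tens_inj : tens p u hu = tens p v hv ↔ ∀ x ∈ U, u x = v x := by
  rw [tens, tens, AddMonoidAlgebra.single_inj, restrict_eq_restrict]
  refine ⟨?_, fun h => Or.inl ⟨rfl, h⟩⟩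
  rintro (h | ⟨h, h'⟩)
  · exact h.2
  · exact restrict_eq_restrict.1 (h.trans h'.symm)

/-- A smoothness proof is an argument of `tens`. The existential lets the function produced by
simplification be renamed as a known operator without writing out that proof. -/
theorem exists_tens_eq (h : u = v) : ∃ hv, tens p u hu = tens p v hv := by
  subst h
  exact ⟨hu, rfl⟩

theorem tens_add : tens p u hu + tens p v hv = tens p (fun x => u x + v x) (hu.add hv) := by
  rw [tens, tens, ← AddMonoidAlgebra.single_add]; rfl

theorem tens_sub : tens p u hu - tens p v hv = tens p (fun x => u x - v x) (hu.sub hv) := by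
  rw [tens, tens, ← AddMonoidAlgebra.single_sub]; rfl

theorem tens_neg : -tens p u hu = tens p (fun x => -u x) hu.neg := by
  rw [tens, ← AddMonoidAlgebra.single_neg]; rfl

theorem tens_mul : tens p u hu * tens q v hv = tens (p + q) (fun x => u x * v x) (hu.mul hv) := by
  rw [tens, tens, AddMonoidAlgebra.single_mul_single]; rfl

theorem imUnit_mul_tens : imUnit _ * tens p u hu =
    tens p (fun x => Complex.I * u x) ((SmoothFunOn.const _ _).mul hu) := by
  rw [tens, imUnit_mul_single]; rfl

theorem ofNat_mul_tens (n : ℕ) [n.AtLeastTwo] : (ofNat(n) : (smoothFun U)[T;T⁻¹]) * tens p u hu =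
    tens p (fun x => ofNat(n) * u x) ((SmoothFunOn.const _ _).mul hu) := by
  have : (ofNat(n) : (smoothFun U)[T;T⁻¹]) = tens 0 (fun _ => ofNat(n)) (SmoothFunOn.const _ _) := by
    rw [← map_ofNat (C : smoothFun U →+* _) n]; rfl
  rw [this, tens_mul, zero_add]

end tens

namespace ContactForm

variable (θ : ContactForm S) (Z : S.Frame)

/-- The derivation `∇₁` on tensors of all degrees. -/
def dDown : Derivation ℂ (smoothFun Z.U)[T;T⁻¹] (smoothFun Z.U)[T;T⁻¹] :=
  laurentLift (derZ Z) (-restrict _ (θ.smoothFunOn_connZ Z)) 1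

/-- The derivation `∇¹` on tensors of all degrees. -/
def dUp : Derivation ℂ (smoothFun Z.U)[T;T⁻¹] (smoothFun Z.U)[T;T⁻¹] :=
  laurentLift (restrict _ (θ.smoothFunOn_levi_inv Z) • derZbar Z)
    (-(restrict _ (θ.smoothFunOn_levi_inv Z) * restrict _ (θ.smoothFunOn_connZbar Z))) (-1)

/-- The derivation `∇₀` on tensors of all degrees. -/
def dReeb : Derivation ℂ (smoothFun Z.U)[T;T⁻¹] (smoothFun Z.U)[T;T⁻¹] :=
  laurentLift (θ.derT Z) (-restrict _ (θ.smoothFunOn_connT Z)) 0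

/-- The derivation multiplying tensors by their degree. -/
def dDegree : Derivation ℂ (smoothFun Z.U)[T;T⁻¹] (smoothFun Z.U)[T;T⁻¹] :=
  laurentLift 0 1 0

/-- The torsion with raised indices, `A^{1 1}`. -/
def torsionUp (x : M) : ℂ := (θ.levi Z x)⁻¹ ^ 2 * starRingEnd ℂ (θ.torsion Z x)

theorem smoothFunOn_torsionUp : SmoothFunOn (θ.torsionUp Z) Z.U := by
  have h := θ.smoothFunOn_levi_inv Z
  exact SmoothFunOn.mul (ContMDiffOn.congr (h.mul h) fun x _ => pow_two _) (θ.smoothFunOn_torsion Z).conj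

variable {u : M → ℂ} (hu : SmoothFunOn u Z.U) (p : ℤ)

theorem dDown_tens : θ.dDown Z (tens p u hu) =
    tens (p + 1) (θ.nablaDown Z p u) (θ.smoothFunOn_nablaDown Z hu p) := by
  rw [dDown, tens, laurentLift_single, tens]
  congr 1
  refine eq_of_extend_eq fun x hx => ?_
  simp only [CField.derivation_restrict, extend_add hx, extend_mul hx, extend_neg hx,
    extend_restrict _ hx, extend_intCast hx, nablaDown, θ.conn_app_Z Z hx]
  ring

theorem dUp_tens : θ.dUp Z (tens p u hu) =
    tens (p + -1) (θ.nablaUp Z p u) (θ.smoothFunOn_nablaUp Z hu p) := by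
  rw [dUp, tens, laurentLift_single, tens]
  congr 1
  refine eq_of_extend_eq fun x hx => ?_
  simp only [Derivation.smul_apply, smul_eq_mul, CField.derivation_restrict, extend_add hx,
    extend_mul hx, extend_neg hx, extend_restrict _ hx, extend_intCast hx, nablaUp,
    θ.conn_app_Zbar Z hx]
  ring

theorem dReeb_tens_zero : θ.dReeb Z (tens 0 u hu) =
    tens 0 (θ.reeb.act u) ((θ.smoothOn_reeb _).act Z.isOpen hu) := by
  rw [dReeb, tens, laurentLift_single, tens]
  congr 1
  rw [Int.cast_zero, zero_mul, zero_mul, add_zero, CField.derivation_restrict]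

theorem dDegree_tens : dDegree Z (tens p u hu) =
    tens p (fun x => p * u x) ((SmoothFunOn.const _ _).mul hu) := by
  rw [dDegree, tens, laurentLift_single, tens, add_zero]
  congr 1
  refine eq_of_extend_eq fun x hx => ?_
  simp only [Derivation.zero_apply, zero_add, mul_one, extend_mul hx, extend_intCast hx,
    extend_restrict _ hx]

theorem dDegree_tens_zero : dDegree Z (tens 0 u hu) = 0 := by
  rw [dDegree, tens, laurentLift_single]
  simp

/-- The abstract torsion coefficients become geometric: A₁₁ = −h e and A^{11} = −h⁻¹ ē, where e is
the Z̄-coefficient of [T, Z]. -/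
theorem websterCalculus [T2Space M] : WebsterCalculus (θ.dDown Z) (θ.dUp Z) (θ.dReeb Z) (dDegree Z)
    (tens 0 _ (θ.smoothFunOn_scalarCurv Z)) (tens 2 _ (θ.smoothFunOn_torsion Z))
    (tens (-2) _ (θ.smoothFunOn_torsionUp Z)) := by
  have h := (θ.frameEquations Z).websterCalculus (θ.restrict_connZ Z) (θ.restrict_scalarCurv Z)
  have e1 : -(restrict _ (θ.smoothFunOn_levi Z) * restrict _ (θ.smoothFunOn_reebCoeff Z)) =
      restrict _ (θ.smoothFunOn_torsion Z) := eq_of_extend_eq fun x hx => by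
    simp only [extend_mul hx, extend_neg hx, extend_restrict _ hx, θ.torsion_eq]
  have e2 : -(restrict _ (θ.smoothFunOn_levi_inv Z) * restrict _ (θ.smoothFunOn_reebCoeff Z).conj) =
      restrict _ (θ.smoothFunOn_torsionUp Z) := eq_of_extend_eq fun x hx => by
    have := θ.levi_ne_zero Z hx
    simp only [extend_mul hx, extend_neg hx, extend_restrict _ hx, θ.torsion_eq, torsionUp, map_neg,
      map_mul, θ.conj_levi Z hx]
    field_simp
  rw [e1, e2] at h
  exact h

theorem lap_tens : WebsterCalculus.lap (θ.dDown Z) (θ.dUp Z) (tens 0 u hu) =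
    tens 0 (θ.sublaplacian Z u) (θ.smoothFunOn_sublaplacian Z hu) := by
  simp only [WebsterCalculus.lap, dDown_tens, dUp_tens, zero_add, Int.reduceAdd, Int.reduceNeg, tens_add,
    tens_neg]
  rfl

/-- `P_α u` for complex functions. -/
def thirdC (u : M → ℂ) (x : M) : ℂ :=
  θ.nablaDown Z 0 (θ.nablaDown Z (-1) (θ.nablaUp Z 0 u)) x
    + Complex.I * (θ.torsion Z x * θ.nablaUp Z 0 u x)

/-- The conjugate of `P_α u`, for real `u`. -/
def thirdConj (u : M → ℂ) (x : M) : ℂ :=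
  θ.nablaUp Z 0 (θ.nablaUp Z 1 (θ.nablaDown Z 0 u)) x
    - Complex.I * (θ.torsionUp Z x * θ.nablaDown Z 0 u x)

/-- The CR Paneitz operator for complex functions. -/
def paneitzC (u : M → ℂ) (x : M) : ℂ :=
  θ.sublaplacian Z (θ.sublaplacian Z u) x + θ.reeb.act (θ.reeb.act u) x
    + 2 * (Complex.I * (θ.nablaUp Z 1 (fun y => θ.torsion Z y * θ.nablaUp Z 0 u y) x
      - θ.nablaDown Z (-1) (fun y => θ.torsionUp Z y * θ.nablaDown Z 0 u y) x))

/-- Three times the `P'`-operator for complex functions. -/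
def primeC (u : M → ℂ) (x : M) : ℂ :=
  12 * θ.sublaplacian Z (θ.sublaplacian Z u) x
    + 12 * (Complex.I * (θ.nablaUp Z 1 (fun y => θ.torsion Z y * θ.nablaUp Z 0 u y) x
      - θ.nablaDown Z (-1) (fun y => θ.torsionUp Z y * θ.nablaDown Z 0 u y) x))
    - 6 * (θ.nablaUp Z 1 (fun y => θ.scalarCurv Z y * θ.nablaDown Z 0 u y) x
      + θ.nablaDown Z (-1) (fun y => θ.scalarCurv Z y * θ.nablaUp Z 0 u y) x)
    + 4 * ((θ.nablaDown Z 0 (θ.scalarCurv Z) x - Complex.I * θ.nablaUp Z 2 (θ.torsion Z) x)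
          * θ.nablaUp Z 0 u x
        + (θ.nablaUp Z 0 (θ.scalarCurv Z) x + Complex.I * θ.nablaDown Z (-2) (θ.torsionUp Z) x)
          * θ.nablaDown Z 0 u x)
    + 2 * ((θ.sublaplacian Z (θ.scalarCurv Z) x
        + Complex.I * (θ.nablaUp Z 1 (θ.nablaUp Z 2 (θ.torsion Z)) x
          - θ.nablaDown Z (-1) (θ.nablaDown Z (-2) (θ.torsionUp Z)) x)) * u x)

theorem third_tens : ∃ h, WebsterCalculus.third (θ.dDown Z) (θ.dUp Z)
    (tens 2 _ (θ.smoothFunOn_torsion Z)) (tens 0 u hu) = tens 1 (θ.thirdC Z u) h := by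
  simp only [WebsterCalculus.third, dDown_tens, dUp_tens, zero_add, Int.reduceAdd, Int.reduceNeg,
    tens_add, tens_mul, imUnit_mul_tens]
  exact exists_tens_eq _ _ rfl

theorem thirdConj_tens : ∃ h, θ.dUp Z (θ.dUp Z (θ.dDown Z (tens 0 u hu)))
    - imUnit _ * (tens (-2) _ (θ.smoothFunOn_torsionUp Z) * θ.dDown Z (tens 0 u hu)) =
      tens (-1) (θ.thirdConj Z u) h := by
  simp only [dDown_tens, dUp_tens, zero_add, Int.reduceAdd, Int.reduceNeg,
    tens_sub, tens_mul, imUnit_mul_tens]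
  exact exists_tens_eq _ _ rfl

theorem paneitz_tens : ∃ h, WebsterCalculus.paneitz (θ.dDown Z) (θ.dUp Z) (θ.dReeb Z)
    (tens 2 _ (θ.smoothFunOn_torsion Z)) (tens (-2) _ (θ.smoothFunOn_torsionUp Z)) (tens 0 u hu) =
      tens 0 (θ.paneitzC Z u) h := by
  simp only [WebsterCalculus.paneitz, lap_tens, dReeb_tens_zero, dDown_tens, dUp_tens, zero_add,
    Int.reduceAdd, Int.reduceNeg, tens_add, tens_sub, tens_mul, imUnit_mul_tens, ofNat_mul_tens, mul_assoc]
  exact exists_tens_eq _ _ rfl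

theorem prime_tens : ∃ h, WebsterCalculus.prime (θ.dDown Z) (θ.dUp Z)
    (tens 0 _ (θ.smoothFunOn_scalarCurv Z))
    (tens 2 _ (θ.smoothFunOn_torsion Z)) (tens (-2) _ (θ.smoothFunOn_torsionUp Z)) (tens 0 u hu) =
      tens 0 (θ.primeC Z u) h := by
  simp only [WebsterCalculus.prime, lap_tens, dDown_tens, dUp_tens, zero_add, Int.reduceAdd,
    Int.reduceNeg, tens_add, tens_sub, tens_mul, imUnit_mul_tens, ofNat_mul_tens, mul_assoc (12 : (smoothFun Z.U)[T;T⁻¹])]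
  exact exists_tens_eq _ _ rfl

/-! ### Part: conjugation exchanges ∇₁ and ∇¹. -/

section conj

variable {x : M}

theorem nablaDown_congr {v : M → ℂ} (h : ∀ y ∈ Z.U, u y = v y) (hx : x ∈ Z.U) :
    θ.nablaDown Z p u x = θ.nablaDown Z p v x := by
  rw [nablaDown, nablaDown, act_congr_on _ Z.isOpen h hx, h x hx]

theorem nablaUp_congr {v : M → ℂ} (h : ∀ y ∈ Z.U, u y = v y) (hx : x ∈ Z.U) :
    θ.nablaUp Z p u x = θ.nablaUp Z p v x := by
  rw [nablaUp, nablaUp, act_congr_on _ Z.isOpen h hx, h x hx]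

theorem sublaplacian_congr {v : M → ℂ} (h : ∀ y ∈ Z.U, u y = v y) (hx : x ∈ Z.U) :
    θ.sublaplacian Z u x = θ.sublaplacian Z v x := by
  rw [sublaplacian, sublaplacian, θ.nablaUp_congr Z 1 (fun y hy => θ.nablaDown_congr Z 0 h hy) hx,
    θ.nablaDown_congr Z (-1) (fun y hy => θ.nablaUp_congr Z 0 h hy) hx]

/-- Derivatives of powers of the inverse of the Levi form. -/
theorem derivation_levi_inv_pow (D : Derivation ℂ (smoothFun Z.U) (smoothFun Z.U)) (n : ℕ) :
    D (restrict _ (θ.smoothFunOn_levi_inv Z) ^ n) = -(n * restrict _ (θ.smoothFunOn_levi_inv Z) ^ (n + 1) *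
      D (restrict _ (θ.smoothFunOn_levi Z))) := by
  have hh : restrict _ (θ.smoothFunOn_levi Z) * restrict _ (θ.smoothFunOn_levi_inv Z) = 1 :=
    eq_of_extend_eq fun x hx => by
      rw [extend_mul hx, extend_restrict _ hx, extend_restrict _ hx, extend_one hx,
        mul_inv_cancel₀ (θ.levi_ne_zero Z hx)]
  have h1 := congrArg D hh
  rw [D.leibniz, D.map_one_eq_zero, smul_eq_mul, smul_eq_mul] at h1
  have h2 : D (restrict _ (θ.smoothFunOn_levi_inv Z)) =
      -(restrict _ (θ.smoothFunOn_levi_inv Z) ^ 2 * D (restrict _ (θ.smoothFunOn_levi Z))) := by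
    linear_combination restrict _ (θ.smoothFunOn_levi_inv Z) * h1
      - D (restrict _ (θ.smoothFunOn_levi_inv Z)) * hh
  induction n with
  | zero => simp
  | succ n ih =>
    rw [pow_succ, D.leibniz, ih, h2, smul_eq_mul, smul_eq_mul]
    push_cast
    ring

-- Conjugation turns n lower unbarred indices into barred ones; raising them with h⁻ⁿ gives a tensor
-- of degree −n. The functions h⁻ⁿ ū below are of this form.
include hu in
theorem smoothFunOn_levi_inv_pow_conj (n : ℕ) :
    SmoothFunOn (fun y => (θ.levi Z y)⁻¹ ^ n * starRingEnd ℂ (u y)) Z.U :=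
  SmoothFunOn.mul (ContMDiffOn.congr (smooth_extend (restrict _ (θ.smoothFunOn_levi_inv Z) ^ n))
    fun x hx => by rw [extend_pow hx, extend_restrict _ hx]) hu.conj

include hu in
theorem act_levi_inv_pow_conj {V : CField M} (hV : V.SmoothOn Z.U) (hx : x ∈ Z.U) (n : ℕ) :
    V.act (fun y => (θ.levi Z y)⁻¹ ^ n * starRingEnd ℂ (u y)) x =
      (θ.levi Z x)⁻¹ ^ n * V.act (fun y => starRingEnd ℂ (u y)) x
        - n * (θ.levi Z x)⁻¹ ^ (n + 1) * V.act (θ.levi Z) x * starRingEnd ℂ (u x) := by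
  have e : restrict _ (θ.smoothFunOn_levi_inv_pow_conj Z hu n) =
      restrict _ (θ.smoothFunOn_levi_inv Z) ^ n * restrict _ hu.conj := eq_of_extend_eq fun y hy => by
    rw [extend_mul hy, extend_pow hy, extend_restrict _ hy, extend_restrict _ hy, extend_restrict _ hy]
  have h := congrArg (fun f => extend (V.derivation Z.isOpen hV f) x) e
  simp only [Derivation.leibniz, derivation_levi_inv_pow, CField.derivation_restrict, smul_eq_mul,
    extend_add hx, extend_mul hx, extend_neg hx, extend_pow hx, extend_restrict _ hx] at h
  have e3 : extend (n : smoothFun Z.U) x = n := by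
    have := extend_intCast (U := Z.U) hx (n : ℤ)
    simpa using this
  rw [h, e3]
  ring

include hu in
/-- Conjugation exchanges `∇¹` and `∇₁`. -/
theorem nablaDown_conj (hx : x ∈ Z.U) (n : ℕ) :
    θ.nablaDown Z (-n) (fun y => (θ.levi Z y)⁻¹ ^ n * starRingEnd ℂ (u y)) x =
      (θ.levi Z x)⁻¹ ^ n * θ.levi Z x * starRingEnd ℂ (θ.nablaUp Z n u x) := by
  have h0 := θ.levi_ne_zero Z hx
  rw [nablaDown, nablaUp, θ.act_levi_inv_pow_conj Z hu Z.smooth hx, act_Z_conj Z hu hx,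
    θ.conn_app_Z Z hx, θ.conn_app_Zbar Z hx, connZ]
  simp only [map_mul, map_sub, map_inv₀, θ.conj_levi Z hx, map_intCast]
  push_cast
  linear_combination (-((θ.levi Z x)⁻¹ ^ n * (starRingEnd ℂ (Z.Z.conj.act u x)
    - n * starRingEnd ℂ (θ.connZbar Z x) * starRingEnd ℂ (u x)))) * mul_inv_cancel₀ h0

include hu in
/-- Conjugation exchanges `∇₁` and `∇¹`. -/
theorem nablaUp_conj (hx : x ∈ Z.U) (n : ℕ) :
    θ.nablaUp Z (-n) (fun y => (θ.levi Z y)⁻¹ ^ n * starRingEnd ℂ (u y)) x =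
      (θ.levi Z x)⁻¹ ^ (n + 1) * starRingEnd ℂ (θ.nablaDown Z n u x) := by
  rw [nablaDown, nablaUp, θ.act_levi_inv_pow_conj Z hu Z.smooth.conj hx, act_Zbar_conj Z hu hx,
    θ.conn_app_Z Z hx, θ.conn_app_Zbar Z hx, connZ, θ.act_Zbar_levi Z hx]
  simp only [map_mul, map_sub, map_inv₀, θ.conj_levi Z hx, map_intCast, Complex.conj_conj]
  push_cast
  ring

include hu

theorem conj_nablaUp_zero (hx : x ∈ Z.U) : starRingEnd ℂ (θ.nablaUp Z 0 u x) =
    (θ.levi Z x)⁻¹ * θ.nablaDown Z 0 (fun y => starRingEnd ℂ (u y)) x := by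
  have h := θ.nablaDown_conj Z hu hx 0
  have h0 := θ.levi_ne_zero Z hx
  simp only [Nat.cast_zero, neg_zero, pow_zero, one_mul] at h
  rw [h]
  field_simp

theorem conj_nablaDown_zero (hx : x ∈ Z.U) : starRingEnd ℂ (θ.nablaDown Z 0 u x) =
    θ.levi Z x * θ.nablaUp Z 0 (fun y => starRingEnd ℂ (u y)) x := by
  have h := θ.nablaUp_conj Z hu hx 0
  have h0 := θ.levi_ne_zero Z hx
  simp only [Nat.cast_zero, neg_zero, pow_zero, one_mul] at h
  rw [h, zero_add, pow_one, mul_inv_cancel_left₀ h0]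

theorem conj_nablaUp_one (hx : x ∈ Z.U) : starRingEnd ℂ (θ.nablaUp Z 1 u x) =
    θ.nablaDown Z (-1) (fun y => (θ.levi Z y)⁻¹ * starRingEnd ℂ (u y)) x := by
  have h := θ.nablaDown_conj Z hu hx 1
  have h0 := θ.levi_ne_zero Z hx
  simp only [Nat.cast_one, pow_one, inv_mul_cancel₀ h0, one_mul] at h
  exact h.symm

theorem conj_nablaUp_two (hx : x ∈ Z.U) : starRingEnd ℂ (θ.nablaUp Z 2 u x) =
    θ.levi Z x * θ.nablaDown Z (-2) (fun y => (θ.levi Z y)⁻¹ ^ 2 * starRingEnd ℂ (u y)) x := by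
  have h := θ.nablaDown_conj Z hu hx 2
  have h0 := θ.levi_ne_zero Z hx
  simp only [Nat.cast_ofNat] at h
  rw [h]
  field_simp

omit hu
variable {f : M → ℝ} (hf : ContMDiffOn (𝓡 3) 𝓘(ℝ, ℝ) ∞ f Z.U)
include hf

theorem conj_nablaUp_nablaDown (hx : x ∈ Z.U) :
    starRingEnd ℂ (θ.nablaUp Z 1 (θ.nablaDown Z 0 fun y => (f y : ℂ)) x) =
      θ.nablaDown Z (-1) (θ.nablaUp Z 0 fun y => (f y : ℂ)) x := by
  have hF : SmoothFunOn (fun y => (f y : ℂ)) Z.U := SmoothFunOn.ofReal hf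
  rw [θ.conj_nablaUp_one Z (θ.smoothFunOn_nablaDown Z hF 0) hx]
  refine θ.nablaDown_congr Z (-1) (fun y hy => ?_) hx
  have h0 := θ.levi_ne_zero Z hy
  simp only [θ.conj_nablaDown_zero Z hF hy, Complex.conj_ofReal]
  field_simp

/-- The two second order terms of Δ_b f are conjugate to each other when f is real. -/
theorem ofReal_re_sublaplacian (hx : x ∈ Z.U) :
    (((θ.sublaplacian Z (fun y => (f y : ℂ)) x).re : ℝ) : ℂ) = θ.sublaplacian Z (fun y => (f y : ℂ)) x := by
  rw [← Complex.conj_eq_iff_re]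
  have h := θ.conj_nablaUp_nablaDown Z hf hx
  rw [sublaplacian, map_neg, map_add, ← h, Complex.conj_conj, add_comm]

end conj

end ContactForm

end CRGeometry
end

/-! ### Part: the real operators coincide with their complexified forms. -/

open scoped Manifold ContDiff
noncomputable section
namespace CRGeometry

open Topology LaurentPolynomial smoothFun

variable {M : Type*} [TopologicalSpace M] [ChartedSpace E3 M] [IsManifold (𝓡 3) ∞ M]
  {S : CRStructure M}

theorem sub_div_two_mul_I (z w : ℂ) : (z - w) / (2 * Complex.I) = -Complex.I * (z - w) / 2 := by
  rw [mul_comm 2, ← div_div, div_eq_mul_inv _ Complex.I, Complex.inv_I]; ring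

namespace ContactForm

variable (θ : ContactForm S) (Z : S.Frame) {x : M} (hx : x ∈ Z.U)

theorem ofReal_re_scalarCurv [T2Space M] {y : M} (hy : y ∈ Z.U) :
    (((θ.scalarCurv Z y).re : ℝ) : ℂ) = θ.scalarCurv Z y :=
  Complex.conj_eq_iff_re.1 (θ.conj_scalarCurv Z hy)

variable {f : M → ℝ} (hf : ContMDiffOn (𝓡 3) 𝓘(ℝ, ℝ) ∞ f Z.U)

include hx in
theorem ofReal_re_sublaplacian_scalarCurv [T2Space M] :
    (((θ.sublaplacian Z (θ.scalarCurv Z) x).re : ℝ) : ℂ) = θ.sublaplacian Z (θ.scalarCurv Z) x := by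
  rw [θ.sublaplacian_congr Z (fun y hy => (θ.ofReal_re_scalarCurv Z hy).symm) hx,
    θ.ofReal_re_sublaplacian Z (θ.smoothFunOn_scalarCurv Z).re hx]

include hf hx

theorem ofReal_re_sublaplacian_sublaplacian :
    (((θ.sublaplacian Z (θ.sublaplacian Z (fun y => (f y : ℂ))) x).re : ℝ) : ℂ) =
      θ.sublaplacian Z (θ.sublaplacian Z (fun y => (f y : ℂ))) x := by
  have h := θ.smoothFunOn_sublaplacian Z (SmoothFunOn.ofReal hf)
  rw [θ.sublaplacian_congr Z (fun y hy => (θ.ofReal_re_sublaplacian Z hf hy).symm) hx,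
    θ.ofReal_re_sublaplacian Z h.re hx]

theorem ofReal_re_act_reeb :
    (((θ.reeb.act (fun y => (f y : ℂ)) x).re : ℝ) : ℂ) = θ.reeb.act (fun y => (f y : ℂ)) x := by
  rw [← Complex.conj_eq_iff_re, ← CField.act_conj _ ((SmoothFunOn.ofReal hf).mdifferentiableAt Z.isOpen hx),
    reeb_conj]
  simp only [Complex.conj_ofReal]

theorem ofReal_re_act_reeb_act_reeb :
    (((θ.reeb.act (θ.reeb.act (fun y => (f y : ℂ))) x).re : ℝ) : ℂ) =
      θ.reeb.act (θ.reeb.act (fun y => (f y : ℂ))) x := by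
  have h := (θ.smoothOn_reeb Z.U).act Z.isOpen (SmoothFunOn.ofReal hf)
  rw [act_congr_on _ Z.isOpen (fun y hy => (θ.ofReal_re_act_reeb Z hy hf).symm) hx,
    θ.ofReal_re_act_reeb Z hx h.re]

theorem conj_nablaUp_ofReal : starRingEnd ℂ (θ.nablaUp Z 0 (fun y => (f y : ℂ)) x) =
    (θ.levi Z x)⁻¹ * θ.nablaDown Z 0 (fun y => (f y : ℂ)) x := by
  rw [θ.conj_nablaUp_zero Z (SmoothFunOn.ofReal hf) hx]
  simp only [Complex.conj_ofReal]

theorem conj_nablaDown_ofReal : starRingEnd ℂ (θ.nablaDown Z 0 (fun y => (f y : ℂ)) x) =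
    θ.levi Z x * θ.nablaUp Z 0 (fun y => (f y : ℂ)) x := by
  rw [θ.conj_nablaDown_zero Z (SmoothFunOn.ofReal hf) hx]
  simp only [Complex.conj_ofReal]

theorem conj_divTorsionGrad : starRingEnd ℂ (θ.divTorsionGrad Z (fun y => (f y : ℂ)) x) =
    θ.nablaDown Z (-1) (fun y => θ.torsionUp Z y * θ.nablaDown Z 0 (fun y => (f y : ℂ)) y) x := by
  have hF := SmoothFunOn.ofReal hf
  rw [divTorsionGrad, θ.conj_nablaUp_one Z ((θ.smoothFunOn_torsion Z).mul
    (θ.smoothFunOn_nablaUp Z hF 0)) hx]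
  refine θ.nablaDown_congr Z _ (fun y hy => ?_) hx
  rw [map_mul, θ.conj_nablaUp_ofReal Z hy hf, torsionUp]
  ring

/-- The Laplacian and Reeb terms are already real, and the imaginary part is written as −i(z − z̄)/2
with z̄ given by the lowered and raised counterparts. The complexified operator is free of Re and
Im, so the algebraic identities apply to it. -/
theorem ofReal_paneitz : (θ.paneitz Z f x : ℂ) = θ.paneitzC Z (fun y => (f y : ℂ)) x := by
  rw [paneitz]
  push_cast
  rw [θ.ofReal_re_sublaplacian_sublaplacian Z hx hf, θ.ofReal_re_act_reeb_act_reeb Z hx hf,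
    Complex.im_eq_sub_conj, θ.conj_divTorsionGrad Z hx hf, paneitzC, divTorsionGrad]
  rw [sub_div_two_mul_I]
  ring

/-- The factor 3 clears the denominators in 8/3 and 2/3. Each Re and Im is replaced by a half sum or
difference with the conjugate, where the reality of R is needed. -/
theorem ofReal_paneitzPrime [T2Space M] :
    ((3 * θ.paneitzPrime Z f x : ℝ) : ℂ) = θ.primeC Z (fun y => (f y : ℂ)) x := by
  have hF := SmoothFunOn.ofReal hf
  have hA := θ.smoothFunOn_torsion Z
  have hR := θ.smoothFunOn_scalarCurv Z
  have h0 := θ.levi_ne_zero Z hx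
  have e1 : starRingEnd ℂ (θ.nablaUp Z 1
      (fun y => θ.scalarCurv Z y * θ.nablaDown Z 0 (fun y => (f y : ℂ)) y) x) =
      θ.nablaDown Z (-1) (fun y => θ.scalarCurv Z y * θ.nablaUp Z 0 (fun y => (f y : ℂ)) y) x := by
    rw [θ.conj_nablaUp_one Z (hR.mul (θ.smoothFunOn_nablaDown Z hF 0)) hx]
    refine θ.nablaDown_congr Z _ (fun y hy => ?_) hx
    have := θ.levi_ne_zero Z hy
    rw [map_mul, θ.conj_nablaDown_ofReal Z hy hf, θ.conj_scalarCurv Z hy]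
    field_simp
  have e2 : ∀ y ∈ Z.U, starRingEnd ℂ (θ.nablaUp Z 2 (θ.torsion Z) y) =
      θ.levi Z y * θ.nablaDown Z (-2) (θ.torsionUp Z) y := fun y hy => θ.conj_nablaUp_two Z hA hy
  have e3 : starRingEnd ℂ (θ.nablaDown Z 0 (θ.scalarCurv Z) x) =
      θ.levi Z x * θ.nablaUp Z 0 (θ.scalarCurv Z) x := by
    rw [θ.conj_nablaDown_zero Z hR hx]
    congr 1
    exact θ.nablaUp_congr Z 0 (fun y hy => θ.conj_scalarCurv Z hy) hx
  have e4 : starRingEnd ℂ (θ.nablaUp Z 1 (θ.nablaUp Z 2 (θ.torsion Z)) x) =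
      θ.nablaDown Z (-1) (θ.nablaDown Z (-2) (θ.torsionUp Z)) x := by
    rw [θ.conj_nablaUp_one Z (θ.smoothFunOn_nablaUp Z hA 2) hx]
    refine θ.nablaDown_congr Z _ (fun y hy => ?_) hx
    rw [e2 y hy, inv_mul_cancel_left₀ (θ.levi_ne_zero Z hy)]
  rw [paneitzPrime]
  push_cast
  rw [θ.ofReal_re_sublaplacian_sublaplacian Z hx hf, θ.ofReal_re_sublaplacian_scalarCurv Z hx,
    Complex.im_eq_sub_conj, θ.conj_divTorsionGrad Z hx hf, Complex.re_eq_add_conj, e1,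
    Complex.re_eq_add_conj, Complex.im_eq_sub_conj, e4, map_mul, map_sub, map_mul, Complex.conj_I,
    e2 x hx, e3, θ.conj_nablaUp_ofReal Z hx hf, primeC, divTorsionGrad, sub_div_two_mul_I,
    sub_div_two_mul_I]
  field_simp
  ring

theorem thirdOrder_eq : θ.thirdOrder Z f x = θ.thirdC Z (fun y => (f y : ℂ)) x := by
  rw [thirdOrder, thirdC, mul_assoc]

/-- Conjugating a lower unbarred index gives a barred one, which is raised at the cost of a factor
h. -/
theorem conj_thirdOrder : starRingEnd ℂ (θ.thirdOrder Z f x) =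
    θ.levi Z x * θ.thirdConj Z (fun y => (f y : ℂ)) x := by
  have hF := SmoothFunOn.ofReal hf
  have h0 := θ.levi_ne_zero Z hx
  have h1 := θ.smoothFunOn_nablaDown Z (θ.smoothFunOn_nablaUp Z hF 0) (-1)
  rw [thirdOrder, map_add, map_mul, map_mul, Complex.conj_I, θ.conj_nablaUp_ofReal Z hx hf,
    θ.conj_nablaDown_zero Z h1 hx, thirdConj, torsionUp,
    θ.nablaUp_congr Z 0 (v := θ.nablaUp Z 1 (θ.nablaDown Z 0 fun y => (f y : ℂ))) (fun y hy => ?_) hx]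
  · field_simp
    ring
  · rw [← θ.conj_nablaUp_nablaDown Z hf hy, Complex.conj_conj]

theorem ofReal_re_thirdOrderPairing {σ : M → ℝ} (hσ : ContMDiffOn (𝓡 3) 𝓘(ℝ, ℝ) ∞ σ Z.U) :
    ((2 * (θ.thirdOrderPairing Z f σ x).re : ℝ) : ℂ) =
      θ.thirdC Z (fun y => (f y : ℂ)) x * θ.nablaUp Z 0 (fun y => (σ y : ℂ)) x
        + θ.thirdConj Z (fun y => (f y : ℂ)) x * θ.nablaDown Z 0 (fun y => (σ y : ℂ)) x := by
  have h0 := θ.levi_ne_zero Z hx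
  push_cast
  rw [Complex.re_eq_add_conj, thirdOrderPairing, map_mul, θ.conj_thirdOrder Z hx hf,
    θ.conj_nablaUp_ofReal Z hx hσ, θ.thirdOrder_eq Z hx hf]
  field_simp

end ContactForm

end CRGeometry
end

/-! ### Part: change of frame. -/

open scoped Manifold ContDiff
noncomputable section
namespace CRGeometry

open Topology LaurentPolynomial smoothFun

variable {M : Type*} [TopologicalSpace M] [ChartedSpace E3 M] [IsManifold (𝓡 3) ∞ M]
  {S : CRStructure M}

theorem hasMFDerivAt_comp_dFun {g : ℂ → ℂ} {g' : ℂ} {u : M → ℂ} {x : M} (hg : HasDerivAt g g' (u x))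
    (hu : MDifferentiableAt (𝓡 3) 𝓘(ℝ, ℂ) u x) :
    MDifferentiableAt (𝓡 3) 𝓘(ℝ, ℂ) (fun y => g (u y)) x ∧
      ∀ w, dFun (fun y => g (u y)) x w = g' * dFun u x w := by
  have h1 : HasFDerivAt g (((1 : ℂ →L[ℂ] ℂ).smulRight g').restrictScalars ℝ) (u x) :=
    hg.hasFDerivAt.restrictScalars ℝ
  have h := h1.hasMFDerivAt.comp x (hasMFDerivAt_dFun hu)
  refine ⟨h.mdifferentiableAt, fun w => ?_⟩
  have e : dFun (fun y => g (u y)) x w = dFun u x w * g' :=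
    congrArg (fun φ : TangentSpace (𝓡 3) x →L[ℝ] ℂ => φ w) h.mfderiv
  rw [e, mul_comm]

theorem CField.act_comp (V : CField M) {g : ℂ → ℂ} {g' : ℂ} {u : M → ℂ} {x : M}
    (hg : HasDerivAt g g' (u x)) (hu : MDifferentiableAt (𝓡 3) 𝓘(ℝ, ℂ) u x) :
    V.act (fun y => g (u y)) x = g' * V.act u x := by
  simp only [CField.act, CForm.app, (hasMFDerivAt_comp_dFun hg hu).2]
  ring

/-- The bracket of a linear combination of fields. -/
theorem app_bracket_comb [T2Space M] {V W V₁ V₂ V₃ : CField M} {U : Set M} (hU : IsOpen U)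
    (hV : V.SmoothOn U) (hW : W.SmoothOn U) (h₁ : V₁.SmoothOn U) (h₂ : V₂.SmoothOn U)
    (h₃ : V₃.SmoothOn U) {α β γ : M → ℂ} (hα : SmoothFunOn α U) (hβ : SmoothFunOn β U)
    (hγ : SmoothFunOn γ U) (h : ∀ y ∈ U, ∀ φ : CForm M, φ.app V y =
      α y * φ.app V₁ y + β y * φ.app V₂ y + γ y * φ.app V₃ y) {x : M} (hx : x ∈ U) (φ : CForm M) :
    φ.app (V.bracket W) x = α x * φ.app (V₁.bracket W) x + β x * φ.app (V₂.bracket W) x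
      + γ x * φ.app (V₃.bracket W) x - W.act α x * φ.app V₁ x - W.act β x * φ.app V₂ x
      - W.act γ x * φ.app V₃ x := by
  let R : CField M := (((((V₁.bracket W).smul fun _ => α x).add ((V₂.bracket W).smul fun _ => β x)).add
    ((V₃.bracket W).smul fun _ => γ x)).add (V₁.smul fun _ => -W.act α x)).add
    ((V₂.smul fun _ => -W.act β x).add (V₃.smul fun _ => -W.act γ x))
  have hR : ∀ φ : CForm M, φ.app R x = α x * φ.app (V₁.bracket W) x + β x * φ.app (V₂.bracket W) x
      + γ x * φ.app (V₃.bracket W) x - W.act α x * φ.app V₁ x - W.act β x * φ.app V₂ x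
      - W.act γ x * φ.app V₃ x := fun φ => by
    simp only [R, CForm.app_add, CForm.app_smul]
    ring
  rw [← hR]
  -- Both sides are compared by their action on functions, where brackets are commutators and the
  -- Leibniz rule produces the derivatives of the coefficients.
  obtain ⟨e1, e2⟩ := CField.eq_of_act_eq (V := V.bracket W) (W := R) (x := x) fun s hs => by
    have hs' : SmoothFunOn (fun y => (s y : ℂ)) U := SmoothFunOn.ofReal hs.contMDiffOn
    have a1 := h₁.act hU hs'
    have a2 := h₂.act hU hs'
    have a3 := h₃.act hU hs'
    have hR' := hR (dFun fun y => (s y : ℂ))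
    have c1 := CField.act_bracket hU h₁ hW hs' hx
    have c2 := CField.act_bracket hU h₂ hW hs' hx
    have c3 := CField.act_bracket hU h₃ hW hs' hx
    have eV : ∀ y ∈ U, V.act (fun y => (s y : ℂ)) y = α y * V₁.act (fun y => (s y : ℂ)) y
      + β y * V₂.act (fun y => (s y : ℂ)) y + γ y * V₃.act (fun y => (s y : ℂ)) y :=
      fun y hy => h y hy _
    have eV2 : V.act (W.act fun y => (s y : ℂ)) x = α x * V₁.act (W.act fun y => (s y : ℂ)) x
      + β x * V₂.act (W.act fun y => (s y : ℂ)) x + γ x * V₃.act (W.act fun y => (s y : ℂ)) x :=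
      h x hx _
    have eW : W.act (V.act fun y => (s y : ℂ)) x = _ := act_congr_on W hU eV hx
    have m : ∀ {u : M → ℂ}, SmoothFunOn u U → MDifferentiableAt (𝓡 3) 𝓘(ℝ, ℂ) u x :=
      fun hu => hu.mdifferentiableAt hU hx
    rw [W.act_add (m ((hα.mul a1).add (hβ.mul a2))) (m (hγ.mul a3)), W.act_add (m (hα.mul a1))
      (m (hβ.mul a2)), W.act_mul (m hα) (m a1), W.act_mul (m hβ) (m a2), W.act_mul (m hγ) (m a3)] at eW
    rw [CField.act_bracket hU hV hW hs' hx, eV2, eW]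
    change _ = (dFun fun y => (s y : ℂ)).app R x
    rw [hR']
    change _ = α x * (V₁.bracket W).act _ x + β x * (V₂.bracket W).act _ x
      + γ x * (V₃.bracket W).act _ x - W.act α x * V₁.act _ x - W.act β x * V₂.act _ x
      - W.act γ x * V₃.act _ x
    rw [c1, c2, c3]
    ring
  exact φ.app_eq_of_eq e1 e2

/-- The bracket of a multiple of a field. -/
theorem app_bracket_smul [T2Space M] {V W V₁ : CField M} {U : Set M} (hU : IsOpen U)
    (hV : V.SmoothOn U) (hW : W.SmoothOn U) (h₁ : V₁.SmoothOn U) {α : M → ℂ} (hα : SmoothFunOn α U)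
    (h : ∀ y ∈ U, ∀ φ : CForm M, φ.app V y = α y * φ.app V₁ y) {x : M} (hx : x ∈ U) (φ : CForm M) :
    φ.app (V.bracket W) x = α x * φ.app (V₁.bracket W) x - W.act α x * φ.app V₁ x := by
  have z := SmoothFunOn.const 0 U
  rw [app_bracket_comb hU hV hW h₁ h₁ h₁ hα z z (fun y hy φ => by rw [h y hy]; ring) hx,
    W.act_const]
  ring

/-- The restriction of a frame to an open subset. -/
def CRStructure.Frame.restrict (Z : S.Frame) {O : Set M} (hO : IsOpen O) (h : O ⊆ Z.U) : S.Frame where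
  U := O
  isOpen := hO
  Z := Z.Z
  smooth := Z.smooth.mono h
  ne_zero x hx := Z.ne_zero x (h hx)
  one_zero x hx := Z.one_zero x (h hx)

namespace ContactForm

variable (θ : ContactForm S) {Z Z' : S.Frame}

/-- The factor between two frames. -/
def transition (Z Z' : S.Frame) (x : M) : ℂ := (θ.coframe Z).app Z'.Z x

section transition

variable {x : M} (hx : x ∈ Z.U) (hx' : x ∈ Z'.U)
include hx hx'

/-- Both frames are of type (1,0), so J-linearity makes Z̄' a multiple of Z̄, which θ¹ kills. -/
theorem coframe_app_conj_frame : (θ.coframe Z).app Z'.Z.conj x = 0 := by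
  obtain ⟨h, e⟩ := Z'.one_zero x hx'
  obtain ⟨a, b, hab⟩ := Z.exists_eq_smul_add hx h
  obtain ⟨hr, hi⟩ := Z.mem hx
  have e1 : S.J x ⟨Z'.Z.re x, h⟩ = a • S.J x ⟨Z.Z.re x, hr⟩ + b • S.J x ⟨Z.Z.im x, hi⟩ := by
    rw [← map_smul, ← map_smul, ← map_add]
    congr 1
    exact Subtype.ext hab
  have e2 := congrArg Subtype.val e1
  have e3 : Z'.Z.im x = a • Z.Z.im x - b • Z.Z.re x := by
    rw [e, e2]
    change -(a • ((S.J x ⟨Z.Z.re x, hr⟩ : S.H x) : TangentSpace (𝓡 3) x)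
      + b • ((S.J x ⟨Z.Z.im x, hi⟩ : S.H x) : TangentSpace (𝓡 3) x)) = _
    rw [Z.J_re hx _ rfl, Z.J_im hx _ rfl]
    module
  rw [CForm.app]
  change θ.coframe Z x (Z'.Z.re x) + Complex.I * θ.coframe Z x (-Z'.Z.im x) = 0
  rw [map_neg, e3, hab, map_add, map_sub, map_smul, map_smul, map_smul, map_smul, θ.coframe_re Z hx,
    θ.coframe_im Z hx]
  simp only [Complex.real_smul]
  linear_combination (a / 2 : ℂ) * Complex.I_sq

theorem app_frame (φ : CForm M) : φ.app Z'.Z x = θ.transition Z Z' x * φ.app Z.Z x := by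
  rw [θ.app_decomp Z φ Z'.Z hx, θ.coframe_app_conj_frame hx hx', θ.formC_app_Z Z' hx', transition]
  simp

theorem app_frame_conj (φ : CForm M) :
    φ.app Z'.Z.conj x = starRingEnd ℂ (θ.transition Z Z' x) * φ.app Z.Z.conj x := by
  have h := θ.app_frame hx hx' φ.conj
  rw [CForm.app_conj', CForm.app_conj'] at h
  have := congrArg (starRingEnd ℂ) h
  rwa [map_mul, Complex.conj_conj, Complex.conj_conj] at this

theorem act_frame (w : M → ℂ) : Z'.Z.act w x = θ.transition Z Z' x * Z.Z.act w x :=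
  θ.app_frame hx hx' _

theorem act_frame_conj (w : M → ℂ) :
    Z'.Z.conj.act w x = starRingEnd ℂ (θ.transition Z Z' x) * Z.Z.conj.act w x :=
  θ.app_frame_conj hx hx' _

theorem transition_ne_zero : θ.transition Z Z' x ≠ 0 := by
  intro h0
  have h := θ.app_frame hx hx' (θ.coframe Z')
  rw [θ.coframe_app_Z Z' hx', h0, zero_mul] at h
  exact one_ne_zero h

theorem coframe_frame (V : CField M) :
    (θ.coframe Z').app V x = (θ.transition Z Z' x)⁻¹ * (θ.coframe Z).app V x := by
  have h := θ.app_decomp Z' (θ.coframe Z) V hx'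
  rw [θ.coframe_app_conj_frame hx hx', θ.coframe_app_reeb Z hx] at h
  rw [h, transition]
  have h0 : (θ.coframe Z).app Z'.Z x ≠ 0 := θ.transition_ne_zero hx hx'
  field_simp
  ring

end transition

section sameDomain

variable (hU : Z'.U = Z.U)
include hU

theorem smoothFunOn_transition : SmoothFunOn (θ.transition Z Z') Z.U :=
  θ.smoothFunOn_coframe_app Z Z.isOpen subset_rfl (hU ▸ Z'.smooth)

variable [T2Space M] {x : M} (hx : x ∈ Z.U)
include hx

theorem app_bracket_frame (φ : CForm M) {W : CField M} (hW : W.SmoothOn Z.U) :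
    φ.app (Z'.Z.bracket W) x = θ.transition Z Z' x * φ.app (Z.Z.bracket W) x
      - W.act (θ.transition Z Z') x * φ.app Z.Z x :=
  app_bracket_smul Z.isOpen (hU ▸ Z'.smooth) hW Z.smooth (θ.smoothFunOn_transition hU)
    (fun _ hy φ => θ.app_frame hy (hU ▸ hy) φ) hx φ

theorem app_bracket_frame_conj (φ : CForm M) {W : CField M} (hW : W.SmoothOn Z.U) :
    φ.app (Z'.Z.conj.bracket W) x = starRingEnd ℂ (θ.transition Z Z' x) * φ.app (Z.Z.conj.bracket W) x
      - W.act (fun y => starRingEnd ℂ (θ.transition Z Z' y)) x * φ.app Z.Z.conj x :=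
  app_bracket_smul Z.isOpen (hU ▸ Z'.smooth.conj) hW Z.smooth.conj (θ.smoothFunOn_transition hU).conj
    (fun _ hy φ => θ.app_frame_conj hy (hU ▸ hy) φ) hx φ

theorem levi_frame : θ.levi Z' x =
    θ.transition Z Z' x * starRingEnd ℂ (θ.transition Z Z' x) * θ.levi Z x := by
  have hx' : x ∈ Z'.U := hU ▸ hx
  have h1 := θ.formC_app_bracket_Z Z' hx'
  rw [θ.app_bracket_frame hU hx _ (hU ▸ Z'.smooth.conj), CForm.app_bracket_swap,
    θ.app_bracket_frame_conj hU hx _ Z.smooth, CForm.app_bracket_swap, θ.formC_app_bracket_Z Z hx,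
    θ.formC_app_Z Z hx, θ.formC_app_Zbar Z hx] at h1
  have hI := Complex.I_ne_zero
  apply mul_left_cancel₀ (neg_ne_zero.2 hI)
  rw [← h1]
  ring

theorem connZbar_frame : θ.connZbar Z' x = starRingEnd ℂ (θ.transition Z Z' x) * (θ.connZbar Z x
    + (θ.transition Z Z' x)⁻¹ * Z.Z.conj.act (θ.transition Z Z') x) := by
  have hx' : x ∈ Z'.U := hU ▸ hx
  have h0 := θ.transition_ne_zero hx hx'
  rw [connZbar, θ.coframe_frame hx hx', θ.app_bracket_frame_conj hU hx _ (hU ▸ Z'.smooth),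
    CForm.app_bracket_swap, θ.app_bracket_frame hU hx _ Z.smooth.conj, CForm.app_bracket_swap,
    θ.coframe_app_Z Z hx, θ.coframe_app_Zbar Z hx, connZbar]
  field_simp
  ring

theorem connT_frame : θ.connT Z' x = θ.connT Z x
    + (θ.transition Z Z' x)⁻¹ * θ.reeb.act (θ.transition Z Z') x := by
  have hx' : x ∈ Z'.U := hU ▸ hx
  have h0 := θ.transition_ne_zero hx hx'
  rw [connT, θ.coframe_frame hx hx', CForm.app_bracket_swap,
    θ.app_bracket_frame hU hx _ (θ.smoothOn_reeb _), CForm.app_bracket_swap,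
    θ.coframe_app_Z Z hx, connT]
  field_simp
  ring

theorem torsion_frame : θ.torsion Z' x = θ.transition Z Z' x ^ 2 * θ.torsion Z x := by
  have hx' : x ∈ Z'.U := hU ▸ hx
  have h0 := θ.transition_ne_zero hx hx'
  have h1 : starRingEnd ℂ (θ.transition Z Z' x) ≠ 0 := (map_ne_zero _).2 h0
  rw [torsion, torsion, θ.levi_frame hU hx, θ.coframe_frame hx hx', CForm.app_bracket_swap,
    θ.app_bracket_frame_conj hU hx _ (θ.smoothOn_reeb _), CForm.app_bracket_swap,
    θ.coframe_app_Zbar Z hx]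
  simp only [map_mul, map_neg, mul_zero, sub_zero, Complex.conj_conj, map_inv₀]
  field_simp

theorem connZ_frame : θ.connZ Z' x = θ.transition Z Z' x * θ.connZ Z x
    + Z.Z.act (θ.transition Z Z') x := by
  have hx' : x ∈ Z'.U := hU ▸ hx
  have h0 := θ.transition_ne_zero hx hx'
  have h1 : starRingEnd ℂ (θ.transition Z Z' x) ≠ 0 := (map_ne_zero _).2 h0
  have h2 := θ.levi_ne_zero Z hx
  have su := θ.smoothFunOn_transition hU
  have m : ∀ {u : M → ℂ}, SmoothFunOn u Z.U → MDifferentiableAt (𝓡 3) 𝓘(ℝ, ℂ) u x :=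
    fun hu => hu.mdifferentiableAt Z.isOpen hx
  rw [connZ, θ.connZbar_frame hU hx, θ.levi_frame hU hx, θ.act_frame hx hx',
    act_congr_on Z.Z Z.isOpen (fun y hy => θ.levi_frame hU hy) hx,
    Z.Z.act_mul (m (su.mul su.conj)) (m (θ.smoothFunOn_levi Z)), Z.Z.act_mul (m su) (m su.conj),
    act_Z_conj Z su hx, connZ]
  simp only [map_mul, map_add, Complex.conj_conj, map_inv₀]
  field_simp
  ring

/-- Writing Z' = uZ, the form ω changes by du/u, which is closed; in the computation this shows as
the commutator [Z, Z̄]u cancelling the second derivatives. -/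
theorem scalarCurv_frame : θ.scalarCurv Z' x = θ.scalarCurv Z x := by
  have hx' : x ∈ Z'.U := hU ▸ hx
  have h0 := θ.transition_ne_zero hx hx'
  have h1 : starRingEnd ℂ (θ.transition Z Z' x) ≠ 0 := (map_ne_zero _).2 h0
  have h2 := θ.levi_ne_zero Z hx
  have su := θ.smoothFunOn_transition hU
  have si : SmoothFunOn (fun y => (θ.transition Z Z' y)⁻¹) Z.U :=
    su.inv fun y hy => θ.transition_ne_zero hy (hU ▸ hy)
  have sb := θ.smoothFunOn_connZbar Z
  have sw := Z.smooth.conj.act Z.isOpen su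
  have sz := Z.smooth.act Z.isOpen su
  have m : ∀ {u : M → ℂ}, SmoothFunOn u Z.U → MDifferentiableAt (𝓡 3) 𝓘(ℝ, ℂ) u x :=
    fun hu => hu.mdifferentiableAt Z.isOpen hx
  have c := θ.act_Z_Zbar Z hx su
  have di : Z.Z.act (fun y => (θ.transition Z Z' y)⁻¹) x =
      -(θ.transition Z Z' x ^ 2)⁻¹ * Z.Z.act (θ.transition Z Z') x :=
    Z.Z.act_comp (hasDerivAt_inv h0) (m su)
  rw [θ.scalarCurv_eq Z' hx', θ.scalarCurv_eq Z hx, θ.act_frame hx hx', θ.act_frame_conj hx hx',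
    act_congr_on Z.Z Z.isOpen (fun y hy => θ.connZbar_frame hU hy) hx,
    act_congr_on Z.Z.conj Z.isOpen (fun y hy => θ.connZ_frame hU hy) hx, θ.levi_frame hU hx,
    θ.connT_frame hU hx, θ.connZ_frame hU hx, θ.connZbar_frame hU hx,
    Z.Z.act_mul (m su.conj) (m (sb.add (si.mul sw))), Z.Z.act_add (m sb) (m (si.mul sw)),
    Z.Z.act_mul (m si) (m sw), Z.Z.conj.act_add (m (su.mul (θ.smoothFunOn_connZ Z))) (m sz),
    Z.Z.conj.act_mul (m su) (m (θ.smoothFunOn_connZ Z)), di, c, act_Z_conj Z su hx]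
  simp only [map_mul, map_add, Complex.conj_conj, map_inv₀]
  field_simp
  ring

/-- `τ'` and `τ` are the components in the frames `Z'` and `Z` of one tensor of degree `p`. -/
def IsTensor (Z Z' : S.Frame) (p : ℤ) (τ' τ : M → ℂ) : Prop :=
  ∀ y ∈ Z.U, τ' y = θ.transition Z Z' y ^ p * τ y

omit hx
variable {p : ℤ} {τ τ' : M → ℂ} (hτ : SmoothFunOn τ Z.U)

theorem act_zpow_mul (V : CField M) (hτ : SmoothFunOn τ Z.U) (hx : x ∈ Z.U) :
    V.act (fun y => θ.transition Z Z' y ^ p * τ y) x = θ.transition Z Z' x ^ p * (V.act τ x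
      + p * (θ.transition Z Z' x)⁻¹ * V.act (θ.transition Z Z') x * τ x) := by
  have h0 := θ.transition_ne_zero hx (hU ▸ hx : x ∈ Z'.U)
  have su := (θ.smoothFunOn_transition hU).mdifferentiableAt Z.isOpen hx
  have hd := hasDerivAt_zpow p _ (Or.inl h0)
  rw [V.act_mul (hasMFDerivAt_comp_dFun hd su).1 (hτ.mdifferentiableAt Z.isOpen hx),
    V.act_comp hd su, zpow_sub_one₀ h0]
  ring

theorem IsTensor.nablaDown (hτ : SmoothFunOn τ Z.U) (h : θ.IsTensor Z Z' p τ' τ) :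
    θ.IsTensor Z Z' (p + 1) (θ.nablaDown Z' p τ') (θ.nablaDown Z p τ) := fun x hx => by
  have hx' : x ∈ Z'.U := hU ▸ hx
  have h0 := θ.transition_ne_zero hx hx'
  rw [ContactForm.nablaDown, ContactForm.nablaDown, θ.act_frame hx hx', act_congr_on _ Z.isOpen h hx,
    θ.act_zpow_mul hU _ hτ hx, θ.conn_app_Z Z' hx', θ.conn_app_Z Z hx, h x hx, θ.connZ_frame hU hx,
    zpow_add_one₀ h0]
  field_simp
  ring

theorem IsTensor.nablaUp (hτ : SmoothFunOn τ Z.U) (h : θ.IsTensor Z Z' p τ' τ) :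
    θ.IsTensor Z Z' (p - 1) (θ.nablaUp Z' p τ') (θ.nablaUp Z p τ) := fun x hx => by
  have hx' : x ∈ Z'.U := hU ▸ hx
  have h0 := θ.transition_ne_zero hx hx'
  have h1 : starRingEnd ℂ (θ.transition Z Z' x) ≠ 0 := (map_ne_zero _).2 h0
  rw [ContactForm.nablaUp, ContactForm.nablaUp, θ.act_frame_conj hx hx', act_congr_on _ Z.isOpen h hx,
    θ.act_zpow_mul hU _ hτ hx, θ.conn_app_Zbar Z' hx', θ.conn_app_Zbar Z hx, h x hx,
    θ.connZbar_frame hU hx, θ.levi_frame hU hx, zpow_sub_one₀ h0]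
  have h2 := θ.levi_ne_zero Z hx
  field_simp
  ring

omit hU in
theorem IsTensor.mul {q : ℤ} {υ υ' : M → ℂ} (hU : Z'.U = Z.U) (h : θ.IsTensor Z Z' p τ' τ)
    (h' : θ.IsTensor Z Z' q υ' υ) :
    θ.IsTensor Z Z' (p + q) (fun y => τ' y * υ' y) (fun y => τ y * υ y) := fun x hx => by
  change τ' x * υ' x = _ * (τ x * υ x)
  rw [h x hx, h' x hx, zpow_add₀ (θ.transition_ne_zero hx (hU ▸ hx : x ∈ Z'.U))]
  ring

theorem IsTensor.sublaplacian (hτ : SmoothFunOn τ Z.U) (h : θ.IsTensor Z Z' 0 τ' τ) :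
    θ.IsTensor Z Z' 0 (θ.sublaplacian Z' τ') (θ.sublaplacian Z τ) := fun x hx => by
  have h1 := (h.nablaDown θ hU hτ).nablaUp θ hU (θ.smoothFunOn_nablaDown Z hτ 0) x hx
  have h2 := (h.nablaUp θ hU hτ).nablaDown θ hU (θ.smoothFunOn_nablaUp Z hτ 0) x hx
  simp only [zero_add, sub_self, zero_sub, neg_add_cancel, zpow_zero, one_mul] at h1 h2
  rw [ContactForm.sublaplacian, ContactForm.sublaplacian, h1, h2, zpow_zero, one_mul]

/-- Each ingredient scales by u to the power of its degree, and every term of P₄' is contracted to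
degree 0. -/
theorem paneitzPrime_frame {f : M → ℝ} (hf : ContMDiffOn (𝓡 3) 𝓘(ℝ, ℝ) ∞ f Z.U) (hx : x ∈ Z.U) :
    θ.paneitzPrime Z' f x = θ.paneitzPrime Z f x := by
  have hx' : x ∈ Z'.U := hU ▸ hx
  have h0 := θ.transition_ne_zero hx hx'
  have hF : SmoothFunOn (fun y => (f y : ℂ)) Z.U := SmoothFunOn.ofReal hf
  have hA := θ.smoothFunOn_torsion Z
  have hR := θ.smoothFunOn_scalarCurv Z
  have tF : θ.IsTensor Z Z' 0 (fun y => (f y : ℂ)) (fun y => (f y : ℂ)) := fun y _ => by simp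
  have tR : θ.IsTensor Z Z' 0 (θ.scalarCurv Z') (θ.scalarCurv Z) := fun y hy => by
    rw [θ.scalarCurv_frame hU hy]; simp
  have tA : θ.IsTensor Z Z' 2 (θ.torsion Z') (θ.torsion Z) := fun y hy => by
    rw [θ.torsion_frame hU hy]; rfl
  have tU := tF.nablaUp θ hU hF
  have tD := tF.nablaDown θ hU hF
  have sU := θ.smoothFunOn_nablaUp Z hF 0
  have sD := θ.smoothFunOn_nablaDown Z hF 0
  have e1 := (tF.sublaplacian θ hU hF).sublaplacian θ hU (θ.smoothFunOn_sublaplacian Z hF) x hx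
  have e2 := (tA.mul θ hU tU).nablaUp θ hU (hA.mul sU) x hx
  have e3 := (tR.mul θ hU tD).nablaUp θ hU (hR.mul sD) x hx
  have e4 := tR.nablaDown θ hU hR x hx
  have e5 := tA.nablaUp θ hU hA x hx
  have e6 := tU x hx
  have e7 := tR.sublaplacian θ hU hR x hx
  have e8 := (tA.nablaUp θ hU hA).nablaUp θ hU (θ.smoothFunOn_nablaUp Z hA 2) x hx
  have n1 : (2 : ℤ) - 1 = 1 := rfl
  have n2 : (2 : ℤ) + -1 = 1 := rfl
  simp only [zero_add, zero_sub, sub_self, n1, n2, zpow_zero, one_mul, zpow_one, zpow_neg_one]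
    at e1 e2 e3 e4 e5 e6 e7 e8
  have e9 : ∀ a b c : ℂ, (θ.transition Z Z' x * a - Complex.I * (θ.transition Z Z' x * b)) *
      ((θ.transition Z Z' x)⁻¹ * c) = (a - Complex.I * b) * c := fun a b c => by field_simp
  rw [paneitzPrime, paneitzPrime, divTorsionGrad, divTorsionGrad, e1, e2, e3, e4, e5, e6, e7, e8, e9]

end sameDomain

/-- The calculus of a frame only depends on its vector field. -/
theorem calculus_congr (h : Z'.Z = Z.Z) : θ.torsion Z' = θ.torsion Z ∧ θ.scalarCurv Z' = θ.scalarCurv Z ∧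
    θ.nablaDown Z' = θ.nablaDown Z ∧ θ.nablaUp Z' = θ.nablaUp Z := by
  have h1 : θ.levi Z' = θ.levi Z := by unfold levi; rw [h]
  have h2 : θ.coframe Z' = θ.coframe Z := by unfold coframe; rw [h]
  have h3 : θ.connZbar Z' = θ.connZbar Z := by unfold connZbar; rw [h, h2]
  have h4 : θ.connT Z' = θ.connT Z := by unfold connT; rw [h, h2]
  have h5 : θ.connZ Z' = θ.connZ Z := by unfold connZ; rw [h, h1, h3]
  have h6 : θ.conn Z' = θ.conn Z := by unfold conn; rw [h2, h3, h4, h5]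
  refine ⟨?_, ?_, ?_, ?_⟩
  · unfold torsion; rw [h, h1, h2]
  · unfold scalarCurv; rw [h, h1, h6]
  · unfold nablaDown; rw [h, h6]
  · unfold nablaUp; rw [h, h1, h6]

theorem paneitzPrime_congr (h : Z'.Z = Z.Z) : θ.paneitzPrime Z' = θ.paneitzPrime Z := by
  obtain ⟨h1, h2, h3, h4⟩ := θ.calculus_congr h
  unfold paneitzPrime divTorsionGrad sublaplacian
  rw [h1, h2, h3, h4]

theorem thirdOrder_congr (h : Z'.Z = Z.Z) : θ.thirdOrder Z' = θ.thirdOrder Z := by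
  obtain ⟨h1, -, h3, h4⟩ := θ.calculus_congr h
  unfold thirdOrder
  rw [h1, h3, h4]

/-- The `P'`-operator does not depend on the frame. -/
theorem paneitzPrime_eq_of_frames [T2Space M] {f : M → ℝ} (hf : ContMDiff (𝓡 3) 𝓘(ℝ, ℝ) ∞ f) {x : M}
    (hx : x ∈ Z.U) (hx' : x ∈ Z'.U) : θ.paneitzPrime Z' f x = θ.paneitzPrime Z f x := by
  -- `paneitzPrime_frame` requires equal domains. Cutting both frames down to the overlap changes no
  -- operator, since these depend only on the vector field of the frame.
  have hO := Z.isOpen.inter Z'.isOpen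
  have h := θ.paneitzPrime_frame (Z := Z.restrict hO Set.inter_subset_left)
    (Z' := Z'.restrict hO Set.inter_subset_right) rfl hf.contMDiffOn ⟨hx, hx'⟩
  rwa [θ.paneitzPrime_congr (Z := Z) (Z' := Z.restrict hO _) rfl,
    θ.paneitzPrime_congr (Z := Z') (Z' := Z'.restrict hO _) rfl] at h

end ContactForm

end CRGeometry
end

/-! ### Part: connection, torsion and curvature of e^σ θ in the same frame. -/

open scoped Manifold ContDiff
noncomputable section
namespace CRGeometry

open Topology LaurentPolynomial smoothFun

variable {M : Type*} [TopologicalSpace M] [ChartedSpace E3 M] [IsManifold (𝓡 3) ∞ M]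
  {S : CRStructure M}

theorem CForm.app_bracket_self (φ : CForm M) (V : CField M) (x : M) : φ.app (V.bracket V) x = 0 := by
  have h := φ.app_bracket_swap V V x
  linear_combination h / 2

namespace ContactForm

variable (θ : ContactForm S) (Z : S.Frame) (σ : M → ℝ) (hσ : ContMDiff (𝓡 3) 𝓘(ℝ, ℝ) ∞ σ)

theorem nablaDown_zero (u : M → ℂ) : θ.nablaDown Z 0 u = Z.Z.act u := by
  funext x
  simp [nablaDown]

theorem nablaUp_zero (u : M → ℂ) :
    θ.nablaUp Z 0 u = fun x => (θ.levi Z x)⁻¹ * Z.Z.conj.act u x := by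
  funext x
  simp [nablaUp]

theorem formC_rescale_app (V : CField M) (x : M) :
    (θ.rescale σ hσ).formC.app V x = Complex.exp (σ x) * θ.formC.app V x := by
  simp only [CForm.app, CForm.ofReal, rescale, ContinuousLinearMap.comp_apply,
    smul_apply, Complex.ofRealCLM_apply, smul_eq_mul, Complex.ofReal_mul, Complex.ofReal_exp]
  ring

theorem levi_rescale {x : M} (hx : x ∈ Z.U) :
    (θ.rescale σ hσ).levi Z x = Complex.exp (σ x) * θ.levi Z x := by
  have h := (θ.rescale σ hσ).formC_app_bracket_Z Z hx
  rw [formC_rescale_app, θ.formC_app_bracket_Z Z hx] at h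
  linear_combination (-Complex.I) * h + ((θ.rescale σ hσ).levi Z x - Complex.exp (σ x) * θ.levi Z x) * Complex.I_sq

include hσ in
theorem smoothFunOn_of_contMDiff (U : Set M) : SmoothFunOn (fun y => (σ y : ℂ)) U :=
  SmoothFunOn.ofReal hσ.contMDiffOn

include hσ in
theorem smoothFunOn_exp_neg (U : Set M) : SmoothFunOn (fun y => Complex.exp (-(σ y : ℂ))) U :=
  ContMDiffOn.congr (SmoothFunOn.ofReal (Real.contDiff_exp.contMDiff.comp hσ.neg).contMDiffOn)
    fun x _ => by simp

include hσ in
theorem act_exp_neg (V : CField M) (x : M) : V.act (fun y => Complex.exp (-(σ y : ℂ))) x =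
    -(Complex.exp (-(σ x : ℂ)) * V.act (fun y => (σ y : ℂ)) x) := by
  have h : HasDerivAt (fun w : ℂ => Complex.exp (-w)) (-Complex.exp (-(σ x : ℂ))) (σ x : ℂ) := by
    simpa using (hasDerivAt_neg (σ x : ℂ)).cexp
  rw [V.act_comp h ((smoothFunOn_of_contMDiff σ hσ Set.univ).mdifferentiableAt isOpen_univ trivial),
    neg_mul]

include hσ in
theorem act_exp (V : CField M) (x : M) : V.act (fun y => Complex.exp (σ y : ℂ)) x =
    Complex.exp (σ x : ℂ) * V.act (fun y => (σ y : ℂ)) x :=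
  V.act_comp (Complex.hasDerivAt_exp _)
    ((smoothFunOn_of_contMDiff σ hσ Set.univ).mdifferentiableAt isOpen_univ trivial)

include hσ in
theorem smoothFunOn_exp (U : Set M) : SmoothFunOn (fun y => Complex.exp (σ y : ℂ)) U :=
  ContMDiffOn.congr (SmoothFunOn.ofReal (Real.contDiff_exp.contMDiff.comp hσ).contMDiffOn)
    fun x _ => by simp

/-- The `Z`-component of the Reeb field of `e^σ θ`. -/
def reebShift (x : M) : ℂ := -Complex.I * (Complex.exp (-(σ x : ℂ)) *
  ((θ.levi Z x)⁻¹ * Z.Z.conj.act (fun y => (σ y : ℂ)) x))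

include hσ in
theorem smoothFunOn_reebShift : SmoothFunOn (θ.reebShift Z σ) Z.U :=
  (SmoothFunOn.const _ _).mul ((smoothFunOn_exp_neg σ hσ _).mul ((θ.smoothFunOn_levi_inv Z).mul
    (Z.smooth.conj.act Z.isOpen (smoothFunOn_of_contMDiff σ hσ _))))

section

variable {x : M} (hx : x ∈ Z.U)
include hx

theorem conj_act_Z_ofReal {f : M → ℝ} (hf : ContMDiffOn (𝓡 3) 𝓘(ℝ, ℝ) ∞ f Z.U) :
    starRingEnd ℂ (Z.Z.act (fun y => (f y : ℂ)) x) = Z.Z.conj.act (fun y => (f y : ℂ)) x := by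
  rw [← act_Zbar_conj Z (SmoothFunOn.ofReal hf) hx]
  simp only [Complex.conj_ofReal]

include hσ in
theorem conj_act_Zbar_ofReal : starRingEnd ℂ (Z.Z.conj.act (fun y => (σ y : ℂ)) x) =
    Z.Z.act (fun y => (σ y : ℂ)) x := by
  rw [← conj_act_Z_ofReal Z hx hσ.contMDiffOn, Complex.conj_conj]

include hσ in
theorem conj_reebShift : starRingEnd ℂ (θ.reebShift Z σ x) = Complex.I * (Complex.exp (-(σ x : ℂ)) *
    ((θ.levi Z x)⁻¹ * Z.Z.act (fun y => (σ y : ℂ)) x)) := by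
  simp only [reebShift, map_mul, map_neg, map_inv₀, Complex.conj_I, θ.conj_levi Z hx,
    conj_act_Zbar_ofReal Z σ hσ hx, ← Complex.exp_conj, Complex.conj_ofReal, neg_neg]

theorem act_Z_levi : Z.Z.act (θ.levi Z) x =
    θ.levi Z x * (θ.connZ Z x + starRingEnd ℂ (θ.connZbar Z x)) := by
  have h0 := θ.levi_ne_zero Z hx
  rw [connZ]
  field_simp
  ring

include hσ in
theorem act_reebShift (V : CField M) : V.act (θ.reebShift Z σ) x =
    -Complex.I * (Complex.exp (-(σ x : ℂ)) * ((θ.levi Z x)⁻¹ *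
      (V.act (Z.Z.conj.act (fun y => (σ y : ℂ))) x
        - (V.act (fun y => (σ y : ℂ)) x + (θ.levi Z x)⁻¹ * V.act (θ.levi Z) x)
          * Z.Z.conj.act (fun y => (σ y : ℂ)) x))) := by
  have h0 := θ.levi_ne_zero Z hx
  have m : ∀ {u : M → ℂ}, SmoothFunOn u Z.U → MDifferentiableAt (𝓡 3) 𝓘(ℝ, ℂ) u x :=
    fun hu => hu.mdifferentiableAt Z.isOpen hx
  have s1 := Z.smooth.conj.act Z.isOpen (smoothFunOn_of_contMDiff σ hσ _)
  have s2 := θ.smoothFunOn_levi_inv Z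
  have s3 := smoothFunOn_exp_neg σ hσ Z.U
  have di : V.act (fun y => (θ.levi Z y)⁻¹) x = -(θ.levi Z x ^ 2)⁻¹ * V.act (θ.levi Z) x :=
    V.act_comp (hasDerivAt_inv h0) (m (θ.smoothFunOn_levi Z))
  unfold reebShift
  rw [V.act_mul (m (SmoothFunOn.const _ _)) (m (s3.mul (s2.mul s1))), V.act_mul (m s3) (m (s2.mul s1)),
    V.act_mul (m s2) (m s1), di, act_exp_neg σ hσ, V.act_const]
  field_simp
  ring

variable [T2Space M]

omit [T2Space M] in
theorem formC_app_reeb_rescale : θ.formC.app (θ.rescale σ hσ).reeb x = Complex.exp (-(σ x : ℂ)) := by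
  have h := (θ.rescale σ hσ).formC_app_reeb (x := x)
  rw [formC_rescale_app] at h
  rw [Complex.exp_neg]
  exact eq_inv_of_mul_eq_one_right h

/-- Write T̂ = qZ + q̄Z̄ + e^{−σ}T. The Reeb condition θ([T̂, Z̄]) = 0 reads −i h q + e^{−σ} Z̄σ =
0, which determines q. -/
theorem coframe_app_reeb_rescale :
    (θ.coframe Z).app (θ.rescale σ hσ).reeb x = θ.reebShift Z σ x := by
  have h0 := θ.levi_ne_zero Z hx
  have sT := (θ.rescale σ hσ).smoothOn_reeb Z.U
  have sq := θ.smoothFunOn_coframe_app Z Z.isOpen subset_rfl sT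
  have h1 := (θ.rescale σ hσ).formC_app_bracket_reeb Z hx Z.smooth.conj fun y hy =>
    (θ.rescale σ hσ).formC_app_Zbar Z hy
  rw [formC_rescale_app] at h1
  have h2 := (mul_eq_zero.1 h1).resolve_left (Complex.exp_ne_zero _)
  rw [app_bracket_comb Z.isOpen sT Z.smooth.conj Z.smooth Z.smooth.conj (θ.smoothOn_reeb _) sq sq.conj
    (smoothFunOn_exp_neg σ hσ _) (fun y hy φ => by
      rw [θ.app_decomp Z φ _ hy, reeb_conj, θ.formC_app_reeb_rescale Z σ hσ hy]) hx,
    CForm.app_bracket_self, θ.formC_app_bracket_Z Z hx, θ.formC_app_bracket_reeb Z hx Z.smooth.conj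
      (fun y hy => θ.formC_app_Zbar Z hy), θ.formC_app_Z Z hx, θ.formC_app_Zbar Z hx, θ.formC_app_reeb,
    act_exp_neg σ hσ] at h2
  rw [reebShift]
  field_simp
  linear_combination (Complex.I) * h2 + ((θ.coframe Z).app (θ.rescale σ hσ).reeb x * θ.levi Z x) * Complex.I_sq

theorem app_reeb_rescale (φ : CForm M) : φ.app (θ.rescale σ hσ).reeb x =
    θ.reebShift Z σ x * φ.app Z.Z x + starRingEnd ℂ (θ.reebShift Z σ x) * φ.app Z.Z.conj x
      + Complex.exp (-(σ x : ℂ)) * φ.app θ.reeb x := by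
  rw [θ.app_decomp Z φ _ hx, reeb_conj, θ.formC_app_reeb_rescale Z σ hσ hx,
    θ.coframe_app_reeb_rescale Z σ hσ hx]

theorem app_bracket_reeb_rescale {W : CField M} (hW : W.SmoothOn Z.U) (φ : CForm M) :
    φ.app ((θ.rescale σ hσ).reeb.bracket W) x =
    θ.reebShift Z σ x * φ.app (Z.Z.bracket W) x
      + starRingEnd ℂ (θ.reebShift Z σ x) * φ.app (Z.Z.conj.bracket W) x
      + Complex.exp (-(σ x : ℂ)) * φ.app (θ.reeb.bracket W) x
      - W.act (θ.reebShift Z σ) x * φ.app Z.Z x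
      - W.act (fun y => starRingEnd ℂ (θ.reebShift Z σ y)) x * φ.app Z.Z.conj x
      - W.act (fun y => Complex.exp (-(σ y : ℂ))) x * φ.app θ.reeb x :=
  app_bracket_comb Z.isOpen ((θ.rescale σ hσ).smoothOn_reeb Z.U) hW Z.smooth Z.smooth.conj
    (θ.smoothOn_reeb _) (θ.smoothFunOn_reebShift Z σ hσ) (θ.smoothFunOn_reebShift Z σ hσ).conj
    (smoothFunOn_exp_neg σ hσ _) (fun _ hy φ => θ.app_reeb_rescale Z σ hσ hy φ) hx φ

theorem coframe_rescale_app (V : CField M) : ((θ.rescale σ hσ).coframe Z).app V x =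
    (θ.coframe Z).app V x - θ.reebShift Z σ x * Complex.exp (σ x) * θ.formC.app V x := by
  have h := (θ.rescale σ hσ).app_decomp Z (θ.coframe Z) V hx
  rw [θ.coframe_app_Z Z hx, θ.coframe_app_Zbar Z hx, θ.coframe_app_reeb_rescale Z σ hσ hx,
    formC_rescale_app] at h
  linear_combination -h

theorem coframe_rescale_app_bracket_reeb {W : CField M} (hW : W.SmoothOn Z.U)
    (h0 : ∀ y ∈ Z.U, θ.formC.app W y = 0) :
    ((θ.rescale σ hσ).coframe Z).app ((θ.rescale σ hσ).reeb.bracket W) x =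
    θ.reebShift Z σ x * (θ.coframe Z).app (Z.Z.bracket W) x
      + starRingEnd ℂ (θ.reebShift Z σ x) * (θ.coframe Z).app (Z.Z.conj.bracket W) x
      + Complex.exp (-(σ x : ℂ)) * (θ.coframe Z).app (θ.reeb.bracket W) x
      - W.act (θ.reebShift Z σ) x := by
  have h1 := (θ.rescale σ hσ).formC_app_bracket_reeb Z hx hW fun y hy => by
    rw [formC_rescale_app, h0 y hy, mul_zero]
  rw [formC_rescale_app] at h1
  have h2 := (mul_eq_zero.1 h1).resolve_left (Complex.exp_ne_zero _)
  rw [θ.coframe_rescale_app Z σ hσ hx, h2, θ.app_bracket_reeb_rescale Z σ hσ hx hW,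
    θ.coframe_app_Z Z hx, θ.coframe_app_Zbar Z hx, θ.coframe_app_reeb Z hx]
  ring

/-- The bracket [Z̄, Z] is unchanged; only the coframe moves, by −q e^σ θ, and θ([Z̄, Z]) = i h
converts this into −Z̄σ. -/
theorem connZbar_rescale : (θ.rescale σ hσ).connZbar Z x = θ.connZbar Z x
    - Z.Z.conj.act (fun y => (σ y : ℂ)) x := by
  have h0 := θ.levi_ne_zero Z hx
  have he : Complex.exp (-(σ x : ℂ)) * Complex.exp (σ x) = 1 := by rw [← Complex.exp_add]; simp
  have h1 : θ.reebShift Z σ x * Complex.exp (σ x) * θ.levi Z x =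
      -Complex.I * Z.Z.conj.act (fun y => (σ y : ℂ)) x := by
    rw [reebShift]
    field_simp
    linear_combination -Z.Z.conj.act (fun y => (σ y : ℂ)) x * he
  rw [connZbar, θ.coframe_rescale_app Z σ hσ hx, CForm.app_bracket_swap θ.formC,
    θ.formC_app_bracket_Z Z hx, connZbar]
  linear_combination -Complex.I * h1 + Z.Z.conj.act (fun y => (σ y : ℂ)) x * Complex.I_sq

theorem act_levi_rescale (V : CField M) : V.act ((θ.rescale σ hσ).levi Z) x =
    Complex.exp (σ x) * (V.act (θ.levi Z) x + V.act (fun y => (σ y : ℂ)) x * θ.levi Z x) := by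
  rw [act_congr_on V Z.isOpen (fun y hy => θ.levi_rescale Z σ hσ hy) hx,
    V.act_mul ((smoothFunOn_exp σ hσ Z.U).mdifferentiableAt Z.isOpen hx)
      ((θ.smoothFunOn_levi Z).mdifferentiableAt Z.isOpen hx), act_exp σ hσ]
  ring

theorem connZ_rescale : (θ.rescale σ hσ).connZ Z x = θ.connZ Z x
    + 2 * Z.Z.act (fun y => (σ y : ℂ)) x := by
  have h0 := θ.levi_ne_zero Z hx
  have he := Complex.exp_ne_zero (σ x : ℂ)
  rw [connZ, θ.connZbar_rescale Z σ hσ hx, θ.act_levi_rescale Z σ hσ hx, θ.levi_rescale Z σ hσ hx,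
    map_sub, conj_act_Zbar_ofReal Z σ hσ hx, connZ]
  field_simp
  ring

theorem connT_rescale : (θ.rescale σ hσ).connT Z x =
    starRingEnd ℂ (θ.reebShift Z σ x) * θ.connZbar Z x + Complex.exp (-(σ x : ℂ)) * θ.connT Z x
      - Z.Z.act (θ.reebShift Z σ) x := by
  rw [connT, θ.coframe_rescale_app_bracket_reeb Z σ hσ hx Z.smooth fun y hy => θ.formC_app_Z Z hy,
    CForm.app_bracket_self, connZbar, connT]
  ring

/-- Torsion is read off from [T̂, Z̄], where Z̄ differentiates the shift q, itself a multiple of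
Z̄σ. After conjugation this is the second derivative ∇₁∇₁σ together with −(∇₁σ)². -/
theorem torsion_rescale : (θ.rescale σ hσ).torsion Z x = θ.torsion Z x + Complex.I *
    (θ.nablaDown Z 1 (θ.nablaDown Z 0 fun y => (σ y : ℂ)) x
      - θ.nablaDown Z 0 (fun y => (σ y : ℂ)) x ^ 2) := by
  have h0 := θ.levi_ne_zero Z hx
  have he := Complex.exp_ne_zero (σ x : ℂ)
  have h1 : starRingEnd ℂ (Z.Z.conj.act (Z.Z.conj.act fun y => (σ y : ℂ)) x) =
      Z.Z.act (Z.Z.act fun y => (σ y : ℂ)) x := by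
    rw [← act_Z_conj Z (Z.smooth.conj.act Z.isOpen (smoothFunOn_of_contMDiff σ hσ _)) hx]
    exact act_congr_on _ Z.isOpen (fun y hy => conj_act_Zbar_ofReal Z σ hσ hy) hx
  have h2 : starRingEnd ℂ (Z.Z.conj.act (θ.levi Z) x) = Z.Z.act (θ.levi Z) x := by
    rw [θ.act_Zbar_levi Z hx, Complex.conj_conj]
  rw [torsion, θ.coframe_rescale_app_bracket_reeb Z σ hσ hx Z.smooth.conj fun y hy =>
    θ.formC_app_Zbar Z hy, CForm.app_bracket_self, θ.act_reebShift Z σ hσ hx, θ.levi_rescale Z σ hσ hx,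
    CForm.app_bracket_swap _ Z.Z, ← connZbar, nablaDown_zero, nablaDown, θ.conn_app_Z Z hx, torsion]
  simp only [map_add, map_sub, map_mul, map_neg, map_inv₀, θ.conj_reebShift Z σ hσ hx, h1, h2,
    Complex.conj_I, θ.conj_levi Z hx, conj_act_Zbar_ofReal Z σ hσ hx, ← Complex.exp_conj,
    Complex.conj_ofReal, θ.act_Z_levi Z hx, Complex.exp_neg, map_zero]
  field_simp
  push_cast
  ring

theorem torsionUp_rescale : (θ.rescale σ hσ).torsionUp Z x = Complex.exp (-(σ x : ℂ)) ^ 2 *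
    (θ.torsionUp Z x - Complex.I * (θ.nablaUp Z (-1) (θ.nablaUp Z 0 fun y => (σ y : ℂ)) x
      - θ.nablaUp Z 0 (fun y => (σ y : ℂ)) x ^ 2)) := by
  have h0 := θ.levi_ne_zero Z hx
  have he := Complex.exp_ne_zero (σ x : ℂ)
  have sD := θ.smoothFunOn_nablaDown Z (smoothFunOn_of_contMDiff σ hσ Z.U) 0
  have e1 : ∀ y ∈ Z.U, (θ.levi Z y)⁻¹ ^ 1 * starRingEnd ℂ (θ.nablaDown Z 0 (fun y => (σ y : ℂ)) y) =
      θ.nablaUp Z 0 (fun y => (σ y : ℂ)) y := fun y hy => by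
    have h0 := θ.levi_ne_zero Z hy
    rw [θ.conj_nablaDown_ofReal Z hy hσ.contMDiffOn]
    field_simp
  have h1 := θ.nablaUp_conj Z sD hx 1
  rw [Nat.cast_one, θ.nablaUp_congr Z (-1) e1 hx] at h1
  rw [h1, ← e1 x hx, torsionUp, θ.torsion_rescale Z σ hσ hx, θ.levi_rescale Z σ hσ hx, torsionUp,
    Complex.exp_neg]
  simp only [map_add, map_sub, map_mul, map_pow, Complex.conj_I, Nat.reduceAdd]
  field_simp
  ring

/-- All three components of ω change: those along Z and Z̄ by derivatives of σ, and that along T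
through Zq. The second derivatives combine to −2(∇¹∇₁σ + ∇₁∇¹σ). -/
theorem scalarCurv_rescale : (θ.rescale σ hσ).scalarCurv Z x = Complex.exp (-(σ x : ℂ)) *
    (θ.scalarCurv Z x - 2 * (θ.nablaUp Z 1 (θ.nablaDown Z 0 fun y => (σ y : ℂ)) x
      + θ.nablaDown Z (-1) (θ.nablaUp Z 0 fun y => (σ y : ℂ)) x)
      - 2 * (θ.nablaDown Z 0 (fun y => (σ y : ℂ)) x * θ.nablaUp Z 0 (fun y => (σ y : ℂ)) x)) := by
  have h0 := θ.levi_ne_zero Z hx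
  have he := Complex.exp_ne_zero (σ x : ℂ)
  have m : ∀ {u : M → ℂ}, SmoothFunOn u Z.U → MDifferentiableAt (𝓡 3) 𝓘(ℝ, ℂ) u x :=
    fun hu => hu.mdifferentiableAt Z.isOpen hx
  have ss := smoothFunOn_of_contMDiff σ hσ Z.U
  have s1 := Z.smooth.conj.act Z.isOpen ss
  have s2 := Z.smooth.act Z.isOpen ss
  have s3 := θ.smoothFunOn_levi_inv Z
  have di : Z.Z.act (fun y => (θ.levi Z y)⁻¹) x = -(θ.levi Z x ^ 2)⁻¹ * Z.Z.act (θ.levi Z) x :=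
    Z.Z.act_comp (hasDerivAt_inv h0) (m (θ.smoothFunOn_levi Z))
  have e1 : Z.Z.act ((θ.rescale σ hσ).connZbar Z) x = Z.Z.act (θ.connZbar Z) x
      + -1 * Z.Z.act (Z.Z.conj.act fun y => (σ y : ℂ)) x := by
    rw [act_congr_on _ Z.isOpen (v := fun y => θ.connZbar Z y + -1 * Z.Z.conj.act (fun y => (σ y : ℂ)) y)
      (fun y hy => by rw [θ.connZbar_rescale Z σ hσ hy]; ring) hx,
      Z.Z.act_add (m (θ.smoothFunOn_connZbar Z)) (m ((SmoothFunOn.const _ _).mul s1)),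
      Z.Z.act_mul (m (SmoothFunOn.const _ _)) (m s1), Z.Z.act_const]
    ring
  have e2 : Z.Z.conj.act ((θ.rescale σ hσ).connZ Z) x = Z.Z.conj.act (θ.connZ Z) x
      + 2 * Z.Z.conj.act (Z.Z.act fun y => (σ y : ℂ)) x := by
    rw [act_congr_on _ Z.isOpen (fun y hy => θ.connZ_rescale Z σ hσ hy) hx,
      CField.act_add _ (m (θ.smoothFunOn_connZ Z)) (m ((SmoothFunOn.const _ _).mul s2)),
      CField.act_mul _ (m (SmoothFunOn.const _ _)) (m s2), CField.act_const]
    ring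
  rw [scalarCurv_eq _ Z hx, e1, e2, θ.connZ_rescale Z σ hσ hx, θ.connZbar_rescale Z σ hσ hx,
    θ.connT_rescale Z σ hσ hx, θ.levi_rescale Z σ hσ hx, θ.act_reebShift Z σ hσ hx,
    θ.conj_reebShift Z σ hσ hx, map_sub, conj_act_Zbar_ofReal Z σ hσ hx, θ.scalarCurv_eq Z hx,
    nablaDown_zero, nablaUp_zero, nablaUp, nablaDown, Z.Z.act_mul (m s3) (m s1), di,
    θ.conn_app_Z Z hx, θ.conn_app_Zbar Z hx, θ.act_Z_levi Z hx, Complex.exp_neg]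
  field_simp
  push_cast
  ring_nf
  simp only [Complex.I_sq]
  ring

variable (p : ℤ) (τ : M → ℂ)

theorem nablaDown_rescale : (θ.rescale σ hσ).nablaDown Z p τ x = θ.nablaDown Z p τ x
    - 2 * (θ.nablaDown Z 0 (fun y => (σ y : ℂ)) x * (p * τ x)) := by
  rw [nablaDown_zero, nablaDown, nablaDown, conn_app_Z _ Z hx, conn_app_Z _ Z hx,
    θ.connZ_rescale Z σ hσ hx]
  ring

theorem nablaUp_rescale : (θ.rescale σ hσ).nablaUp Z p τ x = Complex.exp (-(σ x : ℂ)) *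
    (θ.nablaUp Z p τ x + θ.nablaUp Z 0 (fun y => (σ y : ℂ)) x * (p * τ x)) := by
  have h0 := θ.levi_ne_zero Z hx
  have he := Complex.exp_ne_zero (σ x : ℂ)
  rw [nablaUp_zero, nablaUp, nablaUp, conn_app_Zbar _ Z hx, conn_app_Zbar _ Z hx,
    θ.connZbar_rescale Z σ hσ hx, θ.levi_rescale Z σ hσ hx, Complex.exp_neg]
  field_simp
  ring

end

end ContactForm

end CRGeometry
end

/-! ### Part: the transformation law of the P'-operator. -/

open scoped Manifold ContDiff
noncomputable section
namespace CRGeometry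

open Topology LaurentPolynomial smoothFun

variable {M : Type*} [TopologicalSpace M] [ChartedSpace E3 M] [IsManifold (𝓡 3) ∞ M]
  {S : CRStructure M}

theorem tens_induction {U : Set M} {P : (smoothFun U)[T;T⁻¹] → Prop}
    (hadd : ∀ x y, P x → P y → P (x + y)) (htens : ∀ p u hu, P (tens p u hu)) (x) : P x := by
  refine LaurentPolynomial.induction_on' x hadd fun n a => ?_
  rw [← LaurentPolynomial.single_eq_C_mul_T, ← restrict_extend a]
  exact htens n (extend a) _

namespace ContactForm

variable (θ : ContactForm S) (Z : S.Frame) (σ : M → ℝ) (hσ : ContMDiff (𝓡 3) 𝓘(ℝ, ℝ) ∞ σ)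
  [T2Space M]

/-- Since ω̂(Z) = ω(Z) + 2Zσ, a tensor of degree p picks up −2p ∇₁σ, and multiplication by p is
`dDegree`. This is the form in which `prime_rescale` takes the new derivations. -/
theorem dDown_rescale (t : (smoothFun Z.U)[T;T⁻¹]) : (θ.rescale σ hσ).dDown Z t = θ.dDown Z t
    - 2 * (θ.dDown Z (tens 0 _ (smoothFunOn_of_contMDiff σ hσ Z.U)) * dDegree Z t) := by
  induction t using tens_induction with
  | hadd x y hx hy => simp only [map_add, hx, hy]; ring
  | htens p u hu =>
    simp only [dDown_tens, dDegree_tens, tens_mul, ofNat_mul_tens]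
    rw [show (0 : ℤ) + 1 + p = p + 1 by ring, tens_sub, tens_inj]
    exact fun x hx => θ.nablaDown_rescale Z σ hσ hx p u

theorem dUp_rescale (t : (smoothFun Z.U)[T;T⁻¹]) : (θ.rescale σ hσ).dUp Z t =
    tens 0 _ (smoothFunOn_exp_neg σ hσ Z.U) * (θ.dUp Z t
      + θ.dUp Z (tens 0 _ (smoothFunOn_of_contMDiff σ hσ Z.U)) * dDegree Z t) := by
  induction t using tens_induction with
  | hadd x y hx hy => simp only [map_add, hx, hy]; ring
  | htens p u hu =>
    simp only [dUp_tens, dDegree_tens, tens_mul]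
    rw [show (0 : ℤ) + -1 + p = p + -1 by ring, tens_add, tens_mul,
      show (0 : ℤ) + (p + -1) = p + -1 by ring, tens_inj]
    exact fun x hx => θ.nablaUp_rescale Z σ hσ hx p u

variable {f : M → ℝ} (hf : ContMDiff (𝓡 3) 𝓘(ℝ, ℝ) ∞ f) {x : M} (hx : x ∈ Z.U)
include hf hx

/-- The transformation law in a fixed frame, for complexified operators. -/
theorem primeC_rescale : (θ.rescale σ hσ).primeC Z (fun y => (f y : ℂ)) x =
    Complex.exp (-(σ x : ℂ)) * (Complex.exp (-(σ x : ℂ)) * (θ.primeC Z (fun y => (f y : ℂ)) x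
      + 3 * θ.paneitzC Z (fun y => (f y : ℂ) * σ y) x
      - 3 * (σ x * θ.paneitzC Z (fun y => (f y : ℂ)) x)
      - 24 * (θ.thirdC Z (fun y => (f y : ℂ)) x * θ.nablaUp Z 0 (fun y => (σ y : ℂ)) x
        + θ.thirdConj Z (fun y => (f y : ℂ)) x * θ.nablaDown Z 0 (fun y => (σ y : ℂ)) x))) := by
  have sf := smoothFunOn_of_contMDiff f hf Z.U
  have ss := smoothFunOn_of_contMDiff σ hσ Z.U
  have se := smoothFunOn_exp_neg σ hσ Z.U
  -- The abstract identity is specialized to monomials: f, σ and e^{−σ} in degree 0, and the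
  -- rescaled R, A₁₁, A^{11} in degrees 0, 2, −2. The side goals are the change formulas of the
  -- preceding part.
  have H := (θ.websterCalculus Z).prime_rescale (f := tens 0 _ sf) (s := tens 0 _ ss)
    (E := tens 0 _ se) (D' := (θ.rescale σ hσ).dDown Z) (U' := (θ.rescale σ hσ).dUp Z)
    (R' := tens 0 _ ((θ.rescale σ hσ).smoothFunOn_scalarCurv Z))
    (A₁ := tens 2 _ ((θ.rescale σ hσ).smoothFunOn_torsion Z))
    (A₂ := tens (-2) _ ((θ.rescale σ hσ).smoothFunOn_torsionUp Z))
    (dDegree_tens_zero Z _) (dDegree_tens_zero Z _) (dDegree_tens_zero Z _)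
    (by
      simp only [dDown_tens, tens_mul, tens_neg, Int.reduceAdd]
      rw [tens_inj]
      intro y _
      rw [nablaDown_zero, nablaDown_zero, act_exp_neg σ hσ])
    (by
      simp only [dUp_tens, tens_mul, tens_neg, Int.reduceAdd, Int.reduceNeg]
      rw [tens_inj]
      intro y _
      simp only [nablaUp_zero, act_exp_neg σ hσ]
      ring)
    (θ.dDown_rescale Z σ hσ) (θ.dUp_rescale Z σ hσ)
    (by
      simp only [dDown_tens, dUp_tens, tens_mul, tens_add, tens_sub, ofNat_mul_tens, Int.reduceAdd,
        Int.reduceNeg]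
      rw [tens_inj]
      exact fun y hy => θ.scalarCurv_rescale Z σ hσ hy)
    (by
      simp only [pow_two, dDown_tens, tens_mul, tens_add, tens_sub, imUnit_mul_tens, Int.reduceAdd]
      rw [tens_inj]
      intro y hy
      rw [θ.torsion_rescale Z σ hσ hy, pow_two])
    (by
      simp only [pow_two, dUp_tens, tens_mul, tens_sub, imUnit_mul_tens, Int.reduceAdd,
        Int.reduceNeg]
      rw [tens_inj]
      intro y hy
      rw [θ.torsionUp_rescale Z σ hσ hy, pow_two, pow_two])
  obtain ⟨h1, e1⟩ := (θ.rescale σ hσ).prime_tens Z sf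
  obtain ⟨h2, e2⟩ := θ.prime_tens Z sf
  obtain ⟨h3, e3⟩ := θ.paneitz_tens Z sf
  obtain ⟨h4, e4⟩ := θ.paneitz_tens Z (sf.mul ss)
  obtain ⟨h5, e5⟩ := θ.third_tens Z sf
  obtain ⟨h6, e6⟩ := θ.thirdConj_tens Z sf
  rw [e1, e2, e3, tens_mul] at H
  simp only [zero_add] at H
  rw [e4, e5, e6] at H
  simp only [pow_two, dDown_tens, dUp_tens, tens_mul, tens_add, tens_sub, ofNat_mul_tens, Int.reduceAdd, Int.reduceNeg] at H
  -- Both sides are now single monomials of degree 0, so the identity holds for the coefficient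
  -- functions.
  rw [(tens_inj _ _ _).1 H x hx]
  ring

/-- The transformation law of the `P'`-operator in a fixed frame. -/
theorem paneitzPrime_rescale_frame : Real.exp (2 * σ x) * (θ.rescale σ hσ).paneitzPrime Z f x =
    θ.paneitzPrime Z f x + θ.paneitz Z (fun y => f y * σ y) x - σ x * θ.paneitz Z f x
      - 16 * (θ.thirdOrderPairing Z f σ x).re := by
  have h := θ.primeC_rescale Z σ hσ hf hx
  have h4 := θ.ofReal_paneitz Z (f := fun y => f y * σ y) hx (hf.mul hσ).contMDiffOn
  simp only [Complex.ofReal_mul] at h4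
  rw [← ofReal_paneitzPrime _ Z hx hf.contMDiffOn, ← θ.ofReal_paneitzPrime Z hx hf.contMDiffOn,
    ← θ.ofReal_re_thirdOrderPairing Z hx hf.contMDiffOn hσ.contMDiffOn, ← h4,
    ← θ.ofReal_paneitz Z hx hf.contMDiffOn, ← Complex.ofReal_neg, ← Complex.ofReal_exp] at h
  have h' : 3 * (θ.rescale σ hσ).paneitzPrime Z f x = Real.exp (-σ x) * (Real.exp (-σ x) *
      (3 * θ.paneitzPrime Z f x + 3 * θ.paneitz Z (fun y => f y * σ y) x
        - 3 * (σ x * θ.paneitz Z f x) - 24 * (2 * (θ.thirdOrderPairing Z f σ x).re))) := by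
    exact_mod_cast h
  have he : Real.exp (2 * σ x) * (Real.exp (-σ x) * Real.exp (-σ x)) = 1 := by
    rw [← Real.exp_add, ← Real.exp_add]
    ring_nf
    exact Real.exp_zero
  linear_combination (Real.exp (2 * σ x) / 3) * h' + (θ.paneitzPrime Z f x
    + θ.paneitz Z (fun y => f y * σ y) x - σ x * θ.paneitz Z f x
      - 16 * (θ.thirdOrderPairing Z f σ x).re) * he

/-- The transformation law of the `P'`-operator. -/
theorem paneitzPrime_rescale {Z' : S.Frame} (hx' : x ∈ Z'.U) :
    Real.exp (2 * σ x) * (θ.rescale σ hσ).paneitzPrime Z' f x =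
    θ.paneitzPrime Z f x + θ.paneitz Z (fun y => f y * σ y) x - σ x * θ.paneitz Z f x
      - 16 * (θ.thirdOrderPairing Z f σ x).re := by
  rw [paneitzPrime_eq_of_frames (Z := Z) _ hf hx hx', θ.paneitzPrime_rescale_frame Z σ hσ hf hx]

end ContactForm

end CRGeometry
end

/-! ### Part: coordinate fields and the Poincaré lemma. -/

open scoped Manifold ContDiff
noncomputable section
namespace CRGeometry

open Topology LaurentPolynomial smoothFun VectorField

variable {M : Type*} [TopologicalSpace M] [ChartedSpace E3 M] [IsManifold (𝓡 3) ∞ M]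
  {S : CRStructure M}

section coordField

/-- The coordinate vector field of the chart at `p` in the direction `e`. -/
def coordField (p : M) (e : E3) : ∀ x : M, TangentSpace (𝓡 3) x :=
  mpullback (𝓡 3) 𝓘(ℝ, E3) (extChartAt (𝓡 3) p) (fun _ => e)

theorem mdifferentiableAt_const_field (e y : E3) :
    MDifferentiableAt 𝓘(ℝ, E3) 𝓘(ℝ, E3).tangent
      (fun y : E3 => (⟨y, e⟩ : TangentBundle 𝓘(ℝ, E3) E3)) y :=
  (contMDiffAt_vectorSpace_iff_contDiffAt (n := 1).2 contDiffAt_const).mdifferentiableAt one_ne_zero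

theorem contMDiffAt_extChartAt_of_mem {p x : M} (hx : x ∈ (chartAt E3 p).source) :
    ContMDiffAt (𝓡 3) 𝓘(ℝ, E3) ∞ (extChartAt (𝓡 3) p) x :=
  (contMDiffOn_extChartAt (x := p)).contMDiffAt ((chartAt E3 p).open_source.mem_nhds hx)

theorem smoothFieldOn_coordField (p : M) (e : E3) :
    SmoothFieldOn (coordField p e) (chartAt E3 p).source := fun x hx => by
  have : IsManifold (𝓡 3) ((⊤ : ℕ∞) + 1 : WithTop ℕ∞) M := by simpa
  have hc : ContMDiffAt 𝓘(ℝ, E3) 𝓘(ℝ, E3).tangent (⊤ : ℕ∞)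
      (fun y : E3 => (⟨y, e⟩ : TangentBundle 𝓘(ℝ, E3) E3)) (extChartAt (𝓡 3) p x) :=
    contMDiffAt_vectorSpace_iff_contDiffAt.2 contDiffAt_const
  exact (ContMDiffAt.mpullback_vectorField_preimage hc (contMDiffAt_extChartAt_of_mem hx)
    (isInvertible_mfderiv_extChartAt (by rwa [extChartAt_source])) (by simp)).contMDiffWithinAt

theorem mlieBracket_eq_lieBracketWithin_univ (V W : ∀ y : E3, TangentSpace 𝓘(ℝ, E3) y) :
    mlieBracket 𝓘(ℝ, E3) V W = lieBracketWithin ℝ V W Set.univ := by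
  rw [← mlieBracketWithin_eq_lieBracketWithin, mlieBracketWithin_univ]

/-- Pullback commutes with brackets, and constant fields on the model space commute. -/
theorem mlieBracket_coordField {p x : M} (hx : x ∈ (chartAt E3 p).source) (e e' : E3) :
    mlieBracket (𝓡 3) (coordField p e) (coordField p e') x = 0 := by
  have : IsManifold (𝓡 3) (minSmoothness ℝ 2) M :=
    IsManifold.of_le (n := ∞) (by simpa using order_le 2)
  have h := mpullback_mlieBracket (mdifferentiableAt_const_field e (extChartAt (𝓡 3) p x))
    (mdifferentiableAt_const_field e' (extChartAt (𝓡 3) p x))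
    ((contMDiffAt_extChartAt_of_mem hx).of_le (m := minSmoothness ℝ 2) (by simpa using order_le 2)) le_rfl
  have h0 : lieBracketWithin ℝ (fun _ : E3 => e) (fun _ : E3 => e') Set.univ
      (extChartAt (𝓡 3) p x) = 0 := by
    simp [lieBracketWithin]
  have h1 := congrFun (mlieBracket_eq_lieBracketWithin_univ (fun _ => e) fun _ => e')
    (extChartAt (𝓡 3) p x)
  exact h.symm.trans ((congrArg _ (h1.trans h0)).trans (map_zero _))

end coordField

theorem dForm_ofReal {φ : CForm M} {X Y : ∀ x : M, TangentSpace (𝓡 3) x} {x : M} :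
    dForm φ (CField.ofReal X) (CField.ofReal Y) x = dFun (fun y => φ y (Y y)) x (X x)
      - dFun (fun y => φ y (X y)) x (Y x) - φ x (mlieBracket (𝓡 3) X Y x) := by
  have e : ∀ X : ∀ x : M, TangentSpace (𝓡 3) x, φ.app (CField.ofReal X) = fun y => φ y (X y) :=
    fun X => by
      funext y
      simp [CForm.app, CField.ofReal]
  have h1 : mlieBracket (𝓡 3) X (fun _ => 0) x = 0 := congrFun mlieBracket_zero_right x
  have h2 : mlieBracket (𝓡 3) (fun _ => 0) Y x = 0 := congrFun mlieBracket_zero_left x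
  rw [dForm, e, e]
  simp [CField.act, CForm.app, CField.ofReal, CField.bracket, h1, h2]

/-- The Poincaré lemma for complex valued one-forms. -/
theorem exists_primitive {φ : CForm M} {U : Set M} (hU : IsOpen U) {p : M} (hp : p ∈ U)
    (hs : ∀ (O : Set M) (X : ∀ x : M, TangentSpace (𝓡 3) x), IsOpen O → O ⊆ U → SmoothFieldOn X O →
      SmoothFunOn (fun x => φ x (X x)) O)
    (hc : ∀ (O : Set M) (X Y : ∀ x : M, TangentSpace (𝓡 3) x), IsOpen O → O ⊆ U → SmoothFieldOn X O →
      SmoothFieldOn Y O → ∀ x ∈ O, dForm φ (CField.ofReal X) (CField.ofReal Y) x = 0) :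
    ∃ (O : Set M) (g : M → ℂ), IsOpen O ∧ p ∈ O ∧ O ⊆ U ∧ SmoothFunOn g O ∧
      ∀ x ∈ O, dFun g x = φ x := by
  set c := extChartAt (𝓡 3) p with hcdef
  have hopen : IsOpen (c.target ∩ c.symm ⁻¹' U) :=
    (continuousOn_extChartAt_symm p).isOpen_inter_preimage (isOpen_extChartAt_target p) hU
  have hcp : c p ∈ c.target ∩ c.symm ⁻¹' U :=
    ⟨mem_extChartAt_target p, by simpa [hcdef] using hp⟩
  -- A ball in the chart is chosen for its convexity; `O` is the corresponding neighbourhood in M.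
  obtain ⟨r, hr, hB⟩ := Metric.isOpen_iff.1 hopen _ hcp
  set B := Metric.ball (c p) r
  set O := (chartAt E3 p).source ∩ c ⁻¹' B
  have hO : IsOpen O := isOpen_extChartAt_preimage p Metric.isOpen_ball
  have hOs : O ⊆ (chartAt E3 p).source := Set.inter_subset_left
  have src : ∀ {x}, x ∈ O → x ∈ c.source := fun hx => by rw [hcdef, extChartAt_source]; exact hOs hx
  have hOU : O ⊆ U := fun x hx => by
    have := (hB hx.2).2
    rwa [Set.mem_preimage, c.left_inv (src hx)] at this
  have hBO : ∀ {y}, y ∈ B → c.symm y ∈ O := fun {y} hy =>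
    ⟨by rw [← extChartAt_source (𝓡 3)]; exact c.map_target (hB hy).1,
      by rwa [Set.mem_preimage, c.right_inv (hB hy).1]⟩
  have hX : ∀ e, SmoothFieldOn (coordField p e) O := fun e => (smoothFieldOn_coordField p e).mono hOs
  have hsymm : ContMDiffOn 𝓘(ℝ, E3) (𝓡 3) ∞ c.symm B :=
    (contMDiffOn_extChartAt_symm p).mono fun y hy => (hB hy).1
  have smooth : ∀ {u : M → ℂ}, SmoothFunOn u O → ContDiffOn ℝ ∞ (fun y => u (c.symm y)) B := fun hu =>
    contMDiffOn_iff_contDiffOn.1 (ContMDiffOn.comp hu hsymm fun y hy => hBO hy)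
  have deriv : ∀ {u : M → ℂ}, SmoothFunOn u O → ∀ y ∈ B, ∀ e : E3,
      fderiv ℝ (fun y => u (c.symm y)) y e = dFun u (c.symm y) (coordField p e (c.symm y)) := by
    intro u hu y hy e
    have hx := hBO hy
    have h1 := hasMFDerivAt_dFun (hu.mdifferentiableAt hO hx)
    have hd : DifferentiableAt ℝ (fun y => u (c.symm y)) y :=
      ((smooth hu).differentiableOn (by simp)).differentiableAt (Metric.isOpen_ball.mem_nhds hy)
    have h2 := hd.hasFDerivAt.hasMFDerivAt
    have h3 := (mdifferentiableAt_extChartAt (I := 𝓡 3) (hOs hx)).hasMFDerivAt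
    have h4 : HasMFDerivAt 𝓘(ℝ, E3) 𝓘(ℝ, ℂ) (fun y => u (c.symm y)) (c (c.symm y))
        (fderiv ℝ (fun y => u (c.symm y)) y) := by rwa [c.right_inv (hB hy).1]
    have h5 := h4.comp (c.symm y) h3
    have h6 : (fun y => u (c.symm y)) ∘ c =ᶠ[𝓝 (c.symm y)] u := by
      filter_upwards [hO.mem_nhds hx] with z hz
      simp [c.left_inv (src hz)]
    have h7 := hasMFDerivAt_unique (h1.congr_of_eventuallyEq h6) h5
    rw [h7]
    have hinv := isInvertible_mfderiv_extChartAt (I := 𝓡 3) (src hx)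
    change _ = fderiv ℝ (fun y => u (c.symm y)) y (mfderiv (𝓡 3) 𝓘(ℝ, E3) c (c.symm y)
      ((mfderiv (𝓡 3) 𝓘(ℝ, E3) c (c.symm y)).inverse e))
    congr 1
    exact (hinv.inverse_apply_eq.1 rfl)
  -- φ read in the chart. Its value on a constant vector e is φ on the coordinate field of e.
  let Ω : E3 → E3 →L[ℝ] ℂ := fun y =>
    (φ (c.symm y)).comp (mfderiv (𝓡 3) 𝓘(ℝ, E3) c (c.symm y)).inverse
  have hΩ : ∀ e y, Ω y e = φ (c.symm y) (coordField p e (c.symm y)) := fun e y => rfl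
  have sΩ : ContDiffOn ℝ ∞ Ω B := contDiffOn_clm_apply.2 fun e =>
    smooth (hs O _ hO hOU (hX e))
  have dΩ : DifferentiableOn ℝ Ω B := sΩ.differentiableOn (by simp)
  -- Coordinate fields have vanishing bracket, so closedness of φ on them is exactly the symmetry of
  -- the derivative of `Ω`.
  obtain ⟨G, hG⟩ := (convex_ball (c p) r).exists_forall_hasFDerivAt_of_fderiv_symmetric
    Metric.isOpen_ball dΩ fun y hy a b => by
      have hd := dΩ.differentiableAt (Metric.isOpen_ball.mem_nhds hy)
      have e1 : ∀ a b, fderiv ℝ Ω y a b = dFun (fun x => φ x (coordField p b x)) (c.symm y)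
          (coordField p a (c.symm y)) := fun a b => by
        rw [← deriv (hs O _ hO hOU (hX b)) y hy]
        change _ = fderiv ℝ (fun y => Ω y b) y a
        rw [fderiv_clm_apply hd (differentiableAt_const b)]
        simp
      have h := hc O _ _ hO hOU (hX a) (hX b) _ (hBO hy)
      rw [dForm_ofReal, mlieBracket_coordField (hOs (hBO hy)), map_zero, sub_zero] at h
      rw [e1, e1]
      exact sub_eq_zero.1 h
  have sG : ContDiffOn ℝ ∞ G B := (contDiffOn_infty_iff_fderiv_of_isOpen Metric.isOpen_ball).2
    ⟨fun y hy => (hG y hy).differentiableAt.differentiableWithinAt,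
      sΩ.congr fun y hy => (hG y hy).fderiv⟩
  refine ⟨O, fun x => G (c x), hO, ⟨mem_chart_source E3 p, Metric.mem_ball_self hr⟩, hOU,
    (contMDiffOn_iff_contDiffOn.2 sG).comp ((contMDiffOn_extChartAt (x := p)).mono hOs)
      fun x hx => hx.2, fun x hx => ?_⟩
  have h3 := (mdifferentiableAt_extChartAt (I := 𝓡 3) (hOs hx)).hasMFDerivAt
  have h5 := (hG _ hx.2).hasMFDerivAt.comp x h3
  refine h5.mfderiv.trans ?_
  have hinv := isInvertible_mfderiv_extChartAt (I := 𝓡 3) (src hx)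
  ext w
  change φ (c.symm (c x)) ((mfderiv (𝓡 3) 𝓘(ℝ, E3) c (c.symm (c x))).inverse
    (mfderiv (𝓡 3) 𝓘(ℝ, E3) c x w)) = φ x w
  rw [c.left_inv (src hx), hinv.inverse_apply_eq.2 rfl]

end CRGeometry
end

/-! ### Part: one-forms and their exterior derivatives in an admissible coframe. -/

open scoped Manifold ContDiff
noncomputable section
namespace CRGeometry

open Topology LaurentPolynomial smoothFun VectorField

variable {M : Type*} [TopologicalSpace M] [ChartedSpace E3 M] [IsManifold (𝓡 3) ∞ M]
  {S : CRStructure M}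

theorem tens_eq_zero {U : Set M} {u : M → ℂ} (hu : SmoothFunOn u U) (p : ℤ) :
    tens p u hu = 0 ↔ ∀ x ∈ U, u x = 0 := by
  have z : tens p (fun _ => 0) (SmoothFunOn.const 0 U) = 0 := by
    rw [← sub_self (tens p _ (SmoothFunOn.const 0 U)), tens_sub, tens_inj]
    simp
  rw [← z, tens_inj]

theorem dForm_swap (φ : CForm M) (V W : CField M) (x : M) : dForm φ V W x = -dForm φ W V x := by
  rw [dForm, dForm, φ.app_bracket_swap]
  ring

theorem dForm_self (φ : CForm M) (V : CField M) (x : M) : dForm φ V V x = 0 := by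
  have h := dForm_swap φ V V x
  linear_combination h / 2

namespace ContactForm

variable (θ : ContactForm S) (Z : S.Frame)

theorem smoothFunOn_app {φ : CForm M} (h₁ : SmoothFunOn (φ.app Z.Z) Z.U)
    (h₂ : SmoothFunOn (φ.app Z.Z.conj) Z.U) (h₃ : SmoothFunOn (φ.app θ.reeb) Z.U) {O : Set M}
    (hO : IsOpen O) (hOZ : O ⊆ Z.U) {V : CField M} (hV : V.SmoothOn O) : SmoothFunOn (φ.app V) O := by
  refine ContMDiffOn.congr ?_ fun x hx => θ.app_decomp Z φ V (hOZ hx)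
  exact (((θ.smoothFunOn_coframe_app Z hO hOZ hV).mul (h₁.mono hOZ)).add
    ((θ.smoothFunOn_coframe_app Z hO hOZ hV.conj).conj.mul (h₂.mono hOZ))).add
      ((θ.smoothFunOn_formC_app hV).mul (h₃.mono hOZ))

variable [T2Space M]

/-- The exterior derivative is determined by its values on a frame. -/
theorem dForm_decomp {φ : CForm M} (h₁ : SmoothFunOn (φ.app Z.Z) Z.U)
    (h₂ : SmoothFunOn (φ.app Z.Z.conj) Z.U) (h₃ : SmoothFunOn (φ.app θ.reeb) Z.U) {O : Set M}
    (hO : IsOpen O) (hOZ : O ⊆ Z.U) {V W : CField M} (hV : V.SmoothOn O) (hW : W.SmoothOn O) {x : M}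
    (hx : x ∈ O) : dForm φ V W x = (θ.coframe Z).app V x * dForm φ Z.Z W x
      + starRingEnd ℂ ((θ.coframe Z).app V.conj x) * dForm φ Z.Z.conj W x
      + θ.formC.app V x * dForm φ θ.reeb W x := by
  have s1 := θ.smoothFunOn_coframe_app Z hO hOZ hV
  have s2 := (θ.smoothFunOn_coframe_app Z hO hOZ hV.conj).conj
  have s3 := θ.smoothFunOn_formC_app hV
  have m : ∀ {u : M → ℂ}, SmoothFunOn u O → MDifferentiableAt (𝓡 3) 𝓘(ℝ, ℂ) u x :=
    fun hu => hu.mdifferentiableAt hO hx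
  have e1 := act_congr_on W hO (fun y hy => θ.app_decomp Z φ V (hOZ hy)) hx
  rw [W.act_add (m ((s1.mul (h₁.mono hOZ)).add (s2.mul (h₂.mono hOZ)))) (m (s3.mul (h₃.mono hOZ))),
    W.act_add (m (s1.mul (h₁.mono hOZ))) (m (s2.mul (h₂.mono hOZ))), W.act_mul (m s1) (m (h₁.mono hOZ)),
    W.act_mul (m s2) (m (h₂.mono hOZ)), W.act_mul (m s3) (m (h₃.mono hOZ))] at e1
  have e2 : V.act (φ.app W) x = _ := θ.app_decomp Z _ V (hOZ hx)
  rw [dForm, e1, e2, app_bracket_comb hO hV hW (Z.smooth.mono hOZ) (Z.smooth.conj.mono hOZ)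
    (θ.smoothOn_reeb O) s1 s2 s3 (fun y hy φ => θ.app_decomp Z φ V (hOZ hy)) hx]
  simp only [dForm, CField.act]
  ring

/-- The frame expansion is applied in both slots; antisymmetry reduces the nine components to three.
-/
theorem dForm_eq_zero_of_frame {φ : CForm M} (h₁ : SmoothFunOn (φ.app Z.Z) Z.U)
    (h₂ : SmoothFunOn (φ.app Z.Z.conj) Z.U) (h₃ : SmoothFunOn (φ.app θ.reeb) Z.U) {O : Set M}
    (hO : IsOpen O) (hOZ : O ⊆ Z.U) {V W : CField M} (hV : V.SmoothOn O) (hW : W.SmoothOn O) {x : M}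
    (hx : x ∈ O) (e₁ : dForm φ Z.Z Z.Z.conj x = 0) (e₂ : dForm φ θ.reeb Z.Z x = 0)
    (e₃ : dForm φ θ.reeb Z.Z.conj x = 0) : dForm φ V W x = 0 := by
  have key : ∀ {E : CField M}, E.SmoothOn O → dForm φ Z.Z E x = 0 → dForm φ Z.Z.conj E x = 0 →
      dForm φ θ.reeb E x = 0 → dForm φ E W x = 0 := fun hE a b c => by
    rw [dForm_swap, θ.dForm_decomp Z h₁ h₂ h₃ hO hOZ hW hE hx, a, b, c]
    ring
  have sz := Z.smooth.mono hOZ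
  rw [θ.dForm_decomp Z h₁ h₂ h₃ hO hOZ hV hW hx,
    key sz (dForm_self ..) (by rw [dForm_swap, e₁, neg_zero]) e₂, key sz.conj e₁ (dForm_self ..) e₃,
    key (θ.smoothOn_reeb O) (by rw [dForm_swap, e₂, neg_zero]) (by rw [dForm_swap, e₃, neg_zero])
      (dForm_self ..)]
  ring

/-- The one-form with given components in an admissible coframe. -/
def frameForm (α β γ : M → ℂ) : CForm M := fun x =>
  α x • θ.coframe Z x + β x • (θ.coframe Z).conj x + γ x • θ.formC x

section frameForm

variable (α β γ : M → ℂ) {x : M} (hx : x ∈ Z.U)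

omit [T2Space M]

theorem frameForm_app (V : CField M) : (θ.frameForm Z α β γ).app V x = α x * (θ.coframe Z).app V x
    + β x * starRingEnd ℂ ((θ.coframe Z).app V.conj x) + γ x * θ.formC.app V x := by
  rw [← CForm.app_conj, CField.conj_conj]
  simp only [CForm.app, frameForm, add_apply, smul_apply, smul_eq_mul]
  ring

include hx

theorem frameForm_app_Z : (θ.frameForm Z α β γ).app Z.Z x = α x := by
  rw [frameForm_app, θ.coframe_app_Z Z hx, θ.coframe_app_Zbar Z hx, θ.formC_app_Z Z hx]
  simp

theorem frameForm_app_Zbar : (θ.frameForm Z α β γ).app Z.Z.conj x = β x := by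
  rw [frameForm_app, θ.coframe_app_Zbar Z hx, CField.conj_conj, θ.coframe_app_Z Z hx,
    θ.formC_app_Zbar Z hx]
  simp

theorem frameForm_app_reeb : (θ.frameForm Z α β γ).app θ.reeb x = γ x := by
  rw [frameForm_app, reeb_conj, θ.coframe_app_reeb Z hx, θ.formC_app_reeb]
  simp

end frameForm

omit [T2Space M] in
theorem dReeb_tens {u : M → ℂ} (hu : SmoothFunOn u Z.U) (p : ℤ) : ∃ h, θ.dReeb Z (tens p u hu) =
    tens p (fun x => θ.reeb.act u x - p * θ.connT Z x * u x) h := by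
  have h : SmoothFunOn (fun x => θ.reeb.act u x - p * θ.connT Z x * u x) Z.U :=
    ((θ.smoothOn_reeb _).act Z.isOpen hu).sub
      (((SmoothFunOn.const _ _).mul (θ.smoothFunOn_connT Z)).mul hu)
  refine ⟨h, ?_⟩
  rw [dReeb, tens, laurentLift_single, tens, add_zero]
  congr 1
  refine eq_of_extend_eq fun x hx => ?_
  simp only [derT, CField.derivation_restrict, extend_add hx, extend_mul hx, extend_neg hx,
    extend_restrict _ hx, extend_intCast hx]
  ring

variable {f : M → ℝ}

/-- `closed_of_third_eq_zero` written in a frame; the ω(T) term appears because ∇₁f has degree 1. -/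
theorem reeb_act_of_third {x : M} (hx : x ∈ Z.U) (hf : ContMDiffOn (𝓡 3) 𝓘(ℝ, ℝ) ∞ f Z.U)
    (h0 : ∀ y ∈ Z.U, θ.thirdOrder Z f y = 0) :
    θ.reeb.act (fun y => -Complex.I * Z.Z.act (fun y => (f y : ℂ)) y) x
      + Complex.I * θ.connT Z x * Z.Z.act (fun y => (f y : ℂ)) x
      - Z.Z.act (θ.sublaplacian Z fun y => (f y : ℂ)) x
      + Complex.I * θ.torsion Z x * (θ.levi Z x)⁻¹ * Z.Z.conj.act (fun y => (f y : ℂ)) x = 0 := by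
  have sF : SmoothFunOn (fun y => (f y : ℂ)) Z.U := SmoothFunOn.ofReal hf
  obtain ⟨h1, e1⟩ := θ.third_tens Z sF
  have e2 : tens 1 (θ.thirdC Z fun y => (f y : ℂ)) h1 = 0 := (tens_eq_zero _ _).2 fun y hy => by
    rw [← θ.thirdOrder_eq Z hy hf, h0 y hy]
  have H := (θ.websterCalculus Z).closed_of_third_eq_zero (tens 0 _ sF) (dDegree_tens_zero Z _)
    (e1.trans e2)
  simp only [lap_tens, dDown_tens, dUp_tens, imUnit_mul_tens, tens_neg, tens_mul, zero_add,
    Int.reduceAdd, Int.reduceNeg] at H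
  obtain ⟨h3, e3⟩ := θ.dReeb_tens Z (((SmoothFunOn.const Complex.I _).mul
    (θ.smoothFunOn_nablaDown Z sF 0)).neg) 1
  rw [e3, tens_sub, tens_add, tens_eq_zero] at H
  have h := H x hx
  simp only [nablaDown_zero, nablaUp_zero] at h
  simp only [neg_mul]
  push_cast at h
  linear_combination h

end ContactForm

end CRGeometry
end

/-! ### Part: CR pluriharmonic functions are the solutions of P_α f = 0. -/

open scoped Manifold ContDiff
noncomputable section
namespace CRGeometry

open Topology LaurentPolynomial smoothFun VectorField

variable {M : Type*} [TopologicalSpace M] [ChartedSpace E3 M] [IsManifold (𝓡 3) ∞ M]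
  {S : CRStructure M}

namespace ContactForm

variable (θ : ContactForm S) (Z : S.Frame) {f : M → ℝ} {x : M} (hx : x ∈ Z.U)
  (hf : ContMDiffOn (𝓡 3) 𝓘(ℝ, ℝ) ∞ f Z.U)
include hx hf

theorem dFun_frame : ∃ P Q : ℝ, dFun (fun y => (f y : ℂ)) x (Z.Z.re x) = P ∧
    dFun (fun y => (f y : ℂ)) x (Z.Z.im x) = Q ∧
    Z.Z.act (fun y => (f y : ℂ)) x = P + Complex.I * Q ∧
    Z.Z.conj.act (fun y => (f y : ℂ)) x = P - Complex.I * Q := by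
  have m := mdifferentiableAt_of_smooth Z.isOpen hf hx
  refine ⟨_, _, dFun_ofReal m _, dFun_ofReal m _, ?_, ?_⟩
  · rw [CField.act, CForm.app, dFun_ofReal m, dFun_ofReal m]
  · rw [CField.act, CForm.app]
    change dFun (fun y => (f y : ℂ)) x (Z.Z.re x) + Complex.I * dFun (fun y => (f y : ℂ)) x (-Z.Z.im x) = _
    rw [map_neg, dFun_ofReal m, dFun_ofReal m]
    ring

/-- Needed for the (Z, Z̄) component of dη, with η = `conjForm`: it explains why Δ_b f is the right
θ-coefficient. -/
theorem levi_mul_sublaplacian : θ.levi Z x * θ.sublaplacian Z (fun y => (f y : ℂ)) x =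
    -(Z.Z.conj.act (Z.Z.act fun y => (f y : ℂ)) x - θ.connZbar Z x * Z.Z.act (fun y => (f y : ℂ)) x
      + Z.Z.act (Z.Z.conj.act fun y => (f y : ℂ)) x
      - starRingEnd ℂ (θ.connZbar Z x) * Z.Z.conj.act (fun y => (f y : ℂ)) x) := by
  have h0 := θ.levi_ne_zero Z hx
  have s1 := Z.smooth.conj.act Z.isOpen (SmoothFunOn.ofReal hf)
  have di : Z.Z.act (fun y => (θ.levi Z y)⁻¹) x = -(θ.levi Z x ^ 2)⁻¹ * Z.Z.act (θ.levi Z) x :=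
    Z.Z.act_comp (hasDerivAt_inv h0) ((θ.smoothFunOn_levi Z).mdifferentiableAt Z.isOpen hx)
  rw [sublaplacian, nablaDown_zero, nablaUp_zero, nablaUp, nablaDown, Z.Z.act_mul
    ((θ.smoothFunOn_levi_inv Z).mdifferentiableAt Z.isOpen hx) (s1.mdifferentiableAt Z.isOpen hx), di,
    θ.conn_app_Z Z hx, θ.conn_app_Zbar Z hx, θ.act_Z_levi Z hx]
  field_simp
  push_cast
  ring

omit hx

/-- The one-form `i (∂̄_b - ∂_b) f + (Δ_b f) θ`. -/
def conjForm (f : M → ℝ) : CForm M :=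
  θ.frameForm Z (fun y => -Complex.I * Z.Z.act (fun y => (f y : ℂ)) y)
    (fun y => Complex.I * Z.Z.conj.act (fun y => (f y : ℂ)) y) (θ.sublaplacian Z fun y => (f y : ℂ))

theorem smoothFunOn_conjForm_app {O : Set M} (hO : IsOpen O) (hOZ : O ⊆ Z.U) {V : CField M}
    (hV : V.SmoothOn O) : SmoothFunOn ((θ.conjForm Z f).app V) O := by
  have sF : SmoothFunOn (fun y => (f y : ℂ)) Z.U := SmoothFunOn.ofReal hf
  refine θ.smoothFunOn_app Z ?_ ?_ ?_ hO hOZ hV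
  · exact ContMDiffOn.congr ((SmoothFunOn.const _ _).mul (Z.smooth.act Z.isOpen sF))
      fun y hy => θ.frameForm_app_Z Z _ _ _ hy
  · exact ContMDiffOn.congr ((SmoothFunOn.const _ _).mul (Z.smooth.conj.act Z.isOpen sF))
      fun y hy => θ.frameForm_app_Zbar Z _ _ _ hy
  · exact ContMDiffOn.congr (θ.smoothFunOn_sublaplacian Z sF) fun y hy => θ.frameForm_app_reeb Z _ _ _ hy

/-- Only three components matter: (Z, Z̄) vanishes by the choice of the θ-coefficient, (T, Z) by P_α
f = 0, and (T, Z̄) is the conjugate of the latter. -/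
theorem dForm_conjForm [T2Space M] (h0 : ∀ y ∈ Z.U, θ.thirdOrder Z f y = 0) {O : Set M} (hO : IsOpen O)
    (hOZ : O ⊆ Z.U) {V W : CField M} (hV : V.SmoothOn O) (hW : W.SmoothOn O) (hx : x ∈ O) :
    dForm (θ.conjForm Z f) V W x = 0 := by
  have sF : SmoothFunOn (fun y => (f y : ℂ)) Z.U := SmoothFunOn.ofReal hf
  have hx' := hOZ hx
  have hl := θ.levi_ne_zero Z hx'
  have sZ := Z.smooth.act Z.isOpen sF
  have sZb := Z.smooth.conj.act Z.isOpen sF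
  have sL := θ.smoothFunOn_sublaplacian Z sF
  have m : ∀ {u : M → ℂ}, SmoothFunOn u Z.U → MDifferentiableAt (𝓡 3) 𝓘(ℝ, ℂ) u x :=
    fun hu => hu.mdifferentiableAt Z.isOpen hx'
  have a1 : ∀ y ∈ Z.U, (θ.conjForm Z f).app Z.Z y = _ := fun y hy => θ.frameForm_app_Z Z _ _ _ hy
  have a2 : ∀ y ∈ Z.U, (θ.conjForm Z f).app Z.Z.conj y = _ := fun y hy => θ.frameForm_app_Zbar Z _ _ _ hy
  have a3 : ∀ y ∈ Z.U, (θ.conjForm Z f).app θ.reeb y = _ := fun y hy => θ.frameForm_app_reeb Z _ _ _ hy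
  have cm : ∀ (V : CField M) (c : ℂ) {u : M → ℂ}, SmoothFunOn u Z.U →
      V.act (fun y => c * u y) x = c * V.act u x := fun V c u hu => by
    rw [V.act_mul (m (SmoothFunOn.const _ _)) (m hu), V.act_const]
    ring
  have h2 := θ.reeb_act_of_third Z hx' hf h0
  rw [cm _ _ sZ, θ.torsion_eq] at h2
  -- The (T, Z̄) equation is obtained by conjugating the (T, Z) equation, using that f and Δ_b f are
  -- real.
  have h3 := congrArg (starRingEnd ℂ) h2
  have c1 : starRingEnd ℂ (θ.reeb.act (Z.Z.act fun y => (f y : ℂ)) x) =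
      θ.reeb.act (Z.Z.conj.act fun y => (f y : ℂ)) x := by
    rw [← CField.act_conj _ (m sZ), reeb_conj]
    exact act_congr_on _ Z.isOpen (fun y hy => conj_act_Z_ofReal Z hy hf) hx'
  have c2 : starRingEnd ℂ (Z.Z.act (θ.sublaplacian Z fun y => (f y : ℂ)) x) =
      Z.Z.conj.act (θ.sublaplacian Z fun y => (f y : ℂ)) x := by
    rw [← act_Zbar_conj Z sL hx']
    exact act_congr_on _ Z.isOpen (fun y hy =>
      Complex.conj_eq_iff_re.2 (θ.ofReal_re_sublaplacian Z hf hy)) hx'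
  have c3 : starRingEnd ℂ (Z.Z.conj.act (fun y => (f y : ℂ)) x) = Z.Z.act (fun y => (f y : ℂ)) x := by
    rw [← conj_act_Z_ofReal Z hx' hf, Complex.conj_conj]
  simp only [map_add, map_sub, map_mul, map_neg, map_inv₀, map_zero, Complex.conj_I, c1, c2, c3,
    conj_act_Z_ofReal Z hx' hf, θ.conj_levi Z hx'] at h3
  refine θ.dForm_eq_zero_of_frame Z (θ.smoothFunOn_conjForm_app Z hf Z.isOpen subset_rfl Z.smooth)
    (θ.smoothFunOn_conjForm_app Z hf Z.isOpen subset_rfl Z.smooth.conj)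
    (θ.smoothFunOn_conjForm_app Z hf Z.isOpen subset_rfl (θ.smoothOn_reeb _)) hO hOZ hV hW hx ?_ ?_ ?_
  · rw [dForm, θ.app_bracket_Z Z hx', act_congr_on _ Z.isOpen a1 hx', act_congr_on _ Z.isOpen a2 hx',
      a1 x hx', a2 x hx', a3 x hx', cm _ _ sZ, cm _ _ sZb]
    linear_combination Complex.I * θ.levi_mul_sublaplacian Z hx' hf
  · rw [dForm, θ.app_bracket_reeb_Z Z hx', act_congr_on _ Z.isOpen a1 hx', act_congr_on _ Z.isOpen a3 hx',
      a1 x hx', a2 x hx', cm _ _ sZ]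
    field_simp at h2
    linear_combination h2
  · rw [dForm, θ.app_bracket_reeb_Zbar Z hx', act_congr_on _ Z.isOpen a2 hx',
      act_congr_on _ Z.isOpen a3 hx', a1 x hx', a2 x hx', cm _ _ sZb]
    field_simp at h3
    linear_combination h3

/-- A function with `P_α f = 0` is locally the real part of a CR function. -/
theorem exists_isCRFunctionOn [T2Space M] (h0 : ∀ y ∈ Z.U, θ.thirdOrder Z f y = 0) (hx : x ∈ Z.U) :
    ∃ U : Set M, IsOpen U ∧ x ∈ U ∧ ∃ v : M → ℂ, S.IsCRFunctionOn v U ∧ ∀ y ∈ U, f y = (v y).re := by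
  have app_ofReal : ∀ X : ∀ x : M, TangentSpace (𝓡 3) x,
      (θ.conjForm Z f).app (CField.ofReal X) = fun y => θ.conjForm Z f y (X y) := fun X => by
    funext y
    simp [CForm.app, CField.ofReal]
  obtain ⟨O, g, hO, hxO, hOZ, hg, hdg⟩ := exists_primitive (φ := θ.conjForm Z f) Z.isOpen hx
    (fun O X hO hOZ hX => by
      rw [← app_ofReal]
      exact θ.smoothFunOn_conjForm_app Z hf hO hOZ (CField.SmoothOn.ofReal hX))
    (fun O X Y hO hOZ hX hY y hy => θ.dForm_conjForm Z hf h0 hO hOZ (CField.SmoothOn.ofReal hX)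
      (CField.SmoothOn.ofReal hY) hy)
  have sF : SmoothFunOn (fun y => (f y : ℂ)) O := SmoothFunOn.ofReal (hf.mono hOZ)
  have sg : SmoothFunOn (fun y => ((g y).re : ℂ)) O := SmoothFunOn.ofReal hg.re
  have sIg := (SmoothFunOn.const Complex.I O).mul sg
  -- The CR function is f + i Re g. Taking Re g makes the real part equal to f at once; on H the
  -- form `conjForm` is real, as `r1` and `r2` show, so nothing is lost there.
  refine ⟨O, hO, hxO, fun y => f y + Complex.I * (g y).re, ⟨sF.add sIg, fun y hy w => ?_⟩, fun y _ => by simp⟩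
  have hyZ := hOZ hy
  obtain ⟨P, Q, hP, hQ, hZ, hZb⟩ := dFun_frame Z hyZ hf
  have m : ∀ {u : M → ℂ}, SmoothFunOn u O → MDifferentiableAt (𝓡 3) 𝓘(ℝ, ℂ) u y :=
    fun hu => hu.mdifferentiableAt hO hy
  have dv : ∀ w, dFun (fun y => (f y : ℂ) + Complex.I * (g y).re) y w =
      dFun (fun y => (f y : ℂ)) y w + Complex.I * ((θ.conjForm Z f y w).re : ℂ) := fun w => by
    rw [dFun_add (m sF) (m sIg), dFun_const_mul (m sg), ← hdg y hy]
    congr 2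
    exact dFun_clm (m hg) (Complex.ofRealCLM.comp Complex.reCLM) w
  have e1 := θ.frameForm_app_Z Z (fun y => -Complex.I * Z.Z.act (fun y => (f y : ℂ)) y)
    (fun y => Complex.I * Z.Z.conj.act (fun y => (f y : ℂ)) y)
    (θ.sublaplacian Z fun y => (f y : ℂ)) hyZ
  have e2 := θ.frameForm_app_Zbar Z (fun y => -Complex.I * Z.Z.act (fun y => (f y : ℂ)) y)
    (fun y => Complex.I * Z.Z.conj.act (fun y => (f y : ℂ)) y)
    (θ.sublaplacian Z fun y => (f y : ℂ)) hyZ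
  change θ.conjForm Z f y (Z.Z.re y) + Complex.I * θ.conjForm Z f y (Z.Z.im y) = _ at e1
  change θ.conjForm Z f y (Z.Z.re y) + Complex.I * θ.conjForm Z f y (-Z.Z.im y) = _ at e2
  rw [map_neg] at e2
  simp only [hZ, hZb] at e1 e2
  have r1 : θ.conjForm Z f y (Z.Z.re y) = Q := by
    linear_combination e1 / 2 + e2 / 2 - Q * Complex.I_sq
  have r2 : θ.conjForm Z f y (Z.Z.im y) = (-P : ℝ) := by
    push_cast
    linear_combination -Complex.I * (e1 - e2) / 2 + (P + θ.conjForm Z f y (Z.Z.im y)) * Complex.I_sq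
  obtain ⟨a, b, hab⟩ := Z.exists_eq_smul_add hyZ w.2
  obtain ⟨hr, hi⟩ := Z.mem hyZ
  have ew : w = a • ⟨Z.Z.re y, hr⟩ + b • ⟨Z.Z.im y, hi⟩ := Subtype.ext hab
  have eJ : ((S.J y w : S.H y) : TangentSpace (𝓡 3) y) = a • (-Z.Z.im y) + b • Z.Z.re y := by
    rw [ew, map_add, map_smul, map_smul]
    change a • ((S.J y ⟨Z.Z.re y, hr⟩ : S.H y) : TangentSpace (𝓡 3) y)
      + b • ((S.J y ⟨Z.Z.im y, hi⟩ : S.H y) : TangentSpace (𝓡 3) y) = _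
    rw [Z.J_re hyZ _ rfl, Z.J_im hyZ _ rfl]
  rw [dv, dv, eJ, hab]
  simp only [map_add, map_smul, map_neg, r1, r2, hP, hQ, Complex.add_re, Complex.real_smul,
    Complex.re_ofReal_mul, Complex.neg_re, Complex.ofReal_re]
  push_cast
  linear_combination (a * P + b * Q) * Complex.I_sq

/-- The real part `f` of a CR function satisfies `P_α f = 0`. -/
theorem thirdOrder_eq_zero [T2Space M] {v : M → ℂ} (hv : S.IsCRFunctionOn v Z.U)
    (hfv : ∀ y ∈ Z.U, f y = (v y).re) (hx : x ∈ Z.U) : θ.thirdOrder Z f x = 0 := by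
  have sF : SmoothFunOn (fun y => (f y : ℂ)) Z.U := SmoothFunOn.ofReal hf
  have sv : SmoothFunOn v Z.U := hv.1
  have h1 : ∀ y ∈ Z.U, Z.Z.conj.act v y = 0 := fun y hy => by
    obtain ⟨hr, e⟩ := Z.one_zero y hy
    have h := hv.2 y hy ⟨Z.Z.re y, hr⟩
    rw [CField.act, CForm.app]
    change dFun v y (Z.Z.re y) + Complex.I * dFun v y (-Z.Z.im y) = 0
    rw [e, neg_neg]
    exact h
  have h2 : ∀ y ∈ Z.U, Z.Z.act (fun y => starRingEnd ℂ (v y)) y = 0 := fun y hy => by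
    rw [act_Z_conj Z sv hy, h1 y hy, map_zero]
  have k1 : θ.dUp Z (tens 0 v sv) = 0 := by
    rw [dUp_tens, tens_eq_zero]
    intro y hy
    simp only [nablaUp_zero, h1 y hy, mul_zero]
  have k2 : θ.dDown Z (tens 0 _ sv.conj) = 0 := by
    rw [dDown_tens, tens_eq_zero]
    intro y hy
    rw [nablaDown_zero, h2 y hy]
  -- 2f = v + v̄, and P_α annihilates v because ∇¹v = 0 and v̄ because ∇₁v̄ = 0.
  have e : tens 0 _ sF + tens 0 _ sF = tens 0 v sv + tens 0 _ sv.conj := by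
    rw [tens_add, tens_add, tens_inj]
    intro y hy
    rw [Complex.add_conj, hfv y hy]
    push_cast
    ring
  have k3 := WebsterCalculus.third_eq_zero_of_U (D := θ.dDown Z) (A := tens 2 _ (θ.smoothFunOn_torsion Z)) _ k1
  have k4 := (θ.websterCalculus Z).third_eq_zero_of_D _ (dDegree_tens_zero Z _) k2
  obtain ⟨h, e5⟩ := θ.third_tens Z sF
  have k5 := congrArg (WebsterCalculus.third (θ.dDown Z) (θ.dUp Z) (tens 2 _ (θ.smoothFunOn_torsion Z))) e
  rw [WebsterCalculus.third_add, WebsterCalculus.third_add, k3, k4, e5, tens_add, add_zero,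
    tens_eq_zero] at k5
  rw [θ.thirdOrder_eq Z hx hf]
  linear_combination k5 x hx / 2

/-- P₄ is four times the divergence of P_α. The hypothesis is needed on the whole domain, since P_α
f gets differentiated. -/
theorem paneitz_eq_zero [T2Space M] (h0 : ∀ y ∈ Z.U, θ.thirdOrder Z f y = 0) (hx : x ∈ Z.U) :
    θ.paneitz Z f x = 0 := by
  have sF : SmoothFunOn (fun y => (f y : ℂ)) Z.U := SmoothFunOn.ofReal hf
  obtain ⟨h1, e1⟩ := θ.third_tens Z sF
  obtain ⟨h2, e2⟩ := θ.paneitz_tens Z sF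
  have e3 : tens 1 (θ.thirdC Z fun y => (f y : ℂ)) h1 = 0 := (tens_eq_zero _ _).2 fun y hy => by
    rw [← θ.thirdOrder_eq Z hy hf, h0 y hy]
  have H := (θ.websterCalculus Z).paneitz_eq (tens 0 _ sF) (dDegree_tens_zero Z _)
  rw [e1, e2, e3, map_zero, mul_zero, tens_eq_zero] at H
  have := H x hx
  rw [← θ.ofReal_paneitz Z hx hf] at this
  exact_mod_cast this

omit hf in
include θ in
/-- Functions with prescribed derivative in the direction of `Z̄` at a point. -/
theorem exists_act_Zbar_eq [T2Space M] (hx : x ∈ Z.U) (c : ℂ) :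
    ∃ σ : M → ℝ, ContMDiff (𝓡 3) 𝓘(ℝ, ℝ) ∞ σ ∧ σ x = 0 ∧
    Z.Z.conj.act (fun y => (σ y : ℂ)) x = starRingEnd ℂ c := by
  -- With dσ = Re(2c θ¹), and θ¹ equal to 1/2 on Re Z and −i/2 on Im Z, the derivatives of σ along
  -- these are Re c and Im c, so Z̄σ = c̄.
  obtain ⟨σ, hσ, h0, hd⟩ := exists_contMDiff_mfderiv_eq x
    (Complex.reCLM.comp ((2 * c) • θ.coframe Z x))
  refine ⟨σ, hσ, h0, ?_⟩
  have m := mdifferentiableAt_of_smooth isOpen_univ hσ.contMDiffOn (Set.mem_univ x)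
  have e : ∀ w, dFun (fun y => (σ y : ℂ)) x w = ((2 * c * θ.coframe Z x w).re : ℂ) := fun w => by
    rw [dFun_ofReal m]
    exact congrArg _ (congrArg (fun l : TangentSpace (𝓡 3) x →L[ℝ] ℝ => l w) hd)
  rw [CField.act, CForm.app]
  change dFun (fun y => (σ y : ℂ)) x (Z.Z.re x) + Complex.I * dFun (fun y => (σ y : ℂ)) x (-Z.Z.im x) = _
  rw [map_neg, e, e, θ.coframe_re Z hx, θ.coframe_im Z hx]
  apply Complex.ext <;> simp <;> ring

omit hf in
/-- CR pluriharmonic functions are characterized by `P_α f = 0`. -/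
theorem isPluriharmonic_iff [T2Space M] (hf : ContMDiff (𝓡 3) 𝓘(ℝ, ℝ) ∞ f) :
    S.IsPluriharmonic f ↔ ∀ (Z : S.Frame), ∀ x ∈ Z.U, θ.thirdOrder Z f x = 0 := by
  refine ⟨fun h Z x hx => ?_, fun h => ⟨hf, fun p => ?_⟩⟩
  · obtain ⟨U, hU, hxU, v, hv, hfv⟩ := h.2 x
    -- The CR function exists only near x, so the frame is restricted to its domain.
    have h := θ.thirdOrder_eq_zero (Z.restrict (hU.inter Z.isOpen) Set.inter_subset_right)
      hf.contMDiffOn (v := v) ⟨hv.1.mono Set.inter_subset_left, fun y hy => hv.2 y hy.1⟩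
      (fun y hy => hfv y hy.1) ⟨hxU, hx⟩
    rwa [θ.thirdOrder_congr (Z := Z) (Z' := Z.restrict (hU.inter Z.isOpen) _) rfl] at h
  · obtain ⟨Z, hp⟩ := S.exists_frame p
    exact θ.exists_isCRFunctionOn Z hf.contMDiffOn (h Z) hp

end ContactForm

end CRGeometry
end

/-! ### Part: the theorem. -/

open scoped Manifold ContDiff
open CRGeometry
theorem mainTheorem9 {M : Type*} [TopologicalSpace M] [T2Space M]
    [ChartedSpace (EuclideanSpace ℝ (Fin 3)) M] [IsManifold (𝓡 3) ∞ M]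
    (S : CRStructure M) (θ : ContactForm S) :
    (∀ (σ : M → ℝ) (hσ : ContMDiff (𝓡 3) 𝓘(ℝ, ℝ) ∞ σ)
        (f : M → ℝ), ContMDiff (𝓡 3) 𝓘(ℝ, ℝ) ∞ f →
      ∀ (x : M) (Z Z' : S.Frame), x ∈ Z.U → x ∈ Z'.U →
        Real.exp (2 * σ x) * (θ.rescale σ hσ).paneitzPrime Z' f x =
          θ.paneitzPrime Z f x + θ.paneitz Z (fun y => f y * σ y) x
            - σ x * θ.paneitz Z f x - 16 * (θ.thirdOrderPairing Z f σ x).re) ∧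
    (∀ f : M → ℝ, ContMDiff (𝓡 3) 𝓘(ℝ, ℝ) ∞ f →
      (S.IsPluriharmonic f ↔
        ∀ (σ : M → ℝ) (hσ : ContMDiff (𝓡 3) 𝓘(ℝ, ℝ) ∞ σ)
          (x : M) (Z Z' : S.Frame), x ∈ Z.U → x ∈ Z'.U →
            Real.exp (2 * σ x) * (θ.rescale σ hσ).paneitzPrime Z' f x =
              θ.paneitzPrime Z f x + θ.paneitz Z (fun y => f y * σ y) x)) := by
  refine ⟨fun σ hσ f hf x Z Z' hx hx' => θ.paneitzPrime_rescale Z σ hσ hf hx hx', fun f hf => ?_⟩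
  rw [θ.isPluriharmonic_iff hf]
  constructor
  · intro h σ hσ x Z Z' hx hx'
    rw [θ.paneitzPrime_rescale Z σ hσ hf hx hx', θ.paneitz_eq_zero Z hf.contMDiffOn (h Z) hx,
      ContactForm.thirdOrderPairing, h Z x hx]
    simp
  · intro h Z x hx
    -- With σ(x) = 0 the term σ P₄f drops out. With c = h⁻¹ P₁f and Z̄σ = c̄ at x, the pairing
    -- equals |c|², so its vanishing forces P₁f = 0.
    obtain ⟨σ, hσ, h0, hd⟩ := θ.exists_act_Zbar_eq Z hx (θ.thirdOrder Z f x * (θ.levi Z x)⁻¹)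
    have h1 := h σ hσ x Z Z hx hx
    rw [θ.paneitzPrime_rescale Z σ hσ hf hx hx, h0, ContactForm.thirdOrderPairing,
      ContactForm.nablaUp_zero] at h1
    have h2 : (θ.thirdOrder Z f x * ((θ.levi Z x)⁻¹ * Z.Z.conj.act (fun y => (σ y : ℂ)) x)).re = 0 := by
      linarith
    rw [hd, ← mul_assoc, Complex.mul_conj, Complex.ofReal_re, Complex.normSq_eq_zero] at h2
    exact (mul_eq_zero.1 h2).resolve_right (inv_ne_zero (θ.levi_ne_zero Z hx))
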